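/- \textbf{Model.} Let $(\Omega,\mathcal F,\mathbb P)$ be a probability space, $\lambda,\rho>0$, and let $p$ be a probability measure on $\mathbb R$ with $\int |z|\,p(dz)<\infty$ and $\int z\,p(dz)\ge 0$. Let $\underline z\in(0,1]$ and $\bar z\in(0,\infty]$ be such that the support of $p$ is either an interval with interior $(-\underline z,\bar z)$, or a finite set with minimum $-\underline z$ and maximum $\bar z<\infty$. Let $k,b\ge 0$ be such that $\int(1+z)\,p(dz)\le k e^{bt}$ for all $t\ge 0$. The trading dates $0=\tau_0<\tau_1<\tau_2<\cdots$ are the jump times of a Poisson process of intensity $\lambda$ and $Z_k\in(-1,\infty)$, $k\ge1$, are the observed returns ($Z_0$ is a constant). The model is stationary: for every $k\ge 1$, $\tau_k-\tau_{k-1}$ is exponentially distributed with parameter $\lambda$ and independent of $(\tau_i,Z_i)_{i<k}$, and $Z_k$ has law $p$ and is independent of $(\tau_k-\tau_{k-1},(\tau_i,Z_i)_{i<k})$. Put $\mathcal G_t=\sigma\{(\tau_k,Z_k):\tau_k\le t\}$. The utility $U:[0,\infty)\to\mathbb R$ is strictly increasing and strictly concave, is $C^1$ on $(0,\infty)$,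 and satisfies $U(0)=0$, $U'(0^+)=+\infty$, $U'(+\infty)=0$ and $U(x)\le K_1x^\gamma$ for $x\ge0$, with some $\gamma\in(0,1)$ and $K_1>0$. Assume $\rho>b\gamma+\lambda\big(k^\gamma/\underline z^\gamma-1\big)$. For $x\ge 0$ let $$v(x)=\sup_{(\alpha,c)}\mathbb E\int_0^\infty e^{-\rho t}U(c_t)\,dt,$$ the supremum being over all pairs of a real sequence $(\alpha_k)_{k\ge1}$ with $\alpha_k$ $\mathcal G_{\tau_{k-1}}$-measurable and a nonnegative $(\mathcal G_t)$-predictable process $c$ such that, for every $k\ge1$, almost surely $\int_0^{\tau_k}c_t\,dt<\infty$ and $x-\int_0^{\tau_k}c_t\,dt+\sum_{i=1}^k\alpha_iZ_i\ge0$. Let $A=\mathbb R$ and $l(a)=\max(a\underline z,-a\bar z)$ if $\bar z<\infty$, and let $A=[0,\infty)$ and $l(a)=a\underline z$ if $\bar z=\infty$. For $a\in A$ and $y\ge l(a)$ put $g(y)=g(y,a)=\lambda\int v(y+az)\,p(dz)$. For $a\in A$ and $x\ge l(a)$, the auxiliary problem is to maximize $$\int_0^\infty e^{-(\rho+\lambda)s}\big[U(c_s)+g(Y_s,a)\big]\,ds,\qquad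 Y_s=x-\int_0^sc_u\,du,$$ over measurable, locally integrable $c:[0,\infty)\to[0,\infty)$ with $\int_0^t c_u\,du\le x-l(a)$ for all $t\ge0$. The process $Y$ of an optimal couple $(c,Y)$ is the wealth between two trading dates (time being reset to $0$ at the last trading date, at which the wealth is $x$ and the amount $a$ is invested). \textbf{Proposition.} Suppose in addition that $U\in C^2((0,\infty))$ with $U''(y)<0$ for all $y>0$. Let $a\in A$ and $x>l(a)$. Then the auxiliary problem has an optimal control, and for every optimal control the wealth process $Y$ between two trading dates is twice differentiable on $[0,\infty)$ (one-sidedly at $0$), one has $Y_t>l(a)$ and $c_t:=-\dfrac{dY_t}{dt}>0$ for all $t\ge0$, the function $g=g(\cdot,a)$ is differentiable at $Y_t$, and $$\frac{d^2Y_t}{dt^2}=\frac{g'(Y_t)-(\rho+\lambda)U'(c_t)}{U''(c_t)},\qquad t\ge0.$$ -/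

import Mathlib

open MeasureTheory ProbabilityTheory Set
open scoped NNReal ENNReal

noncomputable section

/-- Stationary return law `p` with support bounds `-zlo` and `zhi` (where `zhi = ⊤` is allowed)
and growth constants `kap`, `b`. -/
structure IsReturnLaw (p : Measure ℝ) (zlo : ℝ) (zhi : EReal) (kap b : ℝ) : Prop where
  isProb : IsProbabilityMeasure p
  zlo_pos : 0 < zlo
  zlo_le_one : zlo ≤ 1
  zhi_pos : 0 < zhi
  support_eq :
    (p.support.OrdConnected ∧ interior p.support = {z : ℝ | -zlo < z ∧ (z : EReal) < zhi}) ∨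
    (p.support.Finite ∧ IsLeast p.support (-zlo) ∧
      ∃ r : ℝ, zhi = (r : EReal) ∧ IsGreatest p.support r)
  integrable : Integrable (fun z : ℝ => z) p
  mean_nonneg : 0 ≤ ∫ z, z ∂p
  kap_nonneg : 0 ≤ kap
  b_nonneg : 0 ≤ b
  growth : ∀ t : ℝ, 0 ≤ t → ∫ z, (1 + z) ∂p ≤ kap * Real.exp (b * t)

/-- Standing assumptions on the utility function `U` (only its values on `[0, ∞)` matter). -/
structure IsUtility (U : ℝ → ℝ) (γ K₁ : ℝ) : Prop where
  strictMono : StrictMonoOn U (Ici 0)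
  strictConcave : StrictConcaveOn ℝ (Ici 0) U
  contDiff : ContDiffOn ℝ 1 U (Ioi 0)
  zero : U 0 = 0
  inada_zero : Filter.Tendsto (deriv U) (nhdsWithin 0 (Ioi 0)) Filter.atTop
  inada_top : Filter.Tendsto (deriv U) Filter.atTop (nhds 0)
  γ_pos : 0 < γ
  γ_lt_one : γ < 1
  K₁_pos : 0 < K₁
  growth : ∀ x : ℝ, 0 ≤ x → U x ≤ K₁ * x ^ γ

/-- Trading dates `τ` and observed returns `Z`, in the stationary case. The trading dates are the
jump times of a Poisson process with intensity `lam` whose interarrival times are independent of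
the observations already made (Poisson process relative to the observed information); the `(k+1)`-st return has law `p` and is independent of the
`(k+1)`-st interarrival time and of everything observed up to `τ k`. -/
structure IlliquidMarket {Ω : Type*} [MeasurableSpace Ω] (P : Measure Ω) (lam : ℝ)
    (p : Measure ℝ) where
  τ : ℕ → Ω → ℝ≥0
  Z : ℕ → Ω → ℝ
  measurable_τ : ∀ k, Measurable (τ k)
  measurable_Z : ∀ k, Measurable (Z k)
  τ_zero : ∀ ω, τ 0 ω = 0
  τ_lt : ∀ k ω, τ k ω < τ (k + 1) ω
  Z_zero : ∃ z₀ : ℝ, ∀ ω, Z 0 ω = z₀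
  Z_gt : ∀ k ω, -1 < Z (k + 1) ω
  law_interarrival : ∀ k, HasLaw (fun ω => (τ (k + 1) ω : ℝ) - τ k ω) (expMeasure lam) P
  indep_interarrival : ∀ k,
    IndepFun (fun ω => (τ (k + 1) ω : ℝ) - τ k ω)
      (fun ω (i : Fin (k + 1)) => (τ i ω, Z i ω)) P
  law_return : ∀ k, HasLaw (Z (k + 1)) p P
  indep_return : ∀ k,
    IndepFun (Z (k + 1))
      (fun ω => ((τ (k + 1) ω : ℝ) - τ k ω, fun i : Fin (k + 1) => (τ i ω, Z i ω))) P

namespace IlliquidMarket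

variable {Ω : Type*} [mΩ : MeasurableSpace Ω] {P : Measure Ω} {lam : ℝ} {p : Measure ℝ}

/-- The events `{τ k ≤ s, Z k ∈ B}` with `s ≤ t`. -/
def obsEvents (M : IlliquidMarket P lam p) (t : ℝ≥0) : Set (Set Ω) :=
  {A | ∃ (k : ℕ) (s : ℝ≥0) (B : Set ℝ), s ≤ t ∧ MeasurableSet B ∧
    A = {ω | M.τ k ω ≤ s ∧ M.Z k ω ∈ B}}

/-- The continuous observation filtration `𝓖_t = σ{(τ_k, Z_k) : τ_k ≤ t}`. -/
def obs (M : IlliquidMarket P lam p) : Filtration ℝ≥0 mΩ where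
  seq t := MeasurableSpace.generateFrom (M.obsEvents t)
  mono' := by
    intro t t' h
    apply MeasurableSpace.generateFrom_mono
    rintro A ⟨k, s, B, hs, hB, rfl⟩
    exact ⟨k, s, B, hs.trans h, hB, rfl⟩
  le' := by
    intro t
    apply MeasurableSpace.generateFrom_le
    rintro A ⟨k, s, B, -, hB, rfl⟩
    exact (measurableSet_le (M.measurable_τ k) measurable_const).inter (M.measurable_Z k hB)

theorem isStoppingTime_τ (M : IlliquidMarket P lam p) (k : ℕ) :
    IsStoppingTime M.obs (fun ω => (M.τ k ω : WithTop ℝ≥0)) := by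
  intro t
  apply MeasurableSpace.measurableSet_generateFrom
  exact ⟨k, t, univ, le_rfl, MeasurableSet.univ, by
    ext ω
    simp only [mem_univ, and_true, mem_ofPred_eq, WithTop.coe_le_coe]⟩

/-- The wealth `X_k = x - ∫_0^{τ_k} c_t dt + ∑_{i=1}^k α_i Z_i`. -/
def wealth (M : IlliquidMarket P lam p) (x : ℝ) (α : ℕ → Ω → ℝ) (c : ℝ≥0 → Ω → ℝ) (k : ℕ)
    (ω : Ω) : ℝ :=
  x - (∫ t in Ioc (0 : ℝ) (M.τ k ω), c t.toNNReal ω) +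
    ∑ i ∈ Finset.range k, α (i + 1) ω * M.Z (i + 1) ω

/-- Admissible investment/consumption policies from initial capital `x`. -/
structure Admissible (M : IlliquidMarket P lam p) (x : ℝ) (α : ℕ → Ω → ℝ) (c : ℝ≥0 → Ω → ℝ) :
    Prop where
  investment : ∀ k, Measurable[(M.isStoppingTime_τ k).measurableSpace] (α (k + 1))
  consumption : IsStronglyPredictable M.obs c
  nonneg : ∀ t ω, 0 ≤ c t ω
  integrable : ∀ k, ∀ᵐ ω ∂P,
    IntegrableOn (fun t : ℝ => c t.toNNReal ω) (Ioc (0 : ℝ) (M.τ (k + 1) ω))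
  wealth_nonneg : ∀ k, ∀ᵐ ω ∂P, 0 ≤ M.wealth x α c (k + 1) ω

/-- Expected discounted utility from consumption. -/
def expectedUtility (P : Measure Ω) (U : ℝ → ℝ) (ρ : ℝ) (c : ℝ≥0 → Ω → ℝ) : ℝ≥0∞ :=
  ∫⁻ ω, (∫⁻ t in Ioi (0 : ℝ), ENNReal.ofReal (Real.exp (-ρ * t) * U (c t.toNNReal ω))) ∂P

/-- The value function `v` of the original problem. -/
def value (M : IlliquidMarket P lam p) (U : ℝ → ℝ) (ρ x : ℝ) : ℝ :=
  (⨆ (α : ℕ → Ω → ℝ) (c : ℝ≥0 → Ω → ℝ) (_ : M.Admissible x α c),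
    expectedUtility P U ρ c).toReal

/-- `g(x, a) = λ ∫ v(x + a z) p(dz)`. -/
def g (M : IlliquidMarket P lam p) (U : ℝ → ℝ) (ρ a x : ℝ) : ℝ :=
  lam * ∫ z, M.value U ρ (x + a * z) ∂p

end IlliquidMarket

/-- `l(a) = max(a zlo, -a zhi)`, with the convention `l(a) = a zlo` when `zhi = ∞`. -/
def lowerWealth (zlo : ℝ) (zhi : EReal) (a : ℝ) : ℝ :=
  open Classical in if zhi = ⊤ then a * zlo else max (a * zlo) (-a * zhi.toReal)

/-- The set `A` of investments: `ℝ` if `zhi < ∞` and `[0, ∞)` if `zhi = ∞`. -/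
def investmentSet (zhi : EReal) : Set ℝ := {a | zhi = ⊤ → 0 ≤ a}

/-- `Y_s = x - ∫_0^s c_u du`, the wealth between two trading dates (time being reset to `0` at the
last trading date). -/
def wealthBetween (x : ℝ) (c : ℝ → ℝ) (s : ℝ) : ℝ := x - ∫ u in (0 : ℝ)..s, c u

/-- Deterministic nonnegative consumption rates on `[0, ∞)` with `∫_0^t c ≤ x - l` for all `t`. -/
structure AuxAdmissible (l x : ℝ) (c : ℝ → ℝ) : Prop where
  measurable : Measurable c
  nonneg : ∀ t, 0 ≤ t → 0 ≤ c t
  integrable : ∀ t, 0 ≤ t → IntervalIntegrable c volume 0 t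
  budget : ∀ t, 0 ≤ t → ∫ u in (0 : ℝ)..t, c u ≤ x - l

/-- `∫_0^∞ e^{-δ s} [U(c_s) + G(Y_s)] ds`. -/
def auxReward (U G : ℝ → ℝ) (δ x : ℝ) (c : ℝ → ℝ) : ℝ≥0∞ :=
  ∫⁻ s in Ioi (0 : ℝ), ENNReal.ofReal (Real.exp (-δ * s) * (U (c s) + G (wealthBetween x c s)))

/-- The value function of the auxiliary problem (as a function of the initial wealth `x`). -/
def auxValue (U G : ℝ → ℝ) (δ l x : ℝ) : ℝ≥0∞ :=
  ⨆ (c : ℝ → ℝ) (_ : AuxAdmissible l x c), auxReward U G δ x c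

/-- `c` is an optimal control for the auxiliary problem. -/
def IsAuxOptimal (U G : ℝ → ℝ) (δ l x : ℝ) (c : ℝ → ℝ) : Prop :=
  AuxAdmissible l x c ∧ auxReward U G δ x c = auxValue U G δ l x

end

/-! The randomness enters only through `g(·, a)`. Once this function is known to be nonnegative,
increasing, concave and continuous on `[l(a), ∞)` and differentiable above `l(a)`
(`isRunningReward_g`), what is left is a deterministic problem in the calculus of variations with
discount rate `δ = ρ + lam`.

Moments. If the wealth `r + a z` after a trade is almost surely nonnegative, then the support point
`-zlo` gives `a zlo ≤ r`. By Jensen the expected `β`-th power of wealth then grows by a factor of at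
most `(kap / zlo) ^ β` per trade, while discounting over an exponential waiting time contributes
`lam / (lam + ρ)`. The hypothesis on `ρ` makes the product less than 1 for `β = γ`, hence also for
some `β > γ`. A geometric series bounds the discounted `β`-th moment of every admissible consumption
(`Admissible.lintegral_consumption_rpow_le`), so `v` is finite. Convexity of the set of policies
makes `v` concave.

Differentiability of `v`. A policy for `x`, multiplied by `1 ± r`, is a policy for `(1 ± r) x`. The
second differences `2 U(y) - U((1 + r) y) - U((1 - r) y)` are at most `r η (1 + y ^ β)` for small
`r` (`IsUtility.second_difference`). The moment bound for `β > γ` makes this integrable uniformly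
over policies, so the second differences of `v` at `x` are `o(h)`, which for a concave function
excludes a kink. Averaging over `z` transfers the property to `g`.

Existence. Along a maximizing sequence, midpoints are admissible and cannot beat the supremum, so
the strict concavity gaps of `U` tend to 0 in mean. This yields almost everywhere convergence of a
subsequence. Fatou's lemma makes the limit admissible, and since `U'(∞) = 0` no utility is lost with
the consumption that may escape to infinity (`exists_isAuxOptimal`).

Regularity. The condition `U'(0+) = ∞` forces `c > 0` almost everywhere, hence `Y > l(a)` at all
times. Two-sided perturbations of zero mean then give the integrated Euler equation `e^{-δ s}
U'(c_s) + ∫_0^s e^{-δ u} g'(Y_u) du = const` almost everywhere (`exists_ae_euler`). Since `g'` is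
continuous, inverting `U'` produces a differentiable version `κ` of `c`. Changing `c` on a null set
does not change `Y`, so `Y' = -κ` everywhere, and differentiating the Euler equation gives the
formula for `Y''`. -/

namespace IlliquidMarket

/-! ### Information available between trading dates -/

variable {Ω : Type*} [mΩ : MeasurableSpace Ω] {P : Measure Ω} {lam : ℝ} {p : Measure ℝ}

/-- The observations up to the `k`-th trading date. -/
def past (M : IlliquidMarket P lam p) (k : ℕ) (ω : Ω) : Fin (k + 1) → ℝ≥0 × ℝ :=
  fun i => (M.τ i ω, M.Z i ω)

/-- The observations just before the return of the `(k+1)`-st trading date is revealed. -/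
def prePast (M : IlliquidMarket P lam p) (k : ℕ) (ω : Ω) : ℝ × (Fin (k + 1) → ℝ≥0 × ℝ) :=
  ((M.τ (k + 1) ω : ℝ) - M.τ k ω, M.past k ω)

/-- The σ-algebra generated by the observations up to the `k`-th trading date. -/
abbrev pastσ (M : IlliquidMarket P lam p) (k : ℕ) : MeasurableSpace Ω :=
  MeasurableSpace.comap (M.past k) inferInstance

/-- The σ-algebra of the information just before the `(k+1)`-st return is revealed. -/
abbrev prePastσ (M : IlliquidMarket P lam p) (k : ℕ) : MeasurableSpace Ω :=
  MeasurableSpace.comap (M.prePast k) inferInstance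

theorem measurable_past (M : IlliquidMarket P lam p) (k : ℕ) : Measurable (M.past k) :=
  measurable_pi_lambda _ fun i => (M.measurable_τ i).prodMk (M.measurable_Z i)

theorem measurable_prePast (M : IlliquidMarket P lam p) (k : ℕ) : Measurable (M.prePast k) :=
  ((M.measurable_τ (k + 1)).coe_nnreal_real.sub (M.measurable_τ k).coe_nnreal_real).prodMk
    (M.measurable_past k)

theorem pastσ_le (M : IlliquidMarket P lam p) (k : ℕ) : M.pastσ k ≤ mΩ :=
  (M.measurable_past k).comap_le

theorem pastσ_le_prePastσ (M : IlliquidMarket P lam p) (k : ℕ) : M.pastσ k ≤ M.prePastσ k := by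
  have h : Measurable[M.prePastσ k] (M.past k) :=
    measurable_snd.comp (comap_measurable (M.prePast k))
  exact h.comap_le

theorem measurable_pair_pastσ (M : IlliquidMarket P lam p) {j k : ℕ} (h : j ≤ k) :
    Measurable[M.pastσ k] (fun ω => (M.τ j ω, M.Z j ω)) :=
  (measurable_pi_apply (⟨j, by omega⟩ : Fin (k + 1))).comp (comap_measurable (M.past k))

theorem measurable_τ_pastσ (M : IlliquidMarket P lam p) {j k : ℕ} (h : j ≤ k) :
    Measurable[M.pastσ k] (M.τ j) :=
  measurable_fst.comp (M.measurable_pair_pastσ h)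

theorem measurable_Z_pastσ (M : IlliquidMarket P lam p) {j k : ℕ} (h : j ≤ k) :
    Measurable[M.pastσ k] (M.Z j) :=
  measurable_snd.comp (M.measurable_pair_pastσ h)

theorem measurable_τ_prePastσ (M : IlliquidMarket P lam p) (k : ℕ) :
    Measurable[M.prePastσ k] (M.τ (k + 1)) := by
  have h1 : Measurable[M.prePastσ k] (fun ω => (M.τ (k + 1) ω : ℝ) - M.τ k ω) :=
    measurable_fst.comp (comap_measurable (M.prePast k))
  have h2 : Measurable[M.prePastσ k] (fun ω => (M.τ k ω : ℝ)) :=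
    measurable_coe_nnreal_real.comp
      ((M.measurable_τ_pastσ le_rfl).mono (M.pastσ_le_prePastσ k) le_rfl)
  have h3 : M.τ (k + 1) = fun ω => (((M.τ (k + 1) ω : ℝ) - M.τ k ω) + M.τ k ω).toNNReal := by
    funext ω
    simp
  rw [h3]
  exact measurable_real_toNNReal.comp (h1.add h2)

theorem pastσ_mono (M : IlliquidMarket P lam p) {j k : ℕ} (h : j ≤ k) :
    M.pastσ j ≤ M.pastσ k := by
  have h' : Measurable[M.pastσ k] (M.past j) :=
    @measurable_pi_lambda _ _ _ (M.pastσ k) _ _ fun i => M.measurable_pair_pastσ (by omega)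
  exact h'.comap_le

theorem prePastσ_le_pastσ (M : IlliquidMarket P lam p) (k : ℕ) :
    M.prePastσ k ≤ M.pastσ (k + 1) := by
  have h1 : Measurable[M.pastσ (k + 1)] (M.past k) :=
    @measurable_pi_lambda _ _ _ (M.pastσ (k + 1)) _ _ fun i => M.measurable_pair_pastσ (by omega)
  have h2 : Measurable[M.pastσ (k + 1)] (fun ω => (M.τ (k + 1) ω : ℝ) - M.τ k ω) :=
    (measurable_coe_nnreal_real.comp (M.measurable_τ_pastσ le_rfl)).sub
      (measurable_coe_nnreal_real.comp (M.measurable_τ_pastσ (Nat.le_succ k)))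
  have h3 : Measurable[M.pastσ (k + 1)] (M.prePast k) := h2.prodMk h1
  exact h3.comap_le

theorem monotone_τ (M : IlliquidMarket P lam p) (ω : Ω) : Monotone fun k => M.τ k ω :=
  monotone_nat_of_le_succ fun k => (M.τ_lt k ω).le

/-- Before the `(k+1)`-st trading date, only the observations up to the `k`-th one are known. -/
theorem exists_trace_pastσ (M : IlliquidMarket P lam p) (k : ℕ) (t : ℝ≥0) {A : Set Ω}
    (hA : MeasurableSet[M.obs t] A) :
    ∃ B, MeasurableSet[M.pastσ k] B ∧
      A ∩ {ω | t < M.τ (k + 1) ω} = B ∩ {ω | t < M.τ (k + 1) ω} := by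
  refine MeasurableSpace.generateFrom_induction (C := M.obsEvents t)
    (p := fun A _ => ∃ B, MeasurableSet[M.pastσ k] B ∧
      A ∩ {ω | t < M.τ (k + 1) ω} = B ∩ {ω | t < M.τ (k + 1) ω}) ?_ ?_ ?_ ?_ A hA
  · rintro A ⟨j, s, B, hs, hB, rfl⟩ -
    by_cases hj : j ≤ k
    · refine ⟨_, ?_, rfl⟩
      have h1 : MeasurableSet[M.pastσ k] (M.τ j ⁻¹' Iic s) :=
        M.measurable_τ_pastσ hj measurableSet_Iic
      have h2 : MeasurableSet[M.pastσ k] (M.Z j ⁻¹' B) := M.measurable_Z_pastσ hj hB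
      exact h1.inter h2
    -- A date `τ j` with `j > k` cannot have occurred by a time `t < τ (k + 1)`, so the trace of
    -- this generator is empty.
    · refine ⟨∅, @MeasurableSet.empty _ (M.pastσ k), ?_⟩
      rw [empty_inter, ← disjoint_iff_inter_eq_empty, Set.disjoint_left]
      rintro ω ⟨h1, -⟩ h2
      have h3 := M.monotone_τ ω (show k + 1 ≤ j by omega)
      exact absurd (h1.trans hs) (not_le.2 (h2.trans_le h3))
  · exact ⟨∅, @MeasurableSet.empty _ (M.pastσ k), rfl⟩
  · rintro A - ⟨B, hB, h⟩
    refine ⟨Bᶜ, hB.compl, ?_⟩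
    ext ω
    have := Set.ext_iff.1 h ω
    simp only [mem_inter_iff, mem_compl_iff] at this ⊢
    tauto
  · intro A _ h
    choose B hB h using h
    refine ⟨⋃ n, B n, MeasurableSet.iUnion hB, ?_⟩
    rw [iUnion_inter, iUnion_inter]
    exact iUnion_congr h

/-- Some rational `q` lies between `τ k` and `τ (k + 1)`. At time `q` the value of `α` is already
determined, while only `k` returns have been seen. The cut `q < τ (k + 1)` brings in the next date,
so the result is stated for `prePastσ`; this is enough, since the next return is independent of it.
-/
theorem measurable_prePastσ_of_stoppingTime (M : IlliquidMarket P lam p) (k : ℕ) {α : Ω → ℝ}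
    (hα : Measurable[(M.isStoppingTime_τ k).measurableSpace] α) :
    Measurable[M.prePastσ k] α := by
  intro S hS
  have h1 := (hα hS).2
  choose B hB h using fun q : ℚ =>
    M.exists_trace_pastσ k (Real.toNNReal q) (h1 (Real.toNNReal q))
  have h2 : α ⁻¹' S = ⋃ q : ℚ, B q ∩ {ω | Real.toNNReal q < M.τ (k + 1) ω} := by
    simp_rw [← h]
    ext ω
    simp only [mem_iUnion, mem_inter_iff, mem_ofPred_eq, WithTop.coe_le_coe]
    constructor
    · intro hω
      obtain ⟨q, -, h1, h2⟩ := (NNReal.lt_iff_exists_rat_btwn _ _).1 (M.τ_lt k ω)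
      exact ⟨q, ⟨hω, h1.le⟩, h2⟩
    · rintro ⟨q, ⟨hω, -⟩, -⟩
      exact hω
  rw [h2]
  refine MeasurableSet.iUnion fun q => ?_
  exact (M.pastσ_le_prePastσ k _ (hB q)).inter (M.measurable_τ_prePastσ k measurableSet_Ioi)

theorem measurableSet_fst_le_comp_snd {Ω' : Type*} {m : MeasurableSpace Ω'} {T : Ω' → ℝ≥0}
    (hT : Measurable T) : MeasurableSet {x : ℝ≥0 × Ω' | x.1 ≤ T x.2} :=
  measurableSet_le measurable_fst (hT.comp measurable_snd)

/-- Predictability matters here: a generator `(i, ∞) × A` restricted to `t ≤ τ (k + 1)` only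
involves outcomes with `i < τ (k + 1)`, where `A` agrees with a set of `pastσ k`. Hence consumption
up to and including the next date does not depend on the next return. -/
theorem measurableSet_predictable_trace (M : IlliquidMarket P lam p) (k : ℕ) {S : Set (ℝ≥0 × Ω)}
    (hS : MeasurableSet[M.obs.predictable] S) :
    MeasurableSet[MeasurableSpace.prod inferInstance (M.prePastσ k)]
      (S ∩ {x | x.1 ≤ M.τ (k + 1) x.2}) := by
  have hle := measurableSet_fst_le_comp_snd (M.measurable_τ_prePastσ k)
  refine MeasurableSpace.generateFrom_induction
    (C := {s | ∃ A, MeasurableSet[M.obs ⊥] A ∧ s = {⊥} ×ˢ A} ∪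
      {s | ∃ i A, MeasurableSet[M.obs i] A ∧ s = Set.Ioi i ×ˢ A})
    (p := fun S _ => MeasurableSet[MeasurableSpace.prod inferInstance (M.prePastσ k)]
      (S ∩ {x : ℝ≥0 × Ω | x.1 ≤ M.τ (k + 1) x.2})) ?_ ?_ ?_ ?_ S hS
  · rintro S hS -
    rcases hS with ⟨A, hA, rfl⟩ | ⟨i, A, hA, rfl⟩
    · obtain ⟨B, hB, h⟩ := M.exists_trace_pastσ k _ hA
      have h' : (({⊥} : Set ℝ≥0) ×ˢ A) = ({⊥} : Set ℝ≥0) ×ˢ B := by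
        -- Every date after the initial one is positive, so at time 0 the trace is no restriction.
        have h0 : ∀ ω, (⊥ : ℝ≥0) < M.τ (k + 1) ω := fun ω => bot_le.trans_lt (M.τ_lt k ω)
        simp only [h0, ofPred_true, inter_univ] at h
        rw [h]
      rw [h']
      exact (@MeasurableSet.prod _ _ _ (M.prePastσ k) _ _ (measurableSet_singleton _)
        (M.pastσ_le_prePastσ k _ hB)).inter hle
    · obtain ⟨B, hB, h⟩ := M.exists_trace_pastσ k _ hA
      have h' : (Ioi i ×ˢ A) ∩ {x : ℝ≥0 × Ω | x.1 ≤ M.τ (k + 1) x.2} =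
          (Ioi i ×ˢ B) ∩ {x : ℝ≥0 × Ω | x.1 ≤ M.τ (k + 1) x.2} := by
        ext ⟨t, ω⟩
        simp only [mem_inter_iff, mem_prod, mem_Ioi, mem_ofPred_eq]
        have h3 := Set.ext_iff.1 h ω
        simp only [mem_inter_iff, mem_ofPred_eq] at h3
        constructor
        · rintro ⟨⟨h1, h2⟩, h4⟩
          exact ⟨⟨h1, (h3.1 ⟨h2, h1.trans_le h4⟩).1⟩, h4⟩
        · rintro ⟨⟨h1, h2⟩, h4⟩
          exact ⟨⟨h1, (h3.2 ⟨h2, h1.trans_le h4⟩).1⟩, h4⟩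
      rw [h']
      exact (@MeasurableSet.prod _ _ _ (M.prePastσ k) _ _ measurableSet_Ioi
        (M.pastσ_le_prePastσ k _ hB)).inter hle
  · rw [empty_inter]
    exact @MeasurableSet.empty _ (MeasurableSpace.prod inferInstance (M.prePastσ k))
  · intro S _ h
    have : Sᶜ ∩ {x : ℝ≥0 × Ω | x.1 ≤ M.τ (k + 1) x.2} =
        {x : ℝ≥0 × Ω | x.1 ≤ M.τ (k + 1) x.2} \
          (S ∩ {x : ℝ≥0 × Ω | x.1 ≤ M.τ (k + 1) x.2}) := by
      ext x
      simp only [mem_inter_iff, mem_compl_iff, mem_sdiff]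
      tauto
    rw [this]
    exact hle.diff h
  · intro S _ h
    rw [iUnion_inter]
    exact MeasurableSet.iUnion h

theorem measurable_consumption_trace (M : IlliquidMarket P lam p) (k : ℕ) {c : ℝ≥0 → Ω → ℝ}
    (hc : IsStronglyPredictable M.obs c) :
    Measurable[MeasurableSpace.prod inferInstance (M.prePastσ k)]
      ({x : ℝ≥0 × Ω | x.1 ≤ M.τ (k + 1) x.2}.indicator (fun x => c x.1 x.2)) := by
  have hc' : Measurable[M.obs.predictable] (fun x : ℝ≥0 × Ω => c x.1 x.2) :=
    StronglyMeasurable.measurable hc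
  have hle := measurableSet_fst_le_comp_snd (M.measurable_τ_prePastσ k)
  intro B hB
  rw [indicator_preimage]
  classical
  have h1 := M.measurableSet_predictable_trace k (hc' hB)
  have : Set.ite {x : ℝ≥0 × Ω | x.1 ≤ M.τ (k + 1) x.2} ((fun x => c x.1 x.2) ⁻¹' B)
      ((0 : ℝ≥0 × Ω → ℝ) ⁻¹' B) =
      ((fun x => c x.1 x.2) ⁻¹' B ∩ {x | x.1 ≤ M.τ (k + 1) x.2}) ∪
        ((0 : ℝ≥0 × Ω → ℝ) ⁻¹' B \ {x | x.1 ≤ M.τ (k + 1) x.2}) := rfl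
  rw [this]
  exact h1.union ((@measurable_const _ _ _ (MeasurableSpace.prod inferInstance
    (M.prePastσ k)) (0 : ℝ) _ hB).diff hle)

theorem measurable_integral_Ioc_of_indicator {Ω' : Type*} {m : MeasurableSpace Ω'}
    {T : Ω' → ℝ≥0} {c : ℝ≥0 → Ω' → ℝ}
    (h : Measurable ({x : ℝ≥0 × Ω' | x.1 ≤ T x.2}.indicator (fun x => c x.1 x.2))) :
    Measurable (fun ω => ∫ t in Ioc (0 : ℝ) (T ω), c t.toNNReal ω) := by
  have h2 : Measurable (fun x : Ω' × ℝ => (x.2.toNNReal, x.1)) :=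
    (measurable_real_toNNReal.comp measurable_snd).prodMk measurable_fst
  have h3 := (h.comp h2).indicator
    (measurable_snd measurableSet_Ioi : MeasurableSet {x : Ω' × ℝ | x.2 ∈ Ioi 0})
  have h4 := (h3.stronglyMeasurable.integral_prod_right' (ν := (volume : Measure ℝ))).measurable
  convert h4 using 2 with ω
  rw [← integral_indicator measurableSet_Ioc]
  refine integral_congr_ae (Filter.Eventually.of_forall fun t => ?_)
  simp only [indicator, mem_Ioc, mem_ofPred_eq, mem_preimage, mem_Ioi, Function.comp]
  by_cases ht : 0 < t
  · simp only [ht, true_and, if_true, Real.toNNReal_le_iff_le_coe]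
  · simp [ht]

theorem measurable_integral_consumption (M : IlliquidMarket P lam p) (k : ℕ) {c : ℝ≥0 → Ω → ℝ}
    (hc : IsStronglyPredictable M.obs c) :
    Measurable[M.prePastσ k]
      (fun ω => ∫ t in Ioc (0 : ℝ) (M.τ (k + 1) ω), c t.toNNReal ω) :=
  measurable_integral_Ioc_of_indicator (M.measurable_consumption_trace k hc)

theorem measurable_consumption (M : IlliquidMarket P lam p) {c : ℝ≥0 → Ω → ℝ}
    (hc : IsStronglyPredictable M.obs c) : Measurable (fun x : ℝ≥0 × Ω => c x.1 x.2) := by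
  have hc' : Measurable[M.obs.predictable] (fun x : ℝ≥0 × Ω => c x.1 x.2) :=
    StronglyMeasurable.measurable hc
  refine hc'.mono (measurableSpace_le_predictable_of_measurableSet ?_ ?_) le_rfl
  · intro A hA
    exact (measurableSet_singleton _).prod (M.obs.le _ _ hA)
  · intro i A hA
    exact measurableSet_Ioi.prod (M.obs.le _ _ hA)

end IlliquidMarket

/-! ### Return law: support bounds and the one-trade moment inequality -/

namespace IsReturnLaw

variable {p : Measure ℝ} {zlo : ℝ} {zhi : EReal} {kap b : ℝ}

/-- In the interval case only the interior of the support is prescribed; the endpoint is recovered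
because the support is closed. -/
theorem neg_zlo_mem_support (hp : IsReturnLaw p zlo zhi kap b) : -zlo ∈ p.support := by
  rcases hp.support_eq with ⟨-, h⟩ | ⟨-, h, -⟩
  · have h1 : Ioo (-zlo) 0 ⊆ p.support := by
      refine subset_trans ?_ interior_subset
      rw [h]
      intro z hz
      exact ⟨hz.1, (EReal.coe_lt_coe_iff.2 hz.2).trans hp.zhi_pos⟩
    have h2 := closure_minimal h1 Measure.isClosed_support
    rw [closure_Ioo (by linarith [hp.zlo_pos] : -zlo ≠ 0)] at h2
    exact h2 ⟨le_rfl, by linarith [hp.zlo_pos]⟩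
  · exact h.1

theorem neg_zlo_le (hp : IsReturnLaw p zlo zhi kap b) {z : ℝ} (hz : z ∈ p.support) :
    -zlo ≤ z := by
  rcases hp.support_eq with ⟨ho, h⟩ | ⟨-, h, -⟩
  · by_contra! hlt
    have h1 : Ioo z (-zlo) ⊆ interior p.support :=
      interior_maximal (Ioo_subset_Icc_self.trans (ho.out hz hp.neg_zlo_mem_support)) isOpen_Ioo
    rw [h] at h1
    have h2 := (h1 (⟨by linarith, by linarith⟩ : (z + -zlo) / 2 ∈ Ioo z (-zlo))).1
    linarith
  · exact h.2 hz

theorem le_toReal_zhi (hp : IsReturnLaw p zlo zhi kap b) (hzhi : zhi ≠ ⊤) {z : ℝ}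
    (hz : z ∈ p.support) : z ≤ zhi.toReal := by
  have hbot : zhi ≠ ⊥ := (bot_lt_iff_ne_bot.1 (bot_le.trans_lt hp.zhi_pos))
  rcases hp.support_eq with ⟨ho, h⟩ | ⟨-, -, r, hr, h⟩
  · by_contra! hlt
    have h0 : 0 < zhi.toReal := EReal.toReal_pos hp.zhi_pos hzhi
    have h1 : Ioo (-zlo) z ⊆ interior p.support :=
      interior_maximal (Ioo_subset_Icc_self.trans (ho.out hp.neg_zlo_mem_support hz)) isOpen_Ioo
    rw [h] at h1
    have h2 := (h1 (⟨by linarith [hp.zlo_pos], by linarith⟩ :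
      (z + zhi.toReal) / 2 ∈ Ioo (-zlo) z)).2
    rw [← EReal.coe_toReal hzhi hbot, EReal.coe_lt_coe_iff, EReal.toReal_coe] at h2
    linarith
  · rw [hr, EReal.toReal_coe]
    exact h.2 hz

/-- Wealth above `l(a)` before a trading date with investment `a` stays nonnegative after it. -/
theorem ae_sub_lowerWealth_le (hp : IsReturnLaw p zlo zhi kap b) {a : ℝ}
    (ha : a ∈ investmentSet zhi) (y : ℝ) : ∀ᵐ z ∂p, y - lowerWealth zlo zhi a ≤ y + a * z := by
  filter_upwards [Measure.support_mem_ae (μ := p)] with z hz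
  have h1 := hp.neg_zlo_le hz
  rw [lowerWealth]
  split_ifs with h
  · have h0 : 0 ≤ a := ha h
    nlinarith
  · have h2 := hp.le_toReal_zhi h hz
    rcases le_total 0 a with h0 | h0
    · have := le_max_left (a * zlo) (-a * zhi.toReal)
      nlinarith
    · have := le_max_right (a * zlo) (-a * zhi.toReal)
      nlinarith

/-- The growth condition at `t = 0` reads `1 + ∫ z ≤ kap`, and `zlo ≤ 1`. The left side is the
largest mean growth factor of wealth in one trade, reached at `a = r / zlo`. -/
theorem one_le_kap_div (hp : IsReturnLaw p zlo zhi kap b) :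
    1 + (∫ z, z ∂p) / zlo ≤ kap / zlo := by
  have := hp.isProb
  have h := hp.growth 0 le_rfl
  rw [mul_zero, Real.exp_zero, mul_one, integral_add (integrable_const _) hp.integrable] at h
  simp only [integral_const, probReal_univ, smul_eq_mul, mul_one] at h
  rw [← sub_nonneg]
  have : kap / zlo - (1 + (∫ z, z ∂p) / zlo) = (kap - zlo - ∫ z, z ∂p) / zlo := by
    field_simp [hp.zlo_pos.ne']
    ring
  rw [this]
  exact div_nonneg (by linarith [hp.zlo_le_one]) hp.zlo_pos.le

theorem kap_div_pos (hp : IsReturnLaw p zlo zhi kap b) : 0 < kap / zlo :=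
  lt_of_lt_of_le (by linarith [div_nonneg hp.mean_nonneg hp.zlo_pos.le]) hp.one_le_kap_div

/-- If the wealth after a trading date is nonnegative, then so is the wealth before it, and the
expected `β`-th power of the wealth grows at most by the factor `(kap / zlo) ^ β`. -/
theorem lintegral_rpow_le (hp : IsReturnLaw p zlo zhi kap b) {β : ℝ} (hβ : 0 < β) (hβ1 : β < 1)
    {r a : ℝ} (h : ∀ᵐ z ∂p, 0 ≤ r + a * z) :
    0 ≤ r ∧ ∫⁻ z, ENNReal.ofReal ((r + a * z) ^ β) ∂p ≤
      ENNReal.ofReal ((kap / zlo) ^ β * r ^ β) := by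
  have := hp.isProb
  have hz := hp.zlo_pos
  have hm := hp.mean_nonneg
  set m := ∫ z, z ∂p with hmdef
  have hint : Integrable (fun z : ℝ => r + a * z) p :=
    (integrable_const r).add (hp.integrable.const_mul a)
  have hmean : ∫ z, (r + a * z) ∂p = r + a * m := by
    rw [integral_add (integrable_const r) (hp.integrable.const_mul a), integral_const_mul]
    simp [hmdef]
  have h1 : 0 ≤ r + a * m := hmean ▸ integral_nonneg_of_ae h
  -- The constraint is closed in `z`, so it passes from almost every `z` to every point of the
  -- support, in particular to the worst return.
  have h2 : 0 ≤ r + a * (-zlo) := by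
    have hc : IsClosed {z : ℝ | 0 ≤ r + a * z} := isClosed_le continuous_const (by fun_prop)
    exact Measure.support_subset_of_isClosed hc h hp.neg_zlo_mem_support
  -- For `a ≥ 0` the worst return gives the sign, for `a ≤ 0` the nonnegative mean does.
  have hr : 0 ≤ r := by
    rcases le_total 0 a with h0 | h0 <;> nlinarith
  have h3 : r + a * m ≤ kap / zlo * r := by
    have h4 : r + a * m ≤ (1 + m / zlo) * r := by
      have h5 : a ≤ r / zlo := by
        rw [le_div_iff₀ hz]
        linarith
      have h6 : a * m ≤ r / zlo * m := mul_le_mul_of_nonneg_right h5 hm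
      calc r + a * m ≤ r + r / zlo * m := by linarith
        _ = (1 + m / zlo) * r := by ring
    exact h4.trans (mul_le_mul_of_nonneg_right hp.one_le_kap_div hr)
  refine ⟨hr, ?_⟩
  have hcont : ContinuousOn (fun y : ℝ => y ^ β) (Ici 0) :=
    fun y _ => (Real.continuousAt_rpow_const y β (Or.inr hβ.le)).continuousWithinAt
  have hpow : Integrable (fun z : ℝ => (r + a * z) ^ β) p := by
    refine Integrable.mono' (hint.add (integrable_const 1)) ?_ ?_
    · exact ((measurable_const.add (measurable_const.mul measurable_id)).pow_const
        β).aestronglyMeasurable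
    · filter_upwards [h] with z hz
      rw [Real.norm_of_nonneg (Real.rpow_nonneg hz _)]
      have := Real.rpow_le_rpow hz (show r + a * z ≤ r + a * z + 1 by linarith) hβ.le
      refine this.trans ?_
      have h7 := Real.rpow_le_rpow_of_exponent_le (show 1 ≤ r + a * z + 1 by linarith) hβ1.le
      simpa using h7
  rw [← ofReal_integral_eq_lintegral_ofReal hpow
    (by filter_upwards [h] with z hz using Real.rpow_nonneg hz _)]
  refine ENNReal.ofReal_le_ofReal ?_
  -- Jensen's inequality for the concave power reduces the moment to the mean.
  have hj := (Real.concaveOn_rpow hβ.le hβ1.le).le_map_integral hcont isClosed_Ici h hint hpow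
  refine hj.trans ?_
  rw [hmean, ← Real.mul_rpow hp.kap_div_pos.le hr]
  exact Real.rpow_le_rpow h1 h3 hβ.le

/-- By independence the joint law of `(V, Z)` is a product, so `V` can be frozen by Fubini. The
almost sure constraint then holds for almost every `z` at almost every frozen value, and the
deterministic inequality applies there. -/
theorem lintegral_rpow_indep_le {Ω S : Type*} [MeasurableSpace Ω] [MeasurableSpace S]
    {P : Measure Ω} [IsProbabilityMeasure P] (hp : IsReturnLaw p zlo zhi kap b) {β : ℝ}
    (hβ : 0 < β) (hβ1 : β < 1) {Z : Ω → ℝ} {V : Ω → S} (hZ : Measurable Z) (hV : Measurable V)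
    (hlaw : HasLaw Z p P) (hind : IndepFun Z V P) {r a : S → ℝ} {w : S → ℝ≥0∞}
    (hr : Measurable r) (ha : Measurable a) (hw : Measurable w)
    (h : ∀ᵐ ω ∂P, 0 ≤ r (V ω) + a (V ω) * Z ω) :
    (∀ᵐ ω ∂P, 0 ≤ r (V ω)) ∧
      ∫⁻ ω, w (V ω) * ENNReal.ofReal ((r (V ω) + a (V ω) * Z ω) ^ β) ∂P ≤
        ∫⁻ ω, w (V ω) * ENNReal.ofReal ((kap / zlo) ^ β * r (V ω) ^ β) ∂P := by
  have := hp.isProb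
  have hVp : IsProbabilityMeasure (P.map V) := Measure.isProbabilityMeasure_map hV.aemeasurable
  have hmap : P.map (fun ω => (V ω, Z ω)) = (P.map V).prod p := by
    rw [(indepFun_iff_map_prod_eq_prod_map_map hV.aemeasurable hZ.aemeasurable).1 hind.symm,
      hlaw.map_eq]
  have hVZ : Measurable (fun ω => (V ω, Z ω)) := hV.prodMk hZ
  have hf : Measurable (fun q : S × ℝ => r q.1 + a q.1 * q.2) :=
    (hr.comp measurable_fst).add ((ha.comp measurable_fst).mul measurable_snd)
  have h1 : ∀ᵐ q ∂((P.map V).prod p), 0 ≤ r q.1 + a q.1 * q.2 := by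
    rw [← hmap, ae_map_iff hVZ.aemeasurable (measurableSet_le measurable_const hf)]
    exact h
  have h2 : ∀ᵐ v ∂(P.map V), ∀ᵐ z ∂p, 0 ≤ r v + a v * z := Measure.ae_ae_of_ae_prod h1
  have h3 := h2.mono fun v hv => hp.lintegral_rpow_le hβ hβ1 hv
  refine ⟨ae_of_ae_map hV.aemeasurable (h3.mono fun v hv => hv.1), ?_⟩
  have hg : Measurable (fun q : S × ℝ => w q.1 * ENNReal.ofReal ((r q.1 + a q.1 * q.2) ^ β)) :=
    (hw.comp measurable_fst).mul (hf.pow_const β).ennreal_ofReal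
  have hg' : Measurable (fun v : S => w v * ENNReal.ofReal ((kap / zlo) ^ β * r v ^ β)) :=
    hw.mul (measurable_const.mul (hr.pow_const β)).ennreal_ofReal
  rw [← lintegral_map (f := fun q : S × ℝ =>
      w q.1 * ENNReal.ofReal ((r q.1 + a q.1 * q.2) ^ β)) hg hVZ, hmap,
    lintegral_prod _ hg.aemeasurable, ← lintegral_map hg' hV]
  refine lintegral_mono_ae (h3.mono fun v hv => ?_)
  have hv' : Measurable fun z : ℝ => ENNReal.ofReal ((r v + a v * z) ^ β) := by fun_prop
  dsimp only
  rw [lintegral_const_mul _ hv']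
  exact mul_le_mul_right hv.2 _

end IsReturnLaw

/-- Exponential tilting turns the density of rate `lam` into a multiple of the density of rate `lam
+ ρ`. -/
theorem lintegral_exp_neg_expMeasure {lam ρ : ℝ} (hlam : 0 < lam) (hρ : 0 < ρ) :
    ∫⁻ x, ENNReal.ofReal (Real.exp (-ρ * x)) ∂(expMeasure lam) =
      ENNReal.ofReal (lam / (lam + ρ)) := by
  have h0 : expMeasure lam = volume.withDensity (exponentialPDF lam) := rfl
  have hm : ∀ r, Measurable (exponentialPDF r) := fun r =>
    (measurable_exponentialPDFReal r).ennreal_ofReal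
  rw [h0, lintegral_withDensity_eq_lintegral_mul _ (hm lam) (by fun_prop)]
  have h1 : ∀ x, (exponentialPDF lam * fun x => ENNReal.ofReal (Real.exp (-ρ * x))) x =
      ENNReal.ofReal (lam / (lam + ρ)) * exponentialPDF (lam + ρ) x := by
    intro x
    rw [Pi.mul_apply, exponentialPDF_eq, exponentialPDF_eq,
      ← ENNReal.ofReal_mul' (Real.exp_nonneg _), ← ENNReal.ofReal_mul (by positivity)]
    congr 1
    split_ifs
    · have : Real.exp (-((lam + ρ) * x)) = Real.exp (-(lam * x)) * Real.exp (-ρ * x) := by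
        rw [← Real.exp_add]
        ring_nf
      rw [this]
      field_simp
    · simp
  simp_rw [h1]
  rw [lintegral_const_mul _ (hm _), lintegral_exponentialPDF_eq_one (by positivity), mul_one]

/-! ### Wealth dynamics and contraction of discounted moments -/

namespace IlliquidMarket

variable {Ω : Type*} [mΩ : MeasurableSpace Ω] {P : Measure Ω} {lam : ℝ} {p : Measure ℝ}

/-- Wealth just before the return of the `(k+1)`-st trading date is revealed. -/
noncomputable def preWealth (M : IlliquidMarket P lam p) (x : ℝ) (α : ℕ → Ω → ℝ) (c : ℝ≥0 → Ω → ℝ) (k : ℕ)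
    (ω : Ω) : ℝ :=
  x - (∫ t in Ioc (0 : ℝ) (M.τ (k + 1) ω), c t.toNNReal ω) +
    ∑ i ∈ Finset.range k, α (i + 1) ω * M.Z (i + 1) ω

variable {M : IlliquidMarket P lam p} {x : ℝ} {α : ℕ → Ω → ℝ} {c : ℝ≥0 → Ω → ℝ}

theorem wealth_succ (k : ℕ) (ω : Ω) : M.wealth x α c (k + 1) ω =
    M.preWealth x α c k ω + α (k + 1) ω * M.Z (k + 1) ω := by
  rw [wealth, preWealth, Finset.sum_range_succ]
  ring

theorem wealth_zero (ω : Ω) : M.wealth x α c 0 ω = x := by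
  simp [wealth, M.τ_zero]

namespace Admissible

theorem measurable_investment (h : M.Admissible x α c) (k : ℕ) :
    Measurable[M.prePastσ k] (α (k + 1)) :=
  M.measurable_prePastσ_of_stoppingTime k (h.investment k)

theorem measurable_gains (h : M.Admissible x α c) (k : ℕ) :
    Measurable[M.pastσ k] (fun ω => ∑ i ∈ Finset.range k, α (i + 1) ω * M.Z (i + 1) ω) := by
  refine @Finset.measurable_fun_sum _ _ _ _ _ _ (M.pastσ k) _ _ fun i hi => ?_
  have hik : i + 1 ≤ k := Finset.mem_range.1 hi
  exact ((h.measurable_investment i).mono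
    ((M.prePastσ_le_pastσ i).trans (M.pastσ_mono hik)) le_rfl).mul (M.measurable_Z_pastσ hik)

theorem measurable_preWealth (h : M.Admissible x α c) (k : ℕ) :
    Measurable[M.prePastσ k] (M.preWealth x α c k) :=
  ((@measurable_const _ _ _ (M.prePastσ k) x).sub
    (M.measurable_integral_consumption k h.consumption)).add
    ((h.measurable_gains k).mono (M.pastσ_le_prePastσ k) le_rfl)

theorem measurable_wealth (h : M.Admissible x α c) (k : ℕ) :
    Measurable[M.pastσ k] (M.wealth x α c k) := by
  cases k with
  | zero =>
    have : M.wealth x α c 0 = fun _ => x := funext fun ω => wealth_zero ω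
    rw [this]
    exact @measurable_const _ _ _ (M.pastσ 0) x
  | succ k =>
    have : M.wealth x α c (k + 1) = fun ω =>
      M.preWealth x α c k ω + α (k + 1) ω * M.Z (k + 1) ω := funext fun ω => wealth_succ k ω
    rw [this]
    exact ((h.measurable_preWealth k).mono (M.prePastσ_le_pastσ k) le_rfl).add
      (((h.measurable_investment k).mono (M.prePastσ_le_pastσ k) le_rfl).mul
        (M.measurable_Z_pastσ le_rfl))

theorem ae_preWealth_eq (h : M.Admissible x α c) (k : ℕ) :
    ∀ᵐ ω ∂P, M.preWealth x α c k ω = M.wealth x α c k ω -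
      ∫ t in Ioc (M.τ k ω : ℝ) (M.τ (k + 1) ω), c t.toNNReal ω := by
  filter_upwards [h.integrable k] with ω hω
  rw [preWealth, wealth]
  have h1 : (M.τ k ω : ℝ) ≤ M.τ (k + 1) ω := NNReal.coe_le_coe.2 (M.τ_lt k ω).le
  have h2 : Ioc (0 : ℝ) (M.τ (k + 1) ω) =
      Ioc (0 : ℝ) (M.τ k ω) ∪ Ioc (M.τ k ω : ℝ) (M.τ (k + 1) ω) :=
    (Ioc_union_Ioc_eq_Ioc (NNReal.coe_nonneg _) h1).symm
  rw [h2, setIntegral_union (Ioc_disjoint_Ioc_of_le le_rfl) measurableSet_Ioc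
    (hω.mono_set (h2 ▸ subset_union_left)) (hω.mono_set (h2 ▸ subset_union_right))]
  ring

variable [IsProbabilityMeasure P] {zlo : ℝ} {zhi : EReal} {kap b ρ β : ℝ}

/-- The pre-trade wealth, the investment and the date `τ (k + 1)` are all functions of `prePast k`,
which is independent of the next return. The weight `e^{-ρ τ}` is carried along, so that the
estimate can be iterated. -/
theorem preWealth_step (hp : IsReturnLaw p zlo zhi kap b) (hβ : 0 < β) (hβ1 : β < 1)
    (h : M.Admissible x α c) (ρ : ℝ) (k : ℕ) :
    (∀ᵐ ω ∂P, 0 ≤ M.preWealth x α c k ω) ∧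
      ∫⁻ ω, ENNReal.ofReal (Real.exp (-ρ * M.τ (k + 1) ω)) *
          ENNReal.ofReal (M.wealth x α c (k + 1) ω ^ β) ∂P ≤
        ∫⁻ ω, ENNReal.ofReal (Real.exp (-ρ * M.τ (k + 1) ω)) *
          ENNReal.ofReal ((kap / zlo) ^ β * M.preWealth x α c k ω ^ β) ∂P := by
  obtain ⟨r, hr, hr'⟩ := (h.measurable_preWealth k).exists_eq_measurable_comp
  obtain ⟨a, ha, ha'⟩ := (h.measurable_investment k).exists_eq_measurable_comp
  obtain ⟨T, hT, hT'⟩ := (M.measurable_τ_prePastσ k).exists_eq_measurable_comp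
  have hw : ∀ᵐ ω ∂P, 0 ≤ r (M.prePast k ω) + a (M.prePast k ω) * M.Z (k + 1) ω := by
    filter_upwards [h.wealth_nonneg k] with ω hω
    rw [wealth_succ, hr', ha'] at hω
    exact hω
  have hwm : Measurable fun v => ENNReal.ofReal (Real.exp (-ρ * T v)) := by fun_prop
  have h1 := hp.lintegral_rpow_indep_le hβ hβ1 (M.measurable_Z (k + 1)) (M.measurable_prePast k)
    (M.law_return k) (M.indep_return k) hr ha hwm hw
  simp_rw [wealth_succ, hr', ha', hT', Function.comp_apply]
  exact h1

theorem ae_preWealth_nonneg (hp : IsReturnLaw p zlo zhi kap b) (h : M.Admissible x α c) (k : ℕ) :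
    ∀ᵐ ω ∂P, 0 ≤ M.preWealth x α c k ω :=
  -- The sign does not depend on the exponent or the discount rate; both are placeholders.
  (preWealth_step (β := 1 / 2) hp (by norm_num) (by norm_num) h 0 k).1

/-- The wealth bounds the consumption until the next trading date. -/
theorem ae_integral_consumption_le (hp : IsReturnLaw p zlo zhi kap b) (h : M.Admissible x α c)
    (k : ℕ) : ∀ᵐ ω ∂P,
      ∫ t in Ioc (M.τ k ω : ℝ) (M.τ (k + 1) ω), c t.toNNReal ω ≤ M.wealth x α c k ω := by
  filter_upwards [h.ae_preWealth_eq k, h.ae_preWealth_nonneg hp k] with ω h1 h2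
  linarith

theorem initial_nonneg (hp : IsReturnLaw p zlo zhi kap b) (h : M.Admissible x α c) : 0 ≤ x := by
  obtain ⟨ω, hω⟩ := (h.ae_integral_consumption_le hp 0).exists
  rw [wealth_zero] at hω
  exact (setIntegral_nonneg measurableSet_Ioc fun t _ => h.nonneg _ _).trans hω

/-- One-step contraction of the discounted `β`-th moment of the wealth at trading dates. -/
theorem lintegral_wealth_succ_le (hp : IsReturnLaw p zlo zhi kap b) (hlam : 0 < lam) (hρ : 0 < ρ)
    (hβ : 0 < β) (hβ1 : β < 1) (h : M.Admissible x α c) (k : ℕ) :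
    ∫⁻ ω, ENNReal.ofReal (Real.exp (-ρ * M.τ (k + 1) ω)) *
        ENNReal.ofReal (M.wealth x α c (k + 1) ω ^ β) ∂P ≤
      ENNReal.ofReal ((kap / zlo) ^ β * (lam / (lam + ρ))) *
        ∫⁻ ω, ENNReal.ofReal (Real.exp (-ρ * M.τ k ω)) *
          ENNReal.ofReal (M.wealth x α c k ω ^ β) ∂P := by
  refine (preWealth_step hp hβ hβ1 h ρ k).2.trans ?_
  have hk := Real.rpow_nonneg hp.kap_div_pos.le β
  obtain ⟨X, hX, hX'⟩ := (h.measurable_wealth k).exists_eq_measurable_comp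
  obtain ⟨T, hT, hT'⟩ := (M.measurable_τ_pastσ (le_refl k)).exists_eq_measurable_comp
  set G : (Fin (k + 1) → ℝ≥0 × ℝ) → ℝ≥0∞ := fun v =>
    ENNReal.ofReal ((kap / zlo) ^ β) *
      (ENNReal.ofReal (Real.exp (-ρ * T v)) * ENNReal.ofReal (X v ^ β)) with hG
  have hGm : Measurable G := by fun_prop
  have hFm : Measurable (fun d : ℝ => ENNReal.ofReal (Real.exp (-ρ * d))) := by fun_prop
  have hind := (M.indep_interarrival k).comp hFm hGm
  have hΔ : Measurable fun ω => (M.τ (k + 1) ω : ℝ) - M.τ k ω :=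
    (M.measurable_τ (k + 1)).coe_nnreal_real.sub (M.measurable_τ k).coe_nnreal_real
  -- The waiting time is independent of the past, so the discount over it factors out with its
  -- Laplace transform `lam / (lam + ρ)`. Replacing pre-trade wealth by the wealth at `τ k`, which
  -- is larger because consumption is nonnegative, makes the other factor a function of the past.
  have h1 := lintegral_mul_eq_lintegral_mul_lintegral_of_indepFun (hFm.comp hΔ)
    (hGm.comp (M.measurable_past k)) hind
  have h2 : ∫⁻ ω, ((fun d : ℝ => ENNReal.ofReal (Real.exp (-ρ * d))) ∘
      fun ω => (M.τ (k + 1) ω : ℝ) - M.τ k ω) ω ∂P = ENNReal.ofReal (lam / (lam + ρ)) := by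
    rw [← lintegral_exp_neg_expMeasure hlam hρ, ← (M.law_interarrival k).map_eq,
      lintegral_map hFm hΔ]
    rfl
  have h3 : ∫⁻ ω, (G ∘ M.past k) ω ∂P = ENNReal.ofReal ((kap / zlo) ^ β) *
      ∫⁻ ω, ENNReal.ofReal (Real.exp (-ρ * M.τ k ω)) *
          ENNReal.ofReal (M.wealth x α c k ω ^ β) ∂P := by
    rw [← lintegral_const_mul']
    · rw [hX', hT']
      rfl
    · exact ENNReal.ofReal_ne_top
  rw [h2, h3] at h1
  rw [ENNReal.ofReal_mul hk, mul_comm (ENNReal.ofReal ((kap / zlo) ^ β)), mul_assoc, ← h1]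
  refine lintegral_mono_ae ?_
  filter_upwards [h.ae_preWealth_eq k, h.ae_preWealth_nonneg hp k] with ω h4 h5
  have h6 : M.preWealth x α c k ω ≤ M.wealth x α c k ω := by
    rw [h4]
    linarith [setIntegral_nonneg (μ := volume) (f := fun t : ℝ => c t.toNNReal ω)
      (measurableSet_Ioc (a := (M.τ k ω : ℝ)) (b := M.τ (k + 1) ω)) fun t _ => h.nonneg _ _]
  have h7 : Real.exp (-ρ * M.τ (k + 1) ω) =
      Real.exp (-ρ * (M.τ (k + 1) ω - M.τ k ω)) * Real.exp (-ρ * M.τ k ω) := by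
    rw [← Real.exp_add]
    ring_nf
  have h8 : (G ∘ M.past k) ω = ENNReal.ofReal ((kap / zlo) ^ β) *
      (ENNReal.ofReal (Real.exp (-ρ * M.τ k ω)) * ENNReal.ofReal (M.wealth x α c k ω ^ β)) := by
    rw [hX', hT']
    rfl
  rw [Pi.mul_apply, h8, h7, ENNReal.ofReal_mul (Real.exp_nonneg _), ENNReal.ofReal_mul hk]
  rw [mul_assoc, mul_left_comm (ENNReal.ofReal (Real.exp (-ρ * M.τ k ω)))]
  simp only [Function.comp_apply]
  gcongr

end Admissible

end IlliquidMarket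

/-! ### Uniform bound on discounted moments of consumption -/

theorem lintegral_exp_neg_mul_Ioi {ρ : ℝ} (hρ : 0 < ρ) (a : ℝ) :
    ∫⁻ t in Ioi a, ENNReal.ofReal (Real.exp (-ρ * t)) =
      ENNReal.ofReal (Real.exp (-ρ * a) / ρ) := by
  rw [← ofReal_integral_eq_lintegral_ofReal (integrableOn_exp_mul_Ioi (by linarith) a)
    (Filter.Eventually.of_forall fun t => (Real.exp_pos _).le),
    integral_exp_mul_Ioi (by linarith) a]
  congr 1
  rw [div_neg, neg_div, neg_neg]

/-- For `y ≤ X` the first term suffices; for `y > X` the second does, because `β - 1 < 0`. This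
affine majorant, taken at the budget `X`, turns a bound on `∫ f` into one on the integral of `f ^ β`
that scales like `X ^ β`. -/
theorem Real.rpow_le_add_rpow_sub_one_mul {β X y : ℝ} (hβ : 0 < β) (hβ1 : β < 1) (hX : 0 < X)
    (hy : 0 ≤ y) : y ^ β ≤ X ^ β + X ^ (β - 1) * y := by
  rcases le_or_gt y X with h | h
  · have h1 := Real.rpow_le_rpow hy h hβ.le
    have h2 : 0 ≤ X ^ (β - 1) * y := mul_nonneg (Real.rpow_nonneg hX.le _) hy
    linarith
  · have hy' : 0 < y := hX.trans h
    have h1 : y ^ β = y ^ (β - 1) * y := by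
      rw [← Real.rpow_add_one hy'.ne', sub_add_cancel]
    have h2 : y ^ (β - 1) ≤ X ^ (β - 1) :=
      Real.rpow_le_rpow_of_nonpos hX h.le (by linarith)
    have h3 := mul_le_mul_of_nonneg_right h2 hy
    have h4 := Real.rpow_nonneg hX.le β
    linarith

/-- Discounted `β`-th moment of a consumption rate with budget `X` on a time interval. -/
theorem lintegral_exp_mul_rpow_le {β ρ a b X : ℝ} (hβ : 0 < β) (hβ1 : β < 1) (hρ : 0 < ρ)
    {f : ℝ → ℝ} (hf0 : ∀ t, 0 ≤ f t) (hf : IntegrableOn f (Ioc a b))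
    (hX : ∫ t in Ioc a b, f t ≤ X) :
    ∫⁻ t in Ioc a b, ENNReal.ofReal (Real.exp (-ρ * t) * f t ^ β) ≤
      ENNReal.ofReal (1 / ρ + 1) *
        (ENNReal.ofReal (Real.exp (-ρ * a)) * ENNReal.ofReal (X ^ β)) := by
  have hint0 : 0 ≤ ∫ t in Ioc a b, f t := integral_nonneg fun t => hf0 t
  -- A zero budget is treated apart, since the affine majorant has slope `X ^ (β - 1)`; then `f`
  -- vanishes almost everywhere.
  rcases (hint0.trans hX).eq_or_lt with h0 | hXpos
  · have h1 : ∫ t in Ioc a b, f t = 0 := le_antisymm (h0 ▸ hX) hint0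
    have h2 := (integral_eq_zero_iff_of_nonneg (fun t => hf0 t) hf).1 h1
    have h3 : ∫⁻ t in Ioc a b, ENNReal.ofReal (Real.exp (-ρ * t) * f t ^ β) = 0 := by
      rw [← lintegral_zero (μ := volume.restrict (Ioc a b))]
      refine lintegral_congr_ae (h2.mono fun t ht => ?_)
      simp only [Pi.zero_apply] at ht
      simp [ht, Real.zero_rpow hβ.ne']
    rw [h3]
    exact zero_le
  · have hea := (Real.exp_pos (-ρ * a)).le
    have hX1 := Real.rpow_nonneg hXpos.le (β - 1)
    have hX2 := Real.rpow_nonneg hXpos.le β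
    calc ∫⁻ t in Ioc a b, ENNReal.ofReal (Real.exp (-ρ * t) * f t ^ β)
        ≤ ∫⁻ t in Ioc a b, (ENNReal.ofReal (Real.exp (-ρ * t)) * ENNReal.ofReal (X ^ β) +
            ENNReal.ofReal (Real.exp (-ρ * a) * X ^ (β - 1)) * ENNReal.ofReal (f t)) := by
          refine setLIntegral_mono_ae' measurableSet_Ioc (Filter.Eventually.of_forall ?_)
          intro t ht
          rw [← ENNReal.ofReal_mul (Real.exp_nonneg _),
            ← ENNReal.ofReal_mul (mul_nonneg hea hX1),
            ← ENNReal.ofReal_add (mul_nonneg (Real.exp_nonneg _) hX2)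
              (mul_nonneg (mul_nonneg hea hX1) (hf0 t))]
          refine ENNReal.ofReal_le_ofReal ?_
          have h1 := Real.rpow_le_add_rpow_sub_one_mul hβ hβ1 hXpos (hf0 t)
          have h2 : Real.exp (-ρ * t) ≤ Real.exp (-ρ * a) :=
            Real.exp_le_exp.2 (by nlinarith [ht.1])
          have h3 := mul_le_mul_of_nonneg_left h1 (Real.exp_nonneg (-ρ * t))
          have h4 := mul_le_mul_of_nonneg_right h2 (mul_nonneg hX1 (hf0 t))
          nlinarith
      _ = (∫⁻ t in Ioc a b, ENNReal.ofReal (Real.exp (-ρ * t))) * ENNReal.ofReal (X ^ β) +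
            ENNReal.ofReal (Real.exp (-ρ * a) * X ^ (β - 1)) *
              ENNReal.ofReal (∫ t in Ioc a b, f t) := by
          rw [lintegral_add_left (by fun_prop), lintegral_mul_const _ (by fun_prop),
            lintegral_const_mul' _ _ ENNReal.ofReal_ne_top,
            ofReal_integral_eq_lintegral_ofReal hf (Filter.Eventually.of_forall hf0)]
      _ ≤ ENNReal.ofReal (Real.exp (-ρ * a) / ρ) * ENNReal.ofReal (X ^ β) +
            ENNReal.ofReal (Real.exp (-ρ * a) * X ^ (β - 1)) * ENNReal.ofReal X := by
          gcongr
          rw [← lintegral_exp_neg_mul_Ioi hρ]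
          exact lintegral_mono_set Ioc_subset_Ioi_self
      _ = _ := by
          rw [← ENNReal.ofReal_mul (by positivity), ← ENNReal.ofReal_mul (by positivity),
            ← ENNReal.ofReal_mul hea, ← ENNReal.ofReal_mul (by positivity),
            ← ENNReal.ofReal_add (by positivity) (by positivity)]
          congr 1
          have h1 : X ^ β = X ^ (β - 1) * X := by
            rw [← Real.rpow_add_one hXpos.ne', sub_add_cancel]
          rw [h1]
          ring

namespace IlliquidMarket

variable {Ω : Type*} [mΩ : MeasurableSpace Ω] {P : Measure Ω} {lam : ℝ} {p : Measure ℝ}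
  {M : IlliquidMarket P lam p} {x : ℝ} {α : ℕ → Ω → ℝ} {c : ℝ≥0 → Ω → ℝ}

theorem admissible_zero (hx : 0 ≤ x) : M.Admissible x (fun _ _ => 0) (fun _ _ => 0) where
  investment k := @measurable_const _ _ _ (M.isStoppingTime_τ k).measurableSpace 0
  consumption := stronglyMeasurable_const
  nonneg _ _ := le_rfl
  integrable k := Filter.Eventually.of_forall fun ω => integrableOn_zero
  wealth_nonneg k := Filter.Eventually.of_forall fun ω => by simpa [wealth] using hx

variable [IsProbabilityMeasure P] {zlo : ℝ} {zhi : EReal} {kap b ρ β : ℝ}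

theorem Admissible.lintegral_wealth_le (hp : IsReturnLaw p zlo zhi kap b) (hlam : 0 < lam)
    (hρ : 0 < ρ) (hβ : 0 < β) (hβ1 : β < 1) (h : M.Admissible x α c) (k : ℕ) :
    ∫⁻ ω, ENNReal.ofReal (Real.exp (-ρ * M.τ k ω)) *
        ENNReal.ofReal (M.wealth x α c k ω ^ β) ∂P ≤
      ENNReal.ofReal ((kap / zlo) ^ β * (lam / (lam + ρ))) ^ k * ENNReal.ofReal (x ^ β) := by
  induction k with
  | zero => simp [M.τ_zero, wealth_zero]
  | succ k ih =>
    refine (h.lintegral_wealth_succ_le hp hlam hρ hβ hβ1 k).trans ?_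
    rw [pow_succ', mul_assoc]
    gcongr

/-- The zero policy keeps the wealth equal to 1, so the moment bound becomes `E e^{-ρ τ_k} ≤ q ^ k`.
The sum over `k` is finite, hence `e^{-ρ τ_k} → 0` almost surely and the dates do not accumulate. -/
theorem ae_exists_le_τ (M : IlliquidMarket P lam p) (hp : IsReturnLaw p zlo zhi kap b)
    (hlam : 0 < lam) (hρ : 0 < ρ) (hβ : 0 < β) (hβ1 : β < 1)
    (hq : (kap / zlo) ^ β * (lam / (lam + ρ)) < 1) :
    ∀ᵐ ω ∂P, ∀ t : ℝ, ∃ k, t ≤ M.τ k ω := by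
  have h0 := M.admissible_zero (x := 1) zero_le_one
  have hm : ∀ k, Measurable fun ω => ENNReal.ofReal (Real.exp (-ρ * M.τ k ω)) := fun k =>
    (((M.measurable_τ k).coe_nnreal_real.const_mul (-ρ)).exp).ennreal_ofReal
  have h1 : ∀ k, ∫⁻ ω, ENNReal.ofReal (Real.exp (-ρ * M.τ k ω)) ∂P ≤
      ENNReal.ofReal ((kap / zlo) ^ β * (lam / (lam + ρ))) ^ k := fun k => by
    simpa [wealth] using h0.lintegral_wealth_le hp hlam hρ hβ hβ1 k
  have h2 : ∫⁻ ω, ∑' k, ENNReal.ofReal (Real.exp (-ρ * M.τ k ω)) ∂P ≠ ⊤ := by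
    rw [lintegral_tsum fun k => (hm k).aemeasurable]
    refine ne_top_of_le_ne_top ?_ (ENNReal.tsum_le_tsum h1)
    rw [ENNReal.tsum_geometric, Ne, ENNReal.inv_eq_top, tsub_eq_zero_iff_le, not_le]
    exact ENNReal.ofReal_lt_one.2 hq
  filter_upwards [ae_lt_top (Measurable.tsum hm) h2] with ω hω t
  by_contra! hlt
  have h3 := ENNReal.tendsto_atTop_zero_of_tsum_ne_top hω.ne
  have h4 : ENNReal.ofReal (Real.exp (-ρ * t)) ≤ 0 := by
    refine ge_of_tendsto' h3 fun k => ENNReal.ofReal_le_ofReal (Real.exp_le_exp.2 ?_)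
    have := hlt k
    nlinarith
  rw [nonpos_iff_eq_zero, ENNReal.ofReal_eq_zero] at h4
  exact absurd (Real.exp_pos (-ρ * t)) (not_lt.2 h4)

/-- Uniform bound on the discounted `β`-th moment of admissible consumption. -/
theorem Admissible.lintegral_consumption_rpow_le (hp : IsReturnLaw p zlo zhi kap b)
    (hlam : 0 < lam) (hρ : 0 < ρ) (hβ : 0 < β) (hβ1 : β < 1)
    (hq : (kap / zlo) ^ β * (lam / (lam + ρ)) < 1) (h : M.Admissible x α c) :
    ∫⁻ ω, (∫⁻ t in Ioi (0 : ℝ), ENNReal.ofReal (Real.exp (-ρ * t) * c t.toNNReal ω ^ β)) ∂P ≤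
      ENNReal.ofReal ((1 / ρ + 1) / (1 - (kap / zlo) ^ β * (lam / (lam + ρ))) * x ^ β) := by
  set q := (kap / zlo) ^ β * (lam / (lam + ρ)) with hqdef
  have hq0 : 0 ≤ q := mul_nonneg (Real.rpow_nonneg hp.kap_div_pos.le _) (by positivity)
  have hx := h.initial_nonneg hp
  have hm : ∀ k, Measurable fun ω => ENNReal.ofReal (Real.exp (-ρ * M.τ k ω)) *
      ENNReal.ofReal (M.wealth x α c k ω ^ β) := fun k =>
    (((M.measurable_τ k).coe_nnreal_real.const_mul (-ρ)).exp).ennreal_ofReal.mul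
      (((h.measurable_wealth k).mono (M.pastσ_le k) le_rfl).pow_const β).ennreal_ofReal
  have h1 : ∀ᵐ ω ∂P,
      ∫⁻ t in Ioi (0 : ℝ), ENNReal.ofReal (Real.exp (-ρ * t) * c t.toNNReal ω ^ β) ≤
      ∑' k, ENNReal.ofReal (1 / ρ + 1) * (ENNReal.ofReal (Real.exp (-ρ * M.τ k ω)) *
      ENNReal.ofReal (M.wealth x α c k ω ^ β)) := by
    filter_upwards [M.ae_exists_le_τ hp hlam hρ hβ hβ1 hq, ae_all_iff.2 h.integrable,
      ae_all_iff.2 (h.ae_integral_consumption_le hp)] with ω h2 h3 h4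
    -- The first date at or after `t` is not `τ 0`, and its predecessor opens the interval that
    -- contains `t`.
    have hcov : Ioi (0 : ℝ) ⊆ ⋃ k, Ioc (M.τ k ω : ℝ) (M.τ (k + 1) ω) := by
      classical
      intro t ht
      have hne : Nat.find (h2 t) ≠ 0 := by
        intro h0
        have := Nat.find_spec (h2 t)
        rw [h0, M.τ_zero] at this
        exact absurd ht (not_lt.2 (by simpa using this))
      obtain ⟨n, hn⟩ := Nat.exists_eq_succ_of_ne_zero hne
      refine mem_iUnion.2 ⟨n, ?_, ?_⟩
      · exact not_le.1 (Nat.find_min (h2 t) (by omega))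
      · have := Nat.find_spec (h2 t)
        rwa [hn] at this
    refine (lintegral_mono_set hcov).trans ((lintegral_iUnion_le _ _).trans ?_)
    refine ENNReal.tsum_le_tsum fun k => ?_
    exact lintegral_exp_mul_rpow_le hβ hβ1 hρ (fun t => h.nonneg _ _)
      ((h3 k).mono_set (Ioc_subset_Ioc_left (NNReal.coe_nonneg _))) (h4 k)
  refine (lintegral_mono_ae h1).trans ?_
  rw [lintegral_tsum fun k => ((hm k).const_mul _).aemeasurable]
  calc ∑' k, ∫⁻ ω, ENNReal.ofReal (1 / ρ + 1) * (ENNReal.ofReal (Real.exp (-ρ * M.τ k ω)) *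
        ENNReal.ofReal (M.wealth x α c k ω ^ β)) ∂P
      ≤ ∑' k, ENNReal.ofReal (1 / ρ + 1) * (ENNReal.ofReal q ^ k * ENNReal.ofReal (x ^ β)) := by
        refine ENNReal.tsum_le_tsum fun k => ?_
        rw [lintegral_const_mul _ (hm k)]
        gcongr
        exact h.lintegral_wealth_le hp hlam hρ hβ hβ1 k
    _ = ENNReal.ofReal (1 / ρ + 1) * ((1 - ENNReal.ofReal q)⁻¹ * ENNReal.ofReal (x ^ β)) := by
        rw [ENNReal.tsum_mul_left, ENNReal.tsum_mul_right, ENNReal.tsum_geometric]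
    _ = _ := by
        have hxb := Real.rpow_nonneg hx β
        rw [← ENNReal.ofReal_one, ← ENNReal.ofReal_sub _ hq0,
          ← ENNReal.ofReal_inv_of_pos (by linarith),
          ← ENNReal.ofReal_mul (inv_nonneg.2 (by linarith)), ← ENNReal.ofReal_mul (by positivity)]
        congr 1
        rw [div_mul_eq_mul_div, mul_div_assoc, div_eq_inv_mul (x ^ β)]

end IlliquidMarket

/-! ### Concave functions and second differences of the utility -/

theorem ConcaveOn.le_tangent {S : Set ℝ} {f : ℝ → ℝ} {f' a y : ℝ} (hf : ConcaveOn ℝ S f)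
    (ha : a ∈ S) (hy : y ∈ S) (h : HasDerivAt f f' a) : f y ≤ f a + f' * (y - a) := by
  rcases lt_trichotomy a y with hlt | rfl | hlt
  · have h1 := hf.slope_le_of_hasDerivAt ha hy hlt h
    rw [slope_def_field, div_le_iff₀ (by linarith)] at h1
    linarith
  · simp
  · have h1 := hf.le_slope_of_hasDerivAt hy ha hlt h
    rw [slope_def_field, le_div_iff₀ (by linarith)] at h1
    linarith

/-- A concave function whose symmetric second differences are `o(h)` is differentiable. -/
theorem ConcaveOn.differentiableAt_of_second_difference {S : Set ℝ} {f : ℝ → ℝ} {x : ℝ}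
    (hf : ConcaveOn ℝ S f) (hx : x ∈ interior S)
    (h : ∀ η > 0, ∃ h₀ > 0, ∀ h, 0 < h → h < h₀ → 2 * f x ≤ f (x + h) + f (x - h) + η * h) :
    DifferentiableAt ℝ f x := by
  have hR := (hf.neg.differentiableWithinAt_Ioi_of_mem_interior hx).neg
  have hL := (hf.neg.differentiableWithinAt_Iio_of_mem_interior hx).neg
  rw [neg_neg] at hR hL
  have hR' := hR.hasDerivWithinAt
  have hL' := hL.hasDerivWithinAt
  set R := derivWithin f (Ioi x) x
  set L := derivWithin f (Iio x) x
  obtain ⟨u, v, hxuv, huv⟩ := mem_nhds_iff_exists_Ioo_subset.1 (mem_interior_iff_mem_nhds.1 hx)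
  have hxS : x ∈ S := interior_subset hx
  have hRi : ∀ y, x < y → y ∈ S → f y - f x ≤ R * (y - x) := by
    intro y hxy hy
    have h1 := hf.slope_le_of_hasDerivWithinAt_Ioi hxS hy hxy hR'
    rwa [slope_def_field, div_le_iff₀ (by linarith)] at h1
  have hLi : ∀ y, y < x → y ∈ S → L * (x - y) ≤ f x - f y := by
    intro y hxy hy
    have h1 := hf.le_slope_of_hasDerivWithinAt_Iio hy hxS hxy hL'
    rwa [slope_def_field, le_div_iff₀ (by linarith)] at h1
  have hRL : R ≤ L := by
    obtain ⟨m, hm⟩ := exists_between hxuv.1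
    obtain ⟨m', hm'⟩ := exists_between hxuv.2
    have t1 : Filter.Tendsto (slope f x) (nhdsWithin x (Ioi x)) (nhds R) := by
      have := hasDerivWithinAt_iff_tendsto_slope.1 hR'
      simpa using this
    have t2 : Filter.Tendsto (slope f x) (nhdsWithin x (Iio x)) (nhds L) := by
      have := hasDerivWithinAt_iff_tendsto_slope.1 hL'
      simpa using this
    have h1 : ∀ y ∈ Ioo u x, R ≤ slope f x y := by
      intro y hy
      refine le_of_tendsto t1 ?_
      filter_upwards [Ioo_mem_nhdsGT hxuv.2] with z hz
      exact hf.slope_anti hxS ⟨huv ⟨hy.1, hy.2.trans hxuv.2⟩, hy.2.ne⟩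
        ⟨huv ⟨hxuv.1.trans hz.1, hz.2⟩, hz.1.ne'⟩ (hy.2.trans hz.1).le
    refine ge_of_tendsto t2 ?_
    filter_upwards [Ioo_mem_nhdsLT hxuv.1] with y hy using h1 y hy
  -- Bounding `f (x ± k)` by the one-sided tangents turns the second-difference hypothesis into `(L
  -- - R) k ≤ η k`.
  have hLR : L ≤ R := by
    refine le_of_forall_pos_le_add fun η hη => ?_
    obtain ⟨h₀, hh₀, H⟩ := h η hη
    obtain ⟨k, hk0, hk⟩ : ∃ k, 0 < k ∧ k < min h₀ (min (x - u) (v - x)) :=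
      exists_between (lt_min hh₀ (lt_min (by linarith [hxuv.1]) (by linarith [hxuv.2])))
    simp only [lt_min_iff] at hk
    have h1 := H k hk0 hk.1
    have h2 := hRi (x + k) (by linarith) (huv ⟨by linarith [hxuv.1], by linarith⟩)
    have h3 := hLi (x - k) (by linarith) (huv ⟨by linarith, by linarith [hxuv.2]⟩)
    have h4 : L * k ≤ (R + η) * k := by nlinarith
    exact le_of_mul_le_mul_right h4 hk0
  have hEq : R = L := le_antisymm hRL hLR
  rw [hEq] at hR'
  have h1 := hR'.union hL'
  have h2 : HasDerivWithinAt f L ({x}ᶜ) x := by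
    rwa [Ioi_union_Iio] at h1
  rw [hasDerivWithinAt_iff_tendsto_slope, show ({x}ᶜ \ {x} : Set ℝ) = {x}ᶜ by ext; simp] at h2
  exact (hasDerivAt_iff_tendsto_slope.2 h2).differentiableAt

theorem ConcaveOn.smul_le_of_nonneg {f : ℝ → ℝ} {l : ℝ} (hf : ConcaveOn ℝ (Ici l) f)
    (h0 : 0 ≤ f l) {s d : ℝ} (hs : 0 ≤ s) (hs1 : s ≤ 1) (hd : 0 ≤ d) :
    s * f (l + d) ≤ f (l + s * d) := by
  have h1 := hf.2 (show l + d ∈ Ici l by simpa using hd) (self_mem_Ici (a := l)) hs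
    (sub_nonneg.2 hs1) (by ring)
  simp only [smul_eq_mul] at h1
  have h2 : s * (l + d) + (1 - s) * l = l + s * d := by ring
  rw [h2] at h1
  have := mul_nonneg (sub_nonneg.2 hs1) h0
  linarith

namespace IsUtility

variable {U : ℝ → ℝ} {γ K₁ : ℝ}

theorem nonneg (hU : IsUtility U γ K₁) {y : ℝ} (hy : 0 ≤ y) : 0 ≤ U y := by
  rw [← hU.zero]
  exact hU.strictMono.monotoneOn self_mem_Ici hy hy

theorem mono (hU : IsUtility U γ K₁) {y z : ℝ} (hy : 0 ≤ y) (hyz : y ≤ z) : U y ≤ U z :=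
  hU.strictMono.monotoneOn hy (hy.trans hyz) hyz

theorem mul_le (hU : IsUtility U γ K₁) {s y : ℝ} (hs : 0 ≤ s) (hs1 : s ≤ 1) (hy : 0 ≤ y) :
    s * U y ≤ U (s * y) := by
  simpa using hU.strictConcave.concaveOn.smul_le_of_nonneg hU.zero.ge hs hs1 hy

theorem hasDerivAt (hU : IsUtility U γ K₁) {y : ℝ} (hy : 0 < y) : HasDerivAt U (deriv U y) y :=
  ((hU.contDiff.differentiableOn one_ne_zero).differentiableAt (Ioi_mem_nhds hy)).hasDerivAt

theorem le_tangent (hU : IsUtility U γ K₁) {a y : ℝ} (ha : 0 < a) (hy : 0 ≤ y) :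
    U y ≤ U a + deriv U a * (y - a) :=
  hU.strictConcave.concaveOn.le_tangent ha.le hy (hU.hasDerivAt ha)

theorem continuousOn_deriv (hU : IsUtility U γ K₁) : ContinuousOn (deriv U) (Ioi 0) :=
  hU.contDiff.continuousOn_deriv_of_isOpen isOpen_Ioi le_rfl

theorem strictAntiOn_deriv (hU : IsUtility U γ K₁) : StrictAntiOn (deriv U) (Ioi 0) :=
  (hU.strictConcave.subset Ioi_subset_Ici_self (convex_Ioi 0)).strictAntiOn_deriv
    fun _ hy => (hU.hasDerivAt hy).differentiableAt

theorem deriv_pos (hU : IsUtility U γ K₁) {y : ℝ} (hy : 0 < y) : 0 < deriv U y := by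
  have h1 : U y < U (y + 1) := hU.strictMono hy.le (by simp; linarith) (by linarith)
  have h2 := hU.le_tangent hy (show 0 ≤ y + 1 by linarith)
  linarith

/-- A concave function on a closed half-line can only be discontinuous at the endpoint, where `0 ≤ U
y ≤ K₁ y ^ γ` forbids it. -/
theorem continuousOn (hU : IsUtility U γ K₁) : ContinuousOn U (Ici 0) := by
  refine hU.strictConcave.concaveOn.continuousOn_Ici ?_
  have h1 : Filter.Tendsto (fun y : ℝ => K₁ * y ^ γ) (nhdsWithin 0 (Ici 0)) (nhds 0) := by
    have h2 := ((Real.continuousAt_rpow_const 0 γ (Or.inr hU.γ_pos.le)).const_mul K₁).tendsto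
    rw [Real.zero_rpow hU.γ_pos.ne', mul_zero] at h2
    exact h2.mono_left nhdsWithin_le_nhds
  rw [ContinuousWithinAt, hU.zero]
  refine squeeze_zero' ?_ ?_ h1
  · filter_upwards [self_mem_nhdsWithin] with y hy using hU.nonneg hy
  · filter_upwards [self_mem_nhdsWithin] with y hy using hU.growth y hy

theorem continuous_max (hU : IsUtility U γ K₁) : Continuous fun y => U (max y 0) :=
  hU.continuousOn.comp_continuous (by fun_prop) fun y => le_max_right y 0

theorem measurable_comp (hU : IsUtility U γ K₁) {X : Type*} [MeasurableSpace X] {f : X → ℝ}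
    (hf : Measurable f) (h0 : ∀ x, 0 ≤ f x) : Measurable fun x => U (f x) := by
  have h1 := hU.continuous_max.measurable.comp hf
  have h2 : (fun x => U (f x)) = (fun y => U (max y 0)) ∘ f := by
    funext x
    simp [max_eq_left (h0 x)]
  rwa [h2]

/-- Second differences of `U` under scaling are `o(r)`, uniformly relative to `1 + y ^ β` for any
`β > γ`. -/
theorem second_difference (hU : IsUtility U γ K₁) {β : ℝ} (hβ : γ < β) {η : ℝ} (hη : 0 < η) :
    ∃ r₀ > 0, r₀ ≤ 1 / 2 ∧ ∀ r, 0 < r → r < r₀ → ∀ y, 0 ≤ y →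
      2 * U y ≤ U ((1 + r) * y) + U ((1 - r) * y) + r * η * (1 + y ^ β) := by
  have hK := hU.K₁_pos
  -- Three regimes: near 0 the utility itself is at most `η`, beyond `C` it is at most `η y ^ β`
  -- because `β > γ`, and in between `U'` is uniformly continuous.
  obtain ⟨d, hd, hd'⟩ : ∃ d > 0, ∀ y, 0 ≤ y → y ≤ d → U y ≤ η := by
    have h1 := hU.continuousOn 0 self_mem_Ici
    rw [ContinuousWithinAt, hU.zero] at h1
    have h2 := h1.eventually (eventually_le_nhds hη)
    rw [eventually_nhdsWithin_iff, Metric.eventually_nhds_iff] at h2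
    obtain ⟨d, hd, h2⟩ := h2
    refine ⟨d / 2, by positivity, fun y hy hyd => h2 ?_ hy⟩
    rw [Real.dist_eq, sub_zero, abs_of_nonneg hy]
    linarith
  obtain ⟨C, hC, hC'⟩ : ∃ C > 0, ∀ y, C ≤ y → U y ≤ η * y ^ β := by
    have h1 := (tendsto_rpow_atTop (sub_pos.2 hβ)).eventually_ge_atTop (K₁ / η)
    obtain ⟨C, hC⟩ := Filter.eventually_atTop.1 h1
    refine ⟨max C 1, by positivity, fun y hy => ?_⟩
    have hy0 : 0 < y := lt_of_lt_of_le (by positivity) hy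
    have h2 := hC y ((le_max_left _ _).trans hy)
    rw [div_le_iff₀ hη] at h2
    have h3 : y ^ β = y ^ (β - γ) * y ^ γ := by rw [← Real.rpow_add hy0, sub_add_cancel]
    have h4 := Real.rpow_nonneg hy0.le γ
    have h5 := hU.growth y hy0.le
    rw [h3]
    nlinarith
  have huc : UniformContinuousOn (deriv U) (Icc (d / 2) (2 * C)) :=
    isCompact_Icc.uniformContinuousOn_of_continuous
      (hU.continuousOn_deriv.mono fun y hy => lt_of_lt_of_le (by positivity) hy.1)
  rw [Metric.uniformContinuousOn_iff] at huc
  obtain ⟨ε, hε, huc⟩ := huc (η / C) (by positivity)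
  refine ⟨min (1 / 2) (ε / (4 * C)), by positivity, min_le_left _ _, fun r hr0 hr y hy => ?_⟩
  rw [lt_min_iff] at hr
  have hr1 : r ≤ 1 := by linarith [hr.1]
  have hrC : 4 * C * r < ε := by
    have := hr.2
    rw [lt_div_iff₀ (by positivity)] at this
    linarith
  have hyb := Real.rpow_nonneg hy β
  -- Monotonicity and `U ((1 - r) y) ≥ (1 - r) U y` bound the second difference by `r U y`, which
  -- settles both extreme regimes.
  have hcrude : U y ≤ η * (1 + y ^ β) →
      2 * U y ≤ U ((1 + r) * y) + U ((1 - r) * y) + r * η * (1 + y ^ β) := by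
    intro h
    have h1 := hU.mono hy (show y ≤ (1 + r) * y by nlinarith)
    have h2 := hU.mul_le (sub_nonneg.2 hr1) (by linarith) hy
    nlinarith
  rcases le_or_gt y d with hyd | hyd
  · refine hcrude ((hd' y hy hyd).trans ?_)
    nlinarith
  rcases le_or_gt C y with hyC | hyC
  · refine hcrude ((hC' y hyC).trans ?_)
    nlinarith
  have hy0 : 0 < y := hd.trans hyd
  have hp1 : 0 < (1 - r) * y := mul_pos (by linarith [hr.1]) hy0
  have hp2 : 0 < (1 + r) * y := by positivity
  -- The tangents at `(1 - r) y` and `(1 + r) y`, evaluated at `y`, bound the second difference by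
  -- `r y` times the difference of the slopes.
  have h1 := hU.le_tangent hp1 hy
  have h2 := hU.le_tangent hp2 hy
  have h3 := huc ((1 - r) * y) ⟨by nlinarith [hr.1], by nlinarith⟩ ((1 + r) * y)
    ⟨by nlinarith, by nlinarith [hr.1]⟩ (by
      rw [Real.dist_eq, abs_sub_lt_iff]
      constructor <;> nlinarith)
  rw [Real.dist_eq, lt_div_iff₀ hC] at h3
  have h4 := le_abs_self (deriv U ((1 - r) * y) - deriv U ((1 + r) * y))
  have h5 : (deriv U ((1 - r) * y) - deriv U ((1 + r) * y)) * y ≤ η := by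
    have h6 := abs_nonneg (deriv U ((1 - r) * y) - deriv U ((1 + r) * y))
    nlinarith
  have h7 : 2 * U y ≤ U ((1 + r) * y) + U ((1 - r) * y) +
      r * ((deriv U ((1 - r) * y) - deriv U ((1 + r) * y)) * y) := by
    nlinarith
  have h8 := mul_nonneg (mul_nonneg hr0.le hη.le) hyb
  nlinarith

end IsUtility

/-! ### The value function: finiteness, concavity, differentiability -/

namespace IlliquidMarket

variable {Ω : Type*} [mΩ : MeasurableSpace Ω] {P : Measure Ω} {lam : ℝ} {p : Measure ℝ}
  {M : IlliquidMarket P lam p} {x y : ℝ} {α α' : ℕ → Ω → ℝ} {c c' : ℝ≥0 → Ω → ℝ}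

/-- Wealth is linear in `(x, α, c)`. The weights need not sum to 1: convex combinations give
concavity of the value function, and the case `t = 0` gives scaling. -/
theorem Admissible.combine (h : M.Admissible x α c) (h' : M.Admissible y α' c') {s t : ℝ}
    (hs : 0 ≤ s) (ht : 0 ≤ t) : M.Admissible (s * x + t * y)
      (fun k ω => s * α k ω + t * α' k ω) (fun u ω => s * c u ω + t * c' u ω) where
  investment k := ((h.investment k).const_mul s).add ((h'.investment k).const_mul t)
  consumption := (StronglyMeasurable.const_mul h.consumption s).add
    (StronglyMeasurable.const_mul h'.consumption t)
  nonneg u ω := add_nonneg (mul_nonneg hs (h.nonneg u ω)) (mul_nonneg ht (h'.nonneg u ω))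
  integrable k := by
    filter_upwards [h.integrable k, h'.integrable k] with ω h1 h2
    exact (h1.const_mul s).add (h2.const_mul t)
  wealth_nonneg k := by
    filter_upwards [h.integrable k, h'.integrable k, h.wealth_nonneg k, h'.wealth_nonneg k]
      with ω h1 h2 h3 h4
    have h5 : M.wealth (s * x + t * y) (fun k ω => s * α k ω + t * α' k ω)
        (fun u ω => s * c u ω + t * c' u ω) (k + 1) ω =
        s * M.wealth x α c (k + 1) ω + t * M.wealth y α' c' (k + 1) ω := by
      simp only [wealth]
      rw [integral_add (h1.const_mul s) (h2.const_mul t), integral_const_mul, integral_const_mul]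
      simp_rw [add_mul, Finset.sum_add_distrib, mul_assoc, ← Finset.mul_sum]
      ring
    rw [h5]
    exact add_nonneg (mul_nonneg hs h3) (mul_nonneg ht h4)

theorem Admissible.smul (h : M.Admissible x α c) {s : ℝ} (hs : 0 ≤ s) :
    M.Admissible (s * x) (fun k ω => s * α k ω) (fun u ω => s * c u ω) := by
  simpa using h.combine h hs le_rfl

theorem Admissible.mono (h : M.Admissible x α c) (hxy : x ≤ y) : M.Admissible y α c where
  investment := h.investment
  consumption := h.consumption
  nonneg := h.nonneg
  integrable := h.integrable
  wealth_nonneg k := by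
    filter_upwards [h.wealth_nonneg k] with ω h1
    rw [wealth] at h1 ⊢
    linarith

/-- The value function before truncation to the reals. -/
noncomputable def extendedValue (M : IlliquidMarket P lam p) (U : ℝ → ℝ) (ρ x : ℝ) : ℝ≥0∞ :=
  ⨆ (α : ℕ → Ω → ℝ) (c : ℝ≥0 → Ω → ℝ) (_ : M.Admissible x α c), expectedUtility P U ρ c

theorem Admissible.le_extendedValue (h : M.Admissible x α c) (U : ℝ → ℝ) (ρ : ℝ) :
    expectedUtility P U ρ c ≤ M.extendedValue U ρ x :=
  le_iSup_of_le α (le_iSup_of_le c (le_iSup_of_le h le_rfl))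

variable {U : ℝ → ℝ} {γ K₁ ρ : ℝ}

/-- Only superadditivity of the lower integral is needed in this direction, so no measurability of
`c` is involved. -/
theorem expectedUtility_combine_le (hU : IsUtility U γ K₁) (hc : ∀ u ω, 0 ≤ c u ω)
    (hc' : ∀ u ω, 0 ≤ c' u ω) {s t : ℝ} (hs : 0 ≤ s) (ht : 0 ≤ t) (hst : s + t = 1) :
    ENNReal.ofReal s * expectedUtility P U ρ c + ENNReal.ofReal t * expectedUtility P U ρ c' ≤
      expectedUtility P U ρ (fun u ω => s * c u ω + t * c' u ω) := by
  simp only [expectedUtility]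
  simp_rw [← lintegral_const_mul' _ _ ENNReal.ofReal_ne_top]
  refine (le_lintegral_add _ _).trans (lintegral_mono fun ω => ?_)
  refine (le_lintegral_add _ _).trans (lintegral_mono fun u => ?_)
  dsimp only
  have e := (Real.exp_pos (-ρ * u)).le
  rw [← ENNReal.ofReal_mul hs, ← ENNReal.ofReal_mul ht, ← ENNReal.ofReal_add
    (mul_nonneg hs (mul_nonneg e (hU.nonneg (hc _ _))))
    (mul_nonneg ht (mul_nonneg e (hU.nonneg (hc' _ _))))]
  refine ENNReal.ofReal_le_ofReal ?_
  have h1 := hU.strictConcave.concaveOn.2 (hc u.toNNReal ω) (hc' u.toNNReal ω) hs ht hst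
  simp only [smul_eq_mul] at h1
  nlinarith

theorem value_nonneg (M : IlliquidMarket P lam p) : 0 ≤ M.value U ρ x := ENNReal.toReal_nonneg

variable [IsProbabilityMeasure P] {zlo : ℝ} {zhi : EReal} {kap b β : ℝ}

/-- The growth constant of the value function. -/
noncomputable def growthConst (lam ρ zlo kap β : ℝ) : ℝ :=
  (1 / ρ + 1) / (1 - (kap / zlo) ^ β * (lam / (lam + ρ)))

theorem growthConst_nonneg (hρ : 0 < ρ) (hq : (kap / zlo) ^ β * (lam / (lam + ρ)) < 1) :
    0 ≤ growthConst lam ρ zlo kap β :=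
  div_nonneg (by positivity) (by linarith)

theorem Admissible.expectedUtility_le (hp : IsReturnLaw p zlo zhi kap b) (hlam : 0 < lam)
    (hρ : 0 < ρ) (hU : IsUtility U γ K₁) (hq : (kap / zlo) ^ γ * (lam / (lam + ρ)) < 1)
    (h : M.Admissible x α c) :
    expectedUtility P U ρ c ≤ ENNReal.ofReal (K₁ * growthConst lam ρ zlo kap γ * x ^ γ) := by
  have h1 := h.lintegral_consumption_rpow_le hp hlam hρ hU.γ_pos hU.γ_lt_one hq
  calc expectedUtility P U ρ c ≤ ∫⁻ ω, (∫⁻ t in Ioi (0 : ℝ), ENNReal.ofReal K₁ *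
        ENNReal.ofReal (Real.exp (-ρ * t) * c t.toNNReal ω ^ γ)) ∂P := by
        refine lintegral_mono fun ω => lintegral_mono fun t => ?_
        dsimp only
        rw [← ENNReal.ofReal_mul hU.K₁_pos.le]
        refine ENNReal.ofReal_le_ofReal ?_
        have h2 := hU.growth _ (h.nonneg t.toNNReal ω)
        nlinarith [Real.exp_pos (-ρ * t)]
    _ = ENNReal.ofReal K₁ * ∫⁻ ω, (∫⁻ t in Ioi (0 : ℝ),
        ENNReal.ofReal (Real.exp (-ρ * t) * c t.toNNReal ω ^ γ)) ∂P := by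
        simp_rw [lintegral_const_mul' _ _ ENNReal.ofReal_ne_top]
    _ ≤ _ := by
        rw [mul_assoc, ENNReal.ofReal_mul hU.K₁_pos.le]
        gcongr
        exact h1

theorem extendedValue_le (M : IlliquidMarket P lam p) (hp : IsReturnLaw p zlo zhi kap b)
    (hlam : 0 < lam) (hρ : 0 < ρ) (hU : IsUtility U γ K₁)
    (hq : (kap / zlo) ^ γ * (lam / (lam + ρ)) < 1) (x : ℝ) :
    M.extendedValue U ρ x ≤ ENNReal.ofReal (K₁ * growthConst lam ρ zlo kap γ * x ^ γ) :=
  iSup_le fun _ => iSup_le fun _ => iSup_le fun h => h.expectedUtility_le hp hlam hρ hU hq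

theorem value_le (M : IlliquidMarket P lam p) (hp : IsReturnLaw p zlo zhi kap b)
    (hlam : 0 < lam) (hρ : 0 < ρ) (hU : IsUtility U γ K₁)
    (hq : (kap / zlo) ^ γ * (lam / (lam + ρ)) < 1) (hx : 0 ≤ x) :
    M.value U ρ x ≤ K₁ * growthConst lam ρ zlo kap γ * x ^ γ :=
  ENNReal.toReal_le_of_le_ofReal (mul_nonneg (mul_nonneg hU.K₁_pos.le (growthConst_nonneg hρ hq))
    (Real.rpow_nonneg hx _)) (M.extendedValue_le hp hlam hρ hU hq x)

theorem Admissible.toReal_le_value (hp : IsReturnLaw p zlo zhi kap b) (hlam : 0 < lam)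
    (hρ : 0 < ρ) (hU : IsUtility U γ K₁) (hq : (kap / zlo) ^ γ * (lam / (lam + ρ)) < 1)
    (h : M.Admissible x α c) : (expectedUtility P U ρ c).toReal ≤ M.value U ρ x :=
  ENNReal.toReal_mono (ne_top_of_le_ne_top ENNReal.ofReal_ne_top
    (M.extendedValue_le hp hlam hρ hU hq x)) (h.le_extendedValue U ρ)

theorem exists_admissible_value_le (M : IlliquidMarket P lam p) (hp : IsReturnLaw p zlo zhi kap b)
    (hlam : 0 < lam) (hρ : 0 < ρ) (hU : IsUtility U γ K₁)
    (hq : (kap / zlo) ^ γ * (lam / (lam + ρ)) < 1) (hx : 0 ≤ x) {ε : ℝ} (hε : 0 < ε) :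
    ∃ α c, M.Admissible x α c ∧ M.value U ρ x ≤ (expectedUtility P U ρ c).toReal + ε := by
  have hfin : M.extendedValue U ρ x ≠ ⊤ := ne_top_of_le_ne_top ENNReal.ofReal_ne_top
    (M.extendedValue_le hp hlam hρ hU hq x)
  have hdef : M.value U ρ x = (M.extendedValue U ρ x).toReal := rfl
  -- Subtraction in `ℝ≥0∞` is truncated, so a zero value cannot be strictly lowered; there the zero
  -- policy is already optimal.
  by_cases h0 : M.extendedValue U ρ x = 0
  · refine ⟨_, _, M.admissible_zero hx, ?_⟩
    rw [hdef, h0, ENNReal.toReal_zero]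
    positivity
  · have h1 : M.extendedValue U ρ x - ENNReal.ofReal ε < M.extendedValue U ρ x :=
      ENNReal.sub_lt_self hfin h0 (by simpa using hε)
    have h2 : M.extendedValue U ρ x - ENNReal.ofReal ε < ⨆ (α : ℕ → Ω → ℝ) (c : ℝ≥0 → Ω → ℝ)
      (_ : M.Admissible x α c), expectedUtility P U ρ c := h1
    simp only [lt_iSup_iff] at h2
    obtain ⟨α, c, h, h3⟩ := h2
    refine ⟨α, c, h, ?_⟩
    have hJ : expectedUtility P U ρ c ≠ ⊤ :=
      ne_top_of_le_ne_top hfin (h.le_extendedValue U ρ)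
    have h4 := tsub_le_iff_right.1 h3.le
    have h5 := ENNReal.toReal_mono (ENNReal.add_ne_top.2 ⟨hJ, ENNReal.ofReal_ne_top⟩) h4
    rwa [ENNReal.toReal_add hJ ENNReal.ofReal_ne_top, ENNReal.toReal_ofReal hε.le] at h5

theorem concaveOn_value (M : IlliquidMarket P lam p) (hp : IsReturnLaw p zlo zhi kap b)
    (hlam : 0 < lam) (hρ : 0 < ρ) (hU : IsUtility U γ K₁)
    (hq : (kap / zlo) ^ γ * (lam / (lam + ρ)) < 1) : ConcaveOn ℝ (Ici 0) (M.value U ρ) := by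
  refine ⟨convex_Ici 0, fun x hx y hy s t hs ht hst => ?_⟩
  simp only [smul_eq_mul]
  refine le_of_forall_pos_le_add fun ε hε => ?_
  obtain ⟨α, c, h, h1⟩ := M.exists_admissible_value_le hp hlam hρ hU hq hx hε
  obtain ⟨α', c', h', h1'⟩ := M.exists_admissible_value_le hp hlam hρ hU hq hy hε
  have h2 := (h.combine h' hs ht).toReal_le_value hp hlam hρ hU hq
  have h3 := expectedUtility_combine_le (P := P) (ρ := ρ) hU h.nonneg h'.nonneg hs ht hst
  have hJ := (h.expectedUtility_le hp hlam hρ hU hq).trans_lt ENNReal.ofReal_lt_top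
  have hJ' := (h'.expectedUtility_le hp hlam hρ hU hq).trans_lt ENNReal.ofReal_lt_top
  have hJ2 := ((h.combine h' hs ht).expectedUtility_le hp hlam hρ hU hq).trans_lt
    ENNReal.ofReal_lt_top
  have h4 := ENNReal.toReal_mono hJ2.ne h3
  rw [ENNReal.toReal_add (ENNReal.mul_ne_top ENNReal.ofReal_ne_top hJ.ne)
    (ENNReal.mul_ne_top ENNReal.ofReal_ne_top hJ'.ne), ENNReal.toReal_mul, ENNReal.toReal_mul,
    ENNReal.toReal_ofReal hs, ENNReal.toReal_ofReal ht] at h4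
  have h5 : s * ε + t * ε = ε := by rw [← add_mul, hst, one_mul]
  nlinarith

theorem monotoneOn_value (M : IlliquidMarket P lam p) (hp : IsReturnLaw p zlo zhi kap b)
    (hlam : 0 < lam) (hρ : 0 < ρ) (hU : IsUtility U γ K₁)
    (hq : (kap / zlo) ^ γ * (lam / (lam + ρ)) < 1) : MonotoneOn (M.value U ρ) (Ici 0) := by
  intro x hx y hy hxy
  refine le_of_forall_pos_le_add fun ε hε => ?_
  obtain ⟨α, c, h, h1⟩ := M.exists_admissible_value_le hp hlam hρ hU hq hx hε
  exact h1.trans (by gcongr; exact (h.mono hxy).toReal_le_value hp hlam hρ hU hq)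

/-- As for `U`, concavity leaves only the endpoint 0, where the growth bound of order `x ^ γ`
squeezes the value to 0. -/
theorem continuousOn_value (M : IlliquidMarket P lam p) (hp : IsReturnLaw p zlo zhi kap b)
    (hlam : 0 < lam) (hρ : 0 < ρ) (hU : IsUtility U γ K₁)
    (hq : (kap / zlo) ^ γ * (lam / (lam + ρ)) < 1) : ContinuousOn (M.value U ρ) (Ici 0) := by
  refine (M.concaveOn_value hp hlam hρ hU hq).continuousOn_Ici ?_
  set K := K₁ * growthConst lam ρ zlo kap γ with hK
  have h1 : Filter.Tendsto (fun y : ℝ => K * y ^ γ) (nhdsWithin 0 (Ici 0)) (nhds 0) := by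
    have h2 := ((Real.continuousAt_rpow_const 0 γ (Or.inr hU.γ_pos.le)).const_mul K).tendsto
    rw [Real.zero_rpow hU.γ_pos.ne', mul_zero] at h2
    exact h2.mono_left nhdsWithin_le_nhds
  have h0 : M.value U ρ 0 = 0 := by
    refine le_antisymm ?_ M.value_nonneg
    have := M.value_le hp hlam hρ hU hq le_rfl
    rwa [Real.zero_rpow hU.γ_pos.ne', mul_zero] at this
  rw [ContinuousWithinAt, h0]
  refine squeeze_zero' (Filter.Eventually.of_forall fun y => M.value_nonneg) ?_ h1
  filter_upwards [self_mem_nhdsWithin] with y hy using M.value_le hp hlam hρ hU hq hy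

/-- The pointwise scaling inequality is integrated against `P ⊗ e^{-ρ t} dt`. The integral of the
sum on the right must be split into a sum of integrals, which is where joint measurability of `c` is
used. -/
theorem expectedUtility_second_difference (hU : IsUtility U γ K₁) (hρ : 0 < ρ)
    (hc : Measurable fun q : ℝ≥0 × Ω => c q.1 q.2) (hc0 : ∀ u ω, 0 ≤ c u ω) {r η : ℝ}
    (hr0 : 0 < r) (hr1 : r ≤ 1 / 2) (hη : 0 < η)
    (hr : ∀ y, 0 ≤ y → 2 * U y ≤ U ((1 + r) * y) + U ((1 - r) * y) + r * η * (1 + y ^ β)) :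
    2 * expectedUtility P U ρ c ≤ expectedUtility P U ρ (fun u ω => (1 + r) * c u ω) +
      expectedUtility P U ρ (fun u ω => (1 - r) * c u ω) + ENNReal.ofReal (r * η) *
        (ENNReal.ofReal (1 / ρ) + ∫⁻ ω, (∫⁻ t in Ioi (0 : ℝ),
          ENNReal.ofReal (Real.exp (-ρ * t) * c t.toNNReal ω ^ β)) ∂P) := by
  have hcm : Measurable fun q : Ω × ℝ => c q.2.toNNReal q.1 :=
    hc.comp ((measurable_real_toNNReal.comp measurable_snd).prodMk measurable_fst)
  have hJ : ∀ s : ℝ, 0 ≤ s → Measurable fun q : Ω × ℝ =>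
      ENNReal.ofReal (Real.exp (-ρ * q.2) * U (s * c q.2.toNNReal q.1)) := by
    intro s hs
    have h1 := hU.measurable_comp (hcm.const_mul s) fun q => mul_nonneg hs (hc0 _ _)
    exact (Measurable.mul (by fun_prop) h1).ennreal_ofReal
  have hB : Measurable fun q : Ω × ℝ =>
      ENNReal.ofReal (Real.exp (-ρ * q.2) * c q.2.toNNReal q.1 ^ β) :=
    (Measurable.mul (by fun_prop) (hcm.pow_const β)).ennreal_ofReal
  have hE : Measurable fun q : Ω × ℝ => ENNReal.ofReal (Real.exp (-ρ * q.2)) := by fun_prop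
  set μ := P.prod (volume.restrict (Ioi (0 : ℝ)))
  have eJ : ∀ s : ℝ, 0 ≤ s → expectedUtility P U ρ (fun u ω => s * c u ω) =
      ∫⁻ q, ENNReal.ofReal (Real.exp (-ρ * q.2) * U (s * c q.2.toNNReal q.1)) ∂μ := fun s hs =>
    (lintegral_prod _ (hJ s hs).aemeasurable).symm
  have eB : ∫⁻ ω, (∫⁻ t in Ioi (0 : ℝ),
      ENNReal.ofReal (Real.exp (-ρ * t) * c t.toNNReal ω ^ β)) ∂P =
      ∫⁻ q, ENNReal.ofReal (Real.exp (-ρ * q.2) * c q.2.toNNReal q.1 ^ β) ∂μ :=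
    (lintegral_prod _ hB.aemeasurable).symm
  have eE : ENNReal.ofReal (1 / ρ) = ∫⁻ q, ENNReal.ofReal (Real.exp (-ρ * q.2)) ∂μ := by
    rw [lintegral_prod _ hE.aemeasurable]
    simp only [lintegral_exp_neg_mul_Ioi hρ, mul_zero, Real.exp_zero, lintegral_const,
      measure_univ, mul_one]
  have e1 : expectedUtility P U ρ c = expectedUtility P U ρ (fun u ω => 1 * c u ω) := by
    simp only [one_mul]
  rw [e1, eJ 1 zero_le_one, eJ (1 + r) (by linarith), eJ (1 - r) (by linarith), eB, eE,
    ← lintegral_add_left hE, ← lintegral_const_mul' _ _ ENNReal.ofReal_ne_top,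
    ← lintegral_const_mul' _ _ ENNReal.ofNat_ne_top, ← lintegral_add_left (hJ _ (by linarith)),
    ← lintegral_add_left (f := fun q : Ω × ℝ =>
      ENNReal.ofReal (Real.exp (-ρ * q.2) * U ((1 + r) * c q.2.toNNReal q.1)) +
      ENNReal.ofReal (Real.exp (-ρ * q.2) * U ((1 - r) * c q.2.toNNReal q.1)))
      ((hJ _ (by linarith)).add (hJ _ (by linarith)))]
  refine lintegral_mono fun q => ?_
  have hy := hc0 q.2.toNNReal q.1
  have e := (Real.exp_pos (-ρ * q.2)).le
  have hyb := Real.rpow_nonneg hy β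
  have a1 := mul_nonneg e (hU.nonneg (mul_nonneg (show 0 ≤ 1 + r by linarith) hy))
  have a2 := mul_nonneg e (hU.nonneg (mul_nonneg (show 0 ≤ 1 - r by linarith) hy))
  have a3 := mul_nonneg e hyb
  have h2 : (2 : ℝ≥0∞) = ENNReal.ofReal 2 := by simp
  dsimp only
  rw [h2, ← ENNReal.ofReal_add e a3, ← ENNReal.ofReal_mul (by positivity),
    ← ENNReal.ofReal_mul (by positivity), ← ENNReal.ofReal_add a1 a2,
    ← ENNReal.ofReal_add (add_nonneg a1 a2) (by positivity)]
  refine ENNReal.ofReal_le_ofReal ?_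
  have h3 := mul_le_mul_of_nonneg_left (hr _ hy) e
  rw [one_mul]
  linarith

/-- A nearly optimal policy for `x`, scaled by `1 ± h / x`, competes at `x ± h`. Its total second
difference is controlled by the `β`-th moment of consumption, which has a bound independent of the
policy, so the near-optimality error can be sent to 0 with `h` fixed. -/
theorem differentiableAt_value (M : IlliquidMarket P lam p) (hp : IsReturnLaw p zlo zhi kap b)
    (hlam : 0 < lam) (hρ : 0 < ρ) (hU : IsUtility U γ K₁)
    (hq : (kap / zlo) ^ γ * (lam / (lam + ρ)) < 1) (hβ : γ < β) (hβ1 : β < 1)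
    (hqβ : (kap / zlo) ^ β * (lam / (lam + ρ)) < 1) (hx : 0 < x) :
    DifferentiableAt ℝ (M.value U ρ) x := by
  have hβ0 := hU.γ_pos.trans hβ
  refine (M.concaveOn_value hp hlam hρ hU hq).differentiableAt_of_second_difference
    (by rwa [interior_Ici]) fun η hη => ?_
  set B := growthConst lam ρ zlo kap β * x ^ β with hBdef
  have hB : 0 ≤ B := mul_nonneg (growthConst_nonneg hρ hqβ) (Real.rpow_nonneg hx.le _)
  have hD : 0 < 1 / ρ + B := by positivity
  -- With `r = h / x`, this tolerance makes the total error `r (η x / (1 / ρ + B)) (1 / ρ + B)`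
  -- equal to `h η`.
  obtain ⟨r₀, hr₀, hr₀', hr⟩ := hU.second_difference hβ
    (show 0 < η * x / (1 / ρ + B) by positivity)
  refine ⟨r₀ * x, by positivity, fun h hh0 hh => ?_⟩
  set r := h / x with hrdef
  have hr0 : 0 < r := by positivity
  have hrr : r < r₀ := by rwa [hrdef, div_lt_iff₀ hx]
  have e1 : x + h = (1 + r) * x := by rw [hrdef]; field_simp
  have e2 : x - h = (1 - r) * x := by rw [hrdef]; field_simp
  refine le_of_forall_pos_le_add fun ε hε => ?_
  obtain ⟨α, c, hadm, h1⟩ := M.exists_admissible_value_le hp hlam hρ hU hq hx.le (half_pos hε)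
  have h2 := expectedUtility_second_difference (P := P) (ρ := ρ) hU hρ
    (M.measurable_consumption hadm.consumption) hadm.nonneg hr0 (by linarith)
    (show 0 < η * x / (1 / ρ + B) by positivity) (hr r hr0 hrr)
  have h3 := hadm.lintegral_consumption_rpow_le hp hlam hρ hβ0 hβ1 hqβ
  have hp1 := hadm.smul (show 0 ≤ 1 + r by linarith)
  have hp2 := hadm.smul (show 0 ≤ 1 - r by linarith)
  have f1 := (hp1.expectedUtility_le hp hlam hρ hU hq).trans_lt ENNReal.ofReal_lt_top
  have f2 := (hp2.expectedUtility_le hp hlam hρ hU hq).trans_lt ENNReal.ofReal_lt_top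
  have h4 : 2 * expectedUtility P U ρ c ≤ expectedUtility P U ρ (fun u ω => (1 + r) * c u ω) +
      expectedUtility P U ρ (fun u ω => (1 - r) * c u ω) + ENNReal.ofReal (h * η) := by
    refine h2.trans ?_
    gcongr
    calc _ ≤ ENNReal.ofReal (r * (η * x / (1 / ρ + B))) *
          (ENNReal.ofReal (1 / ρ) + ENNReal.ofReal B) := by
          gcongr
          exact h3
      _ = ENNReal.ofReal (h * η) := by
          rw [← ENNReal.ofReal_add (by positivity) hB, ← ENNReal.ofReal_mul (by positivity)]
          congr 1
          rw [hrdef]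
          field_simp
  have h5 := ENNReal.toReal_mono
    (ENNReal.add_ne_top.2 ⟨ENNReal.add_ne_top.2 ⟨f1.ne, f2.ne⟩, ENNReal.ofReal_ne_top⟩) h4
  rw [ENNReal.toReal_mul, ENNReal.toReal_add (ENNReal.add_ne_top.2 ⟨f1.ne, f2.ne⟩)
    ENNReal.ofReal_ne_top, ENNReal.toReal_add f1.ne f2.ne, ENNReal.toReal_ofReal (by positivity),
    ENNReal.toReal_ofNat] at h5
  have h6 := hp1.toReal_le_value hp hlam hρ hU hq
  have h7 := hp2.toReal_le_value hp hlam hρ hU hq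
  rw [e1, e2]
  linarith

end IlliquidMarket

/-! ### From the value function to the running reward -/

/-- Running rewards for which the auxiliary problem is well behaved on the state space
`[l, ∞)`. -/
structure IsRunningReward (G : ℝ → ℝ) (l : ℝ) : Prop where
  concaveOn : ConcaveOn ℝ (Ici l) G
  monotoneOn : MonotoneOn G (Ici l)
  nonneg : ∀ y, l ≤ y → 0 ≤ G y
  continuousOn : ContinuousOn G (Ici l)
  differentiableAt : ∀ y, l < y → DifferentiableAt ℝ G y

theorem ConcaveOn.le_mul_of_nonneg {v : ℝ → ℝ} (hv : ConcaveOn ℝ (Ici 0) v) (h0 : 0 ≤ v 0)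
    {e w : ℝ} (he : 0 < e) (hew : e ≤ w) : v w ≤ v e / e * w := by
  have hw : 0 < w := he.trans_le hew
  have h1 := hv.smul_le_of_nonneg h0 (s := e / w) (by positivity) ((div_le_one hw).2 hew) hw.le
  rw [zero_add, zero_add, div_mul_cancel₀ _ hw.ne', div_mul_eq_mul_div, div_le_iff₀ hw] at h1
  rw [div_mul_eq_mul_div, le_div_iff₀ he]
  linarith

/-- The ratio `v w / w` decreases. For `e ≤ u ≤ w` this gives `v w - v u ≤ (1 - u / w) v w`, and
then `v w ≤ (v e / e) w`. The explicit constant serves as a dominating bound that is uniform in `z`.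
-/
theorem ConcaveOn.lipschitzOnWith_Ici {v : ℝ → ℝ} (hv : ConcaveOn ℝ (Ici 0) v) (h0 : 0 ≤ v 0)
    (hm : MonotoneOn v (Ici 0)) {e : ℝ} (he : 0 < e) :
    LipschitzOnWith (Real.nnabs (v e / e)) v (Ici e) := by
  have hve : 0 ≤ v e / e := div_nonneg (h0.trans (hm self_mem_Ici he.le he.le)) he.le
  have key : ∀ u ∈ Ici e, ∀ w ∈ Ici e, u ≤ w → |v w - v u| ≤ v e / e * (w - u) := by
    intro u hu w hw huw
    have hu0 : 0 < u := he.trans_le hu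
    have hw0 : 0 < w := he.trans_le hw
    rw [abs_of_nonneg (sub_nonneg.2 (hm hu0.le hw0.le huw))]
    have h1 := hv.smul_le_of_nonneg h0 (s := u / w) (by positivity) ((div_le_one hw0).2 huw) hw0.le
    rw [zero_add, zero_add, div_mul_cancel₀ _ hw0.ne'] at h1
    have h2 := hv.le_mul_of_nonneg h0 he hw
    have h3 : v w - v u ≤ (1 - u / w) * v w := by linarith
    have h4 : 0 ≤ 1 - u / w := sub_nonneg.2 ((div_le_one hw0).2 huw)
    calc v w - v u ≤ (1 - u / w) * v w := h3
      _ ≤ (1 - u / w) * (v e / e * w) := mul_le_mul_of_nonneg_left h2 h4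
      _ = v e / e * (w - u) := by field_simp
  refine LipschitzOnWith.of_dist_le_mul fun u hu w hw => ?_
  rw [Real.coe_nnabs, abs_of_nonneg hve, Real.dist_eq, Real.dist_eq]
  rcases le_total u w with h | h
  · have := key u hu w hw h
    rwa [abs_sub_comm, abs_sub_comm u w, abs_of_nonneg (sub_nonneg.2 h)]
  · have := key w hw u hu h
    rwa [abs_of_nonneg (sub_nonneg.2 h)]

/-- Averaging a nonnegative, increasing, differentiable concave function over returns. -/
theorem isRunningReward_integral {p : Measure ℝ} [IsProbabilityMeasure p]
    (hint : Integrable (fun z : ℝ => z) p) {v : ℝ → ℝ} (hv : ConcaveOn ℝ (Ici 0) v)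
    (hm : MonotoneOn v (Ici 0)) (hv0 : ∀ y, 0 ≤ v y) (hvc : ContinuousOn v (Ici 0))
    (hvd : ∀ y, 0 < y → DifferentiableAt ℝ v y) {lam : ℝ} (hlam : 0 < lam) {a l : ℝ}
    (hal : ∀ y, ∀ᵐ z ∂p, y - l ≤ y + a * z) :
    IsRunningReward (fun y => lam * ∫ z, v (y + a * z) ∂p) l := by
  have hpos : ∀ y, l ≤ y → ∀ᵐ z ∂p, 0 ≤ y + a * z := fun y hy => by
    filter_upwards [hal y] with z hz
    linarith
  have hcm : Continuous fun u => v (max u 0) :=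
    hvc.comp_continuous (by fun_prop) fun u => le_max_right u 0
  have hmeas : ∀ y, l ≤ y → AEStronglyMeasurable (fun z => v (y + a * z)) p := by
    intro y hy
    have h1 : Continuous fun z => v (max (y + a * z) 0) := hcm.comp (by fun_prop)
    refine h1.aestronglyMeasurable.congr ?_
    filter_upwards [hpos y hy] with z hz
    rw [max_eq_left hz]
  -- Linear growth together with the first moment of `p` provides an integrable majorant.
  have hgrow : ∀ u, 0 ≤ u → v u ≤ v 1 * (1 + |u|) := by
    intro u hu
    rcases le_total u 1 with h | h
    · have h1 := hm hu (zero_le_one' ℝ) h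
      nlinarith [hv0 1, abs_nonneg u]
    · have h1 := hv.le_mul_of_nonneg (hv0 0) one_pos h
      rw [abs_of_nonneg hu]
      rw [div_one] at h1
      nlinarith [hv0 1]
  have hbound : ∀ y, l ≤ y → ∀ B, |y| ≤ B →
      ∀ᵐ z ∂p, ‖v (y + a * z)‖ ≤ v 1 * (1 + (B + |a| * |z|)) := by
    intro y hy B hB
    filter_upwards [hpos y hy] with z hz
    rw [Real.norm_of_nonneg (hv0 _)]
    refine (hgrow _ hz).trans ?_
    have h1 : |y + a * z| ≤ |y| + |a| * |z| := by
      rw [← abs_mul]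
      exact abs_add_le _ _
    have := hv0 1
    gcongr
    linarith
  have hbint : ∀ B, Integrable (fun z : ℝ => v 1 * (1 + (B + |a| * |z|))) p := fun B =>
    ((integrable_const 1).add ((integrable_const B).add (hint.abs.const_mul |a|))).const_mul (v 1)
  have hI : ∀ y, l ≤ y → Integrable (fun z => v (y + a * z)) p := fun y hy =>
    Integrable.mono' (hbint |y|) (hmeas y hy) (hbound y hy |y| le_rfl)
  have hconc : ConcaveOn ℝ (Ici l) fun y => lam * ∫ z, v (y + a * z) ∂p := by
    refine ⟨convex_Ici l, fun x hx y hy s t hs ht hst => ?_⟩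
    simp only [smul_eq_mul]
    have hxy : l ≤ s * x + t * y := by
      have := (convex_Ici l) hx hy hs ht hst
      simpa using this
    have h1 : s * ∫ z, v (x + a * z) ∂p + t * ∫ z, v (y + a * z) ∂p ≤
        ∫ z, v (s * x + t * y + a * z) ∂p := by
      rw [← integral_const_mul, ← integral_const_mul,
        ← integral_add ((hI x hx).const_mul s) ((hI y hy).const_mul t)]
      refine integral_mono_ae (((hI x hx).const_mul s).add ((hI y hy).const_mul t)) (hI _ hxy) ?_
      filter_upwards [hpos x hx, hpos y hy] with z hzx hzy
      have h2 := hv.2 hzx hzy hs ht hst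
      simp only [smul_eq_mul] at h2
      have h3 : s * (x + a * z) + t * (y + a * z) = s * x + t * y + a * z := by
        have : a * z = (s + t) * (a * z) := by rw [hst, one_mul]
        linear_combination -this
      rw [h3] at h2
      exact h2
    calc _ = lam * (s * ∫ z, v (x + a * z) ∂p + t * ∫ z, v (y + a * z) ∂p) := by ring
      _ ≤ _ := mul_le_mul_of_nonneg_left h1 hlam.le
  refine ⟨hconc, ?_, ?_, ?_, ?_⟩
  · intro x hx y hy hxy
    refine mul_le_mul_of_nonneg_left (integral_mono_ae (hI x hx) (hI y hy) ?_) hlam.le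
    filter_upwards [hpos x hx, hpos y hy] with z hzx hzy
    exact hm hzx hzy (by linarith)
  · exact fun y _ => mul_nonneg hlam.le (integral_nonneg fun z => hv0 _)
  · refine hconc.continuousOn_Ici ?_
    refine ContinuousWithinAt.mul continuousWithinAt_const ?_
    refine continuousWithinAt_of_dominated (bound := fun z => v 1 * (1 + ((|l| + 1) + |a| * |z|)))
      ?_ ?_ (hbint _) ?_
    · filter_upwards [self_mem_nhdsWithin] with y hy using hmeas y hy
    · have h1 : Icc l (l + 1) ∈ nhdsWithin l (Ici l) := Icc_mem_nhdsGE (by linarith)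
      filter_upwards [h1] with y hy
      refine hbound y hy.1 _ ?_
      rw [abs_le]
      constructor <;> cases abs_cases l <;> linarith [hy.1, hy.2]
    · filter_upwards [hpos l le_rfl, hal 0] with z hz hz'
      have h1 : ContinuousWithinAt v (Ici 0) (l + a * z) := hvc _ hz
      refine ContinuousWithinAt.comp (t := Ici 0) h1 (by fun_prop) fun y hy => ?_
      have : l ≤ y := hy
      change 0 ≤ y + a * z
      linarith
  · intro y hy
    -- On the ball of this radius about `y`, the shifted argument `x + a z` stays at least `(y - l)
    -- / 2` for almost every `z`. There `v` is Lipschitz with one constant, so differentiation under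
    -- the integral is allowed.
    have hd : 0 < (y - l) / 2 := by linarith
    have hball : ∀ x ∈ Metric.ball y ((y - l) / 2), l ≤ x ∧ (y - l) / 2 ≤ x - l := by
      intro x hx
      rw [Metric.mem_ball, Real.dist_eq, abs_lt] at hx
      constructor <;> linarith [hx.1]
    have h := hasDerivAt_integral_of_dominated_loc_of_lip (μ := p)
      (F := fun x z => v (x + a * z)) (F' := fun z => deriv v (y + a * z)) (x₀ := y)
      (bound := fun _ => v ((y - l) / 2) / ((y - l) / 2)) (Metric.ball_mem_nhds y hd)
      (by filter_upwards [Metric.ball_mem_nhds y hd] with x hx using hmeas x (hball x hx).1)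
      (hI y hy.le)
      (((measurable_deriv v).comp (by fun_prop :
        Measurable fun z : ℝ => y + a * z)).aestronglyMeasurable)
      (by
        filter_upwards [hal 0] with z hz
        have h1 := hv.lipschitzOnWith_Ici (hv0 0) hm hd
        refine LipschitzOnWith.of_dist_le_mul fun x hx w hw => ?_
        have h2 := h1.dist_le_mul (x + a * z)
          (by have := (hball x hx).2; change _ ≤ x + a * z; linarith) (w + a * z)
          (by have := (hball w hw).2; change _ ≤ w + a * z; linarith)
        rwa [dist_add_right] at h2)
      (integrable_const _)
      (by
        filter_upwards [hal 0] with z hz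
        have h1 := (hvd (y + a * z) (by linarith)).hasDerivAt
        exact h1.comp_add_const y (a * z))
    exact (h.2.const_mul lam).differentiableAt

/-- The strict inequality is an open condition on the exponent. The room between `γ` and `β` makes
large consumption negligible in the second differences of `U`. -/
theorem exists_exponent_gt {κ lam ρ γ : ℝ} (hκ : 0 < κ) (hγ1 : γ < 1)
    (h : κ ^ γ * (lam / (lam + ρ)) < 1) :
    ∃ β, γ < β ∧ β < 1 ∧ κ ^ β * (lam / (lam + ρ)) < 1 := by
  have h1 : Continuous fun β : ℝ => κ ^ β * (lam / (lam + ρ)) :=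
    (Real.continuous_const_rpow hκ.ne').mul continuous_const
  have h2 := (h1.tendsto γ).eventually (gt_mem_nhds h)
  have h3 : ∀ᶠ β in nhdsWithin γ (Ioi γ), κ ^ β * (lam / (lam + ρ)) < 1 :=
    h2.filter_mono nhdsWithin_le_nhds
  obtain ⟨β, h4, h5⟩ := (h3.and (Ioo_mem_nhdsGT hγ1)).exists
  exact ⟨β, h5.1, h5.2, h4⟩

namespace IlliquidMarket

variable {Ω : Type*} [mΩ : MeasurableSpace Ω] {P : Measure Ω} {lam : ℝ} {p : Measure ℝ}
  [IsProbabilityMeasure P] {zlo : ℝ} {zhi : EReal} {kap b ρ γ K₁ : ℝ} {U : ℝ → ℝ}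

theorem isRunningReward_g (M : IlliquidMarket P lam p) (hlam : 0 < lam) (hρ : 0 < ρ)
    (hp : IsReturnLaw p zlo zhi kap b) (hU : IsUtility U γ K₁)
    (hρb : b * γ + lam * (kap ^ γ / zlo ^ γ - 1) < ρ) {a : ℝ} (ha : a ∈ investmentSet zhi) :
    IsRunningReward (M.g U ρ a) (lowerWealth zlo zhi a) := by
  have := hp.isProb
  -- Since `b γ ≥ 0`, the hypothesis on `ρ` implies `lam (kap / zlo) ^ γ < lam + ρ`.
  have hq : (kap / zlo) ^ γ * (lam / (lam + ρ)) < 1 := by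
    rw [Real.div_rpow hp.kap_nonneg hp.zlo_pos.le, mul_div_assoc', div_lt_one (by positivity)]
    have := mul_nonneg hp.b_nonneg hU.γ_pos.le
    nlinarith
  obtain ⟨β, hβ, hβ1, hqβ⟩ := exists_exponent_gt hp.kap_div_pos hU.γ_lt_one hq
  exact isRunningReward_integral hp.integrable (M.concaveOn_value hp hlam hρ hU hq)
    (M.monotoneOn_value hp hlam hρ hU hq) (fun _ => M.value_nonneg)
    (M.continuousOn_value hp hlam hρ hU hq)
    (fun y hy => M.differentiableAt_value hp hlam hρ hU hq hβ hβ1 hqβ hy) hlam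
    (hp.ae_sub_lowerWealth_le ha)

end IlliquidMarket

/-! ### The auxiliary problem as a finite real optimization problem -/

/-- The measure `e^{-δ s} ds` on `(0, ∞)`. -/
noncomputable def discountMeasure (δ : ℝ) : Measure ℝ :=
  (volume.restrict (Ioi (0 : ℝ))).withDensity fun s => ENNReal.ofReal (Real.exp (-δ * s))

theorem lintegral_discountMeasure (δ : ℝ) (f : ℝ → ℝ≥0∞) :
    ∫⁻ s, f s ∂(discountMeasure δ) =
      ∫⁻ s in Ioi (0 : ℝ), ENNReal.ofReal (Real.exp (-δ * s)) * f s :=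
  lintegral_withDensity_eq_lintegral_mul_non_measurable _ (by fun_prop)
    (Filter.Eventually.of_forall fun _ => ENNReal.ofReal_lt_top) f

theorem integral_discountMeasure (δ : ℝ) (f : ℝ → ℝ) :
    ∫ s, f s ∂(discountMeasure δ) = ∫ s in Ioi (0 : ℝ), Real.exp (-δ * s) * f s := by
  rw [discountMeasure, integral_withDensity_eq_integral_toReal_smul (by fun_prop)
    (Filter.Eventually.of_forall fun _ => ENNReal.ofReal_lt_top)]
  simp_rw [ENNReal.toReal_ofReal (Real.exp_pos _).le, smul_eq_mul]

theorem ae_discountMeasure_iff {δ : ℝ} {q : ℝ → Prop} :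
    (∀ᵐ s ∂(discountMeasure δ), q s) ↔ ∀ᵐ s ∂(volume.restrict (Ioi (0 : ℝ))), q s := by
  rw [discountMeasure, ae_withDensity_iff (by fun_prop)]
  have : ∀ s, ENNReal.ofReal (Real.exp (-δ * s)) ≠ 0 := fun s => by
    simpa using Real.exp_pos _
  exact ⟨fun h => h.mono fun s hs => hs (this s), fun h => h.mono fun s hs _ => hs⟩

theorem ae_discountMeasure_pos (δ : ℝ) : ∀ᵐ s ∂(discountMeasure δ), 0 < s :=
  ae_discountMeasure_iff.2 (ae_restrict_mem measurableSet_Ioi)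

theorem isFiniteMeasure_discountMeasure {δ : ℝ} (hδ : 0 < δ) :
    IsFiniteMeasure (discountMeasure δ) := by
  refine ⟨?_⟩
  have h := lintegral_discountMeasure δ (fun _ => 1)
  rw [lintegral_one] at h
  rw [h]
  simp only [mul_one]
  rw [lintegral_exp_neg_mul_Ioi hδ]
  exact ENNReal.ofReal_lt_top

theorem integrable_discountMeasure {δ : ℝ} (hδ : 0 < δ) {f : ℝ → ℝ}
    (hf : IntegrableOn f (Ioi 0)) : Integrable f (discountMeasure δ) := by
  rw [discountMeasure, integrable_withDensity_iff_integrable_smul' (by fun_prop)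
    (Filter.Eventually.of_forall fun _ => ENNReal.ofReal_lt_top)]
  refine Integrable.mono' hf.norm ?_ ?_
  · exact (by fun_prop : Measurable fun s => (ENNReal.ofReal (Real.exp (-δ * s))).toReal)
      |>.aestronglyMeasurable.smul hf.aestronglyMeasurable
  · filter_upwards [ae_restrict_mem measurableSet_Ioi] with s hs
    rw [ENNReal.toReal_ofReal (Real.exp_pos _).le, norm_smul,
      Real.norm_of_nonneg (Real.exp_pos _).le]
    have : Real.exp (-δ * s) ≤ 1 := Real.exp_le_one_iff.2 (by nlinarith [mem_Ioi.1 hs])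
    nlinarith [norm_nonneg (f s)]

namespace AuxAdmissible

variable {l x : ℝ} {c c' : ℝ → ℝ}

theorem intervalIntegrable (h : AuxAdmissible l x c) {s t : ℝ} (hs : 0 ≤ s) (ht : 0 ≤ t) :
    IntervalIntegrable c volume s t :=
  (h.integrable s hs).symm.trans (h.integrable t ht)

theorem initial_le (h : AuxAdmissible l x c) : l ≤ x := by
  have := h.budget 0 le_rfl
  rw [intervalIntegral.integral_same] at this
  linarith

theorem le_wealthBetween (h : AuxAdmissible l x c) {t : ℝ} (ht : 0 ≤ t) :
    l ≤ wealthBetween x c t := by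
  have := h.budget t ht
  rw [wealthBetween]
  linarith

theorem wealthBetween_sub (h : AuxAdmissible l x c) {s t : ℝ} (hs : 0 ≤ s) (ht : 0 ≤ t) :
    wealthBetween x c s - wealthBetween x c t = ∫ u in s..t, c u := by
  rw [wealthBetween, wealthBetween,
    ← intervalIntegral.integral_add_adjacent_intervals (h.integrable s hs)
      (h.intervalIntegrable hs ht)]
  ring

theorem wealthBetween_anti (h : AuxAdmissible l x c) {s t : ℝ} (hs : 0 ≤ s) (hst : s ≤ t) :
    wealthBetween x c t ≤ wealthBetween x c s := by
  have h1 := h.wealthBetween_sub hs (hs.trans hst)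
  have h2 : 0 ≤ ∫ u in s..t, c u :=
    intervalIntegral.integral_nonneg hst fun u hu => h.nonneg u (hs.trans hu.1)
  linarith

theorem wealthBetween_le (h : AuxAdmissible l x c) {t : ℝ} (ht : 0 ≤ t) :
    wealthBetween x c t ≤ x := by
  have := h.wealthBetween_anti le_rfl ht
  simpa [wealthBetween] using this

theorem continuousOn_wealthBetween (h : AuxAdmissible l x c) :
    ContinuousOn (wealthBetween x c) (Ici 0) := by
  intro t ht
  have ht' : (0 : ℝ) ≤ t := ht
  have h1 : ContinuousOn (fun s => ∫ u in (0 : ℝ)..s, c u) (uIcc 0 (t + 1)) :=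
    intervalIntegral.continuousOn_primitive_interval' (h.integrable (t + 1) (by linarith))
      left_mem_uIcc
  rw [uIcc_of_le (by linarith)] at h1
  have h2 : ContinuousWithinAt (fun s => ∫ u in (0 : ℝ)..s, c u) (Ici 0) t := by
    refine (h1 t ⟨ht', by linarith⟩).mono_of_mem_nhdsWithin ?_
    refine mem_nhdsWithin.2 ⟨Iio (t + 1), isOpen_Iio, by simp, fun s hs => ⟨hs.2, hs.1.le⟩⟩
  exact continuousWithinAt_const.sub h2

theorem integrableOn_Ioi (h : AuxAdmissible l x c) : IntegrableOn c (Ioi 0) := by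
  refine integrableOn_Ioi_of_intervalIntegral_norm_bounded (b := fun i : ℝ => i) (l := Filter.atTop)
    (x - l) 0 (fun i => ?_) Filter.tendsto_id ?_
  · rcases le_total 0 i with hi | hi
    · exact (intervalIntegrable_iff_integrableOn_Ioc_of_le hi).1 (h.integrable i hi)
    · simp [Ioc_eq_empty_of_le hi]
  · filter_upwards [Filter.eventually_ge_atTop 0] with i hi
    refine le_trans (le_of_eq ?_) (h.budget i hi)
    refine intervalIntegral.integral_congr fun u hu => ?_
    rw [uIcc_of_le hi] at hu
    exact Real.norm_of_nonneg (h.nonneg u hu.1)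

theorem integral_Ioi_le (h : AuxAdmissible l x c) : ∫ s in Ioi (0 : ℝ), c s ≤ x - l :=
  le_of_tendsto (intervalIntegral_tendsto_integral_Ioi 0 h.integrableOn_Ioi Filter.tendsto_id)
    (by filter_upwards [Filter.eventually_ge_atTop 0] with i hi using h.budget i hi)

theorem integrable_discount {δ : ℝ} (hδ : 0 < δ) (h : AuxAdmissible l x c) :
    Integrable c (discountMeasure δ) :=
  integrable_discountMeasure hδ h.integrableOn_Ioi

theorem integral_discount_le {δ : ℝ} (hδ : 0 < δ) (h : AuxAdmissible l x c) :
    ∫ s, c s ∂(discountMeasure δ) ≤ x - l := by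
  rw [integral_discountMeasure]
  have h0 : ∀ᵐ s ∂(volume.restrict (Ioi (0 : ℝ))), Real.exp (-δ * s) * c s ≤ c s := by
    filter_upwards [ae_restrict_mem measurableSet_Ioi] with s hs
    have : Real.exp (-δ * s) ≤ 1 := Real.exp_le_one_iff.2 (by nlinarith [mem_Ioi.1 hs])
    nlinarith [h.nonneg s (le_of_lt hs)]
  have h1 : ∀ᵐ s ∂(volume.restrict (Ioi (0 : ℝ))), 0 ≤ Real.exp (-δ * s) * c s := by
    filter_upwards [ae_restrict_mem measurableSet_Ioi] with s hs
    exact mul_nonneg (Real.exp_pos _).le (h.nonneg s (le_of_lt hs))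
  exact (integral_mono_of_nonneg h1 h.integrableOn_Ioi h0).trans h.integral_Ioi_le

theorem combine (h : AuxAdmissible l x c) (h' : AuxAdmissible l x c') {s t : ℝ} (hs : 0 ≤ s)
    (ht : 0 ≤ t) (hst : s + t = 1) : AuxAdmissible l x fun u => s * c u + t * c' u where
  measurable := (h.measurable.const_mul s).add (h'.measurable.const_mul t)
  nonneg u hu := add_nonneg (mul_nonneg hs (h.nonneg u hu)) (mul_nonneg ht (h'.nonneg u hu))
  integrable u hu := ((h.integrable u hu).const_mul s).add ((h'.integrable u hu).const_mul t)
  budget u hu := by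
    rw [intervalIntegral.integral_add ((h.integrable u hu).const_mul s)
      ((h'.integrable u hu).const_mul t), intervalIntegral.integral_const_mul,
      intervalIntegral.integral_const_mul]
    have h1 := mul_le_mul_of_nonneg_left (h.budget u hu) hs
    have h2 := mul_le_mul_of_nonneg_left (h'.budget u hu) ht
    have h3 : s * (x - l) + t * (x - l) = x - l := by rw [← add_mul, hst, one_mul]
    linarith

theorem wealthBetween_combine (h : AuxAdmissible l x c) (h' : AuxAdmissible l x c') {s t u : ℝ}
    (hst : s + t = 1) (hu : 0 ≤ u) : wealthBetween x (fun u => s * c u + t * c' u) u =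
      s * wealthBetween x c u + t * wealthBetween x c' u := by
  simp only [wealthBetween]
  rw [intervalIntegral.integral_add ((h.integrable u hu).const_mul s)
      ((h'.integrable u hu).const_mul t), intervalIntegral.integral_const_mul,
      intervalIntegral.integral_const_mul]
  have h3 : s * x + t * x = x := by rw [← add_mul, hst, one_mul]
  linarith

end AuxAdmissible

theorem auxAdmissible_zero {l x : ℝ} (hx : l ≤ x) : AuxAdmissible l x fun _ => 0 where
  measurable := measurable_const
  nonneg _ _ := le_rfl
  integrable _ _ := intervalIntegrable_const
  budget t _ := by simpa using hx

/-- The discounted reward as a real integral. -/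
noncomputable def realReward (U G : ℝ → ℝ) (δ x : ℝ) (c : ℝ → ℝ) : ℝ :=
  ∫ s, (U (c s) + G (wealthBetween x c s)) ∂(discountMeasure δ)

section Reward

variable {U G : ℝ → ℝ} {γ K₁ δ l x : ℝ} {c c' : ℝ → ℝ}

theorem AuxAdmissible.aemeasurable_wealthBetween (h : AuxAdmissible l x c) :
    AEMeasurable (wealthBetween x c) (discountMeasure δ) :=
  ((h.continuousOn_wealthBetween.mono Ioi_subset_Ici_self).aemeasurable measurableSet_Ioi).mono_ac
    (withDensity_absolutelyContinuous _ _)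

theorem AuxAdmissible.continuousOn_reward (hG : IsRunningReward G l) (h : AuxAdmissible l x c) :
    ContinuousOn (fun s => G (wealthBetween x c s)) (Ici 0) :=
  hG.continuousOn.comp h.continuousOn_wealthBetween fun _ ht => h.le_wealthBetween ht

theorem AuxAdmissible.integrable_reward (hδ : 0 < δ) (hG : IsRunningReward G l)
    (h : AuxAdmissible l x c) :
    Integrable (fun s => G (wealthBetween x c s)) (discountMeasure δ) := by
  have := isFiniteMeasure_discountMeasure hδ
  refine Integrable.mono' (integrable_const (G x)) ?_ ?_
  · exact ((((h.continuousOn_reward hG).mono Ioi_subset_Ici_self).aemeasurable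
      measurableSet_Ioi).mono_ac (withDensity_absolutelyContinuous _ _)).aestronglyMeasurable
  · filter_upwards [ae_discountMeasure_pos δ] with s hs
    have h1 := h.le_wealthBetween hs.le
    have h2 := h.wealthBetween_le hs.le
    rw [Real.norm_of_nonneg (hG.nonneg _ h1)]
    exact hG.monotoneOn h1 (h1.trans h2) h2

/-- The tangent at 1 majorizes `U` by an affine function, and the budget makes `c` integrable. -/
theorem AuxAdmissible.integrable_utility (hδ : 0 < δ) (hU : IsUtility U γ K₁)
    (h : AuxAdmissible l x c) : Integrable (fun s => U (c s)) (discountMeasure δ) := by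
  have := isFiniteMeasure_discountMeasure hδ
  have hd := hU.deriv_pos one_pos
  refine Integrable.mono' ((integrable_const (U 1)).add
    ((h.integrable_discount hδ).const_mul (deriv U 1))) ?_ ?_
  · have h1 : Measurable fun s => U (max (c s) 0) :=
      hU.continuous_max.measurable.comp h.measurable
    refine h1.aestronglyMeasurable.congr ?_
    filter_upwards [ae_discountMeasure_pos δ] with s hs
    rw [max_eq_left (h.nonneg s hs.le)]
  · filter_upwards [ae_discountMeasure_pos δ] with s hs
    have h0 := h.nonneg s hs.le
    rw [Real.norm_of_nonneg (hU.nonneg h0)]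
    have h1 := hU.le_tangent one_pos h0
    simp only [Pi.add_apply]
    linarith

theorem AuxAdmissible.integrable_total (hδ : 0 < δ) (hU : IsUtility U γ K₁)
    (hG : IsRunningReward G l) (h : AuxAdmissible l x c) :
    Integrable (fun s => U (c s) + G (wealthBetween x c s)) (discountMeasure δ) :=
  (h.integrable_utility hδ hU).add (h.integrable_reward hδ hG)

theorem AuxAdmissible.ae_total_nonneg (hU : IsUtility U γ K₁)
    (hG : IsRunningReward G l) (h : AuxAdmissible l x c) :
    ∀ᵐ s ∂(discountMeasure δ), 0 ≤ U (c s) + G (wealthBetween x c s) := by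
  filter_upwards [ae_discountMeasure_pos δ] with s hs
  exact add_nonneg (hU.nonneg (h.nonneg s hs.le)) (hG.nonneg _ (h.le_wealthBetween hs.le))

theorem AuxAdmissible.realReward_nonneg (hU : IsUtility U γ K₁) (hG : IsRunningReward G l)
    (h : AuxAdmissible l x c) : 0 ≤ realReward U G δ x c :=
  integral_nonneg_of_ae (h.ae_total_nonneg hU hG)

theorem AuxAdmissible.auxReward_eq (hδ : 0 < δ) (hU : IsUtility U γ K₁)
    (hG : IsRunningReward G l) (h : AuxAdmissible l x c) :
    auxReward U G δ x c = ENNReal.ofReal (realReward U G δ x c) := by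
  rw [realReward, ofReal_integral_eq_lintegral_ofReal (h.integrable_total hδ hU hG)
    (h.ae_total_nonneg hU hG), lintegral_discountMeasure, auxReward]
  simp_rw [ENNReal.ofReal_mul (Real.exp_pos _).le]

theorem AuxAdmissible.realReward_le (hδ : 0 < δ) (hU : IsUtility U γ K₁)
    (hG : IsRunningReward G l) (h : AuxAdmissible l x c) :
    realReward U G δ x c ≤
      (U 1 + G x) * (discountMeasure δ).real univ + deriv U 1 * (x - l) := by
  have := isFiniteMeasure_discountMeasure hδ
  have hd := hU.deriv_pos one_pos
  have h1 : realReward U G δ x c ≤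
      ∫ s, ((U 1 + G x) + deriv U 1 * c s) ∂(discountMeasure δ) := by
    refine integral_mono_ae (h.integrable_total hδ hU hG) ((integrable_const _).add
      ((h.integrable_discount hδ).const_mul _)) ?_
    filter_upwards [ae_discountMeasure_pos δ] with s hs
    have h1 := hU.le_tangent one_pos (h.nonneg s hs.le)
    have h2 := h.le_wealthBetween hs.le
    have h3 := h.wealthBetween_le hs.le
    have h4 := hG.monotoneOn h2 (h2.trans h3) h3
    linarith
  refine h1.trans ?_
  rw [integral_add (integrable_const _) ((h.integrable_discount hδ).const_mul _),
    integral_const_mul, integral_const, smul_eq_mul, mul_comm]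
  have := mul_le_mul_of_nonneg_left (h.integral_discount_le hδ) hd.le
  linarith

/-- Rewards of admissible controls are nonnegative and have finite integrals, so their comparison in
`ℝ≥0∞` amounts to a comparison of real integrals. -/
theorem isAuxOptimal_iff (hδ : 0 < δ) (hU : IsUtility U γ K₁) (hG : IsRunningReward G l) :
    IsAuxOptimal U G δ l x c ↔ AuxAdmissible l x c ∧
      ∀ c', AuxAdmissible l x c' → realReward U G δ x c' ≤ realReward U G δ x c := by
  refine and_congr_right fun h => ?_
  rw [h.auxReward_eq hδ hU hG]
  constructor
  · intro heq c' h'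
    have h1 : auxReward U G δ x c' ≤ auxValue U G δ l x :=
      le_iSup₂_of_le c' h' le_rfl
    rw [← heq, h'.auxReward_eq hδ hU hG] at h1
    exact (ENNReal.ofReal_le_ofReal_iff (h.realReward_nonneg hU hG)).1 h1
  · intro hle
    refine le_antisymm ?_ (iSup₂_le fun c' h' => ?_)
    · rw [← h.auxReward_eq hδ hU hG]
      exact le_iSup₂_of_le c h le_rfl
    · rw [h'.auxReward_eq hδ hU hG]
      exact ENNReal.ofReal_le_ofReal (hle c' h')

/-- Strict concavity gap of the utility. -/
noncomputable def utilityGap (U : ℝ → ℝ) (y z : ℝ) : ℝ := U ((y + z) / 2) - (U y + U z) / 2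

theorem IsUtility.utilityGap_nonneg (hU : IsUtility U γ K₁) {y z : ℝ} (hy : 0 ≤ y) (hz : 0 ≤ z) :
    0 ≤ utilityGap U y z := by
  have h := hU.strictConcave.concaveOn.2 hy hz (show (0 : ℝ) ≤ 1 / 2 by norm_num)
    (show (0 : ℝ) ≤ 1 / 2 by norm_num) (by norm_num)
  simp only [smul_eq_mul] at h
  have e : 1 / 2 * y + 1 / 2 * z = (y + z) / 2 := by ring
  rw [e] at h
  rw [utilityGap]
  linarith

theorem IsUtility.utilityGap_pos (hU : IsUtility U γ K₁) {y z : ℝ} (hy : 0 ≤ y) (hz : 0 ≤ z)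
    (hyz : y ≠ z) : 0 < utilityGap U y z := by
  have h := hU.strictConcave.2 hy hz hyz (show (0 : ℝ) < 1 / 2 by norm_num)
    (show (0 : ℝ) < 1 / 2 by norm_num) (by norm_num)
  simp only [smul_eq_mul] at h
  have e : 1 / 2 * y + 1 / 2 * z = (y + z) / 2 := by ring
  rw [e] at h
  rw [utilityGap]
  linarith

theorem AuxAdmissible.midpoint (h : AuxAdmissible l x c) (h' : AuxAdmissible l x c') :
    AuxAdmissible l x fun s => (c s + c' s) / 2 := by
  have h1 := h.combine h' (show (0 : ℝ) ≤ 1 / 2 by norm_num) (show (0 : ℝ) ≤ 1 / 2 by norm_num)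
    (by norm_num)
  have e : (fun s => (c s + c' s) / 2) = fun s => 1 / 2 * c s + 1 / 2 * c' s := by
    funext s
    ring
  rwa [e]

theorem AuxAdmissible.integrable_gap (hδ : 0 < δ) (hU : IsUtility U γ K₁)
    (h : AuxAdmissible l x c) (h' : AuxAdmissible l x c') :
    Integrable (fun s => utilityGap U (c s) (c' s)) (discountMeasure δ) :=
  ((h.midpoint h').integrable_utility hδ hU).sub
    (((h.integrable_utility hδ hU).add (h'.integrable_utility hδ hU)).div_const 2)

/-- The gain from passing to the midpoint is at least the concavity gap of `U`, because concavity of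
`G` can only add to it. For two nearly optimal controls this gain is small, which is how a
maximizing sequence acquires compactness. -/
theorem AuxAdmissible.integral_gap_le (hδ : 0 < δ) (hU : IsUtility U γ K₁)
    (hG : IsRunningReward G l) (h : AuxAdmissible l x c) (h' : AuxAdmissible l x c') :
    ∫ s, utilityGap U (c s) (c' s) ∂(discountMeasure δ) ≤
      realReward U G δ x (fun s => (c s + c' s) / 2) -
        (realReward U G δ x c + realReward U G δ x c') / 2 := by
  have i1 := h.integrable_total hδ hU hG
  have i2 := h'.integrable_total hδ hU hG
  have i3 := (h.midpoint h').integrable_total hδ hU hG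
  simp only [realReward]
  have i4 : Integrable (fun s => (U (c s) + G (wealthBetween x c s) +
      (U (c' s) + G (wealthBetween x c' s))) / 2) (discountMeasure δ) := (i1.add i2).div_const 2
  rw [← integral_add i1 i2, ← integral_div, ← integral_sub i3 i4]
  refine integral_mono_ae (h.integrable_gap hδ hU h') (i3.sub i4) ?_
  filter_upwards [ae_discountMeasure_pos δ] with s hs
  have e : (fun s => (c s + c' s) / 2) = fun s => 1 / 2 * c s + 1 / 2 * c' s := by
    funext s
    ring
  have h1 : wealthBetween x (fun s => (c s + c' s) / 2) s =
      1 / 2 * wealthBetween x c s + 1 / 2 * wealthBetween x c' s := by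
    rw [e]
    exact h.wealthBetween_combine h' (by norm_num) hs.le
  have h2 := hG.concaveOn.2 (h.le_wealthBetween hs.le) (h'.le_wealthBetween hs.le)
    (show (0 : ℝ) ≤ 1 / 2 by norm_num) (show (0 : ℝ) ≤ 1 / 2 by norm_num) (by norm_num)
  simp only [smul_eq_mul] at h2
  rw [← h1] at h2
  simp only [utilityGap]
  linarith

end Reward

/-! ### Existence of an optimal control -/

theorem exists_subseq_ae_tendsto_of_integral_cauchy {α : Type*} [MeasurableSpace α]
    {μ : Measure α} {X : ℕ → α → ℝ} (hX : ∀ n, Integrable (X n) μ)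
    (hc : ∀ ε > 0, ∃ N, ∀ n ≥ N, ∀ m ≥ N, ∫ s, |X n s - X m s| ∂μ ≤ ε) :
    ∃ ns : ℕ → ℕ, StrictMono ns ∧ ∃ f : α → ℝ,
      ∀ᵐ s ∂μ, Filter.Tendsto (fun k => X (ns k) s) Filter.atTop (nhds (f s)) := by
  have hcs : CauchySeq fun n => (hX n).toL1 (X n) := by
    refine Metric.cauchySeq_iff.2 fun ε hε => ?_
    obtain ⟨N, hN⟩ := hc (ε / 2) (by positivity)
    refine ⟨N, fun n hn m hm => ?_⟩
    have h1 : dist ((hX n).toL1 (X n)) ((hX m).toL1 (X m)) = ∫ s, |X n s - X m s| ∂μ := by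
      rw [dist_eq_norm, ← Integrable.toL1_sub, L1.norm_eq_integral_norm]
      refine integral_congr_ae ?_
      filter_upwards [Integrable.coeFn_toL1 ((hX n).sub (hX m))] with s hs
      rw [hs, Pi.sub_apply, Real.norm_eq_abs]
    rw [h1]
    linarith [hN n hn m hm]
  obtain ⟨F, hF⟩ := cauchySeq_tendsto_of_complete hcs
  obtain ⟨ns, hns, hae⟩ := (tendstoInMeasure_of_tendsto_Lp hF).exists_seq_tendsto_ae
  refine ⟨ns, hns, F, ?_⟩
  have h2 : ∀ᵐ s ∂μ, ∀ n, (hX n).toL1 (X n) s = X n s :=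
    ae_all_iff.2 fun n => Integrable.coeFn_toL1 (hX n)
  filter_upwards [hae, h2] with s hs h2s
  simpa only [h2s] using hs

theorem abs_squash_sub_le_one {y z : ℝ} (hy : 0 ≤ y) (hz : 0 ≤ z) :
    |y / (1 + y) - z / (1 + z)| ≤ 1 := by
  have h1 : y / (1 + y) ≤ 1 := (div_le_one (by linarith)).2 (by linarith)
  have h2 : z / (1 + z) ≤ 1 := (div_le_one (by linarith)).2 (by linarith)
  have h3 : 0 ≤ y / (1 + y) := by positivity
  have h4 : 0 ≤ z / (1 + z) := by positivity
  rw [abs_le]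
  constructor <;> linarith

/-- The map `y / (1 + y)` has distances at most 1, so if `y` or `z` exceeds `1 / η` the linear term
suffices. On the compact set of remaining pairs with squashed distance at least `η`, the gap is
continuous and positive, so it has a positive minimum `m`, and `K = 1 / m` works. -/
theorem IsUtility.exists_abs_squash_sub_le {U : ℝ → ℝ} {γ K₁ : ℝ} (hU : IsUtility U γ K₁)
    {η : ℝ} (hη : 0 < η) : ∃ K, 0 ≤ K ∧ ∀ y z, 0 ≤ y → 0 ≤ z →
      |y / (1 + y) - z / (1 + z)| ≤ η * (1 + y + z) + K * utilityGap U y z := by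
  set S : Set (ℝ × ℝ) := (Icc 0 (1 / η) ×ˢ Icc 0 (1 / η)) ∩
    {q | η ≤ |q.1 / (1 + q.1) - q.2 / (1 + q.2)|} with hS
  have hsq : ContinuousOn (fun q : ℝ × ℝ => |q.1 / (1 + q.1) - q.2 / (1 + q.2)|)
      (Icc 0 (1 / η) ×ˢ Icc 0 (1 / η)) := by
    refine ContinuousOn.abs (ContinuousOn.sub ?_ ?_)
    · refine ContinuousOn.div (by fun_prop) (by fun_prop) fun q hq => ?_
      have := hq.1.1
      positivity
    · refine ContinuousOn.div (by fun_prop) (by fun_prop) fun q hq => ?_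
      have := hq.2.1
      positivity
  have hcpt : IsCompact S := (isCompact_Icc.prod isCompact_Icc).of_isClosed_subset
    (hsq.preimage_isClosed_of_isClosed (isClosed_Icc.prod isClosed_Icc) isClosed_Ici)
    inter_subset_left
  have hgap : ContinuousOn (fun q : ℝ × ℝ => utilityGap U q.1 q.2) S := by
    have hc := hU.continuousOn
    refine ContinuousOn.sub (hc.comp (by fun_prop) fun q hq => ?_)
      (((hc.comp (by fun_prop) fun q hq => ?_).add
        (hc.comp (by fun_prop) fun q hq => ?_)).div_const 2)
    · have h1 := hq.1.1.1
      have h2 := hq.1.2.1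
      exact mem_Ici.2 (by positivity)
    · exact hq.1.1.1
    · exact hq.1.2.1
  have hpos : ∀ q ∈ S, 0 < utilityGap U q.1 q.2 := by
    intro q hq
    refine hU.utilityGap_pos hq.1.1.1 hq.1.2.1 fun h => ?_
    have := hq.2
    simp only [h, sub_self, abs_zero, mem_ofPred_eq] at this
    linarith
  obtain ⟨m, hm, hmS⟩ : ∃ m > 0, ∀ q ∈ S, m ≤ utilityGap U q.1 q.2 := by
    rcases S.eq_empty_or_nonempty with he | hne
    · exact ⟨1, one_pos, by simp [he]⟩
    · obtain ⟨q, hq, hmin⟩ := hcpt.exists_isMinOn hne hgap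
      exact ⟨_, hpos q hq, fun r hr => hmin hr⟩
  refine ⟨1 / m, by positivity, fun y z hy hz => ?_⟩
  have h1 := abs_squash_sub_le_one hy hz
  have hg : 0 ≤ 1 / m * utilityGap U y z :=
    mul_nonneg (by positivity) (hU.utilityGap_nonneg hy hz)
  have e : η * (1 / η) = 1 := by field_simp
  by_cases hy1 : 1 / η < y
  · have := mul_le_mul_of_nonneg_left hy1.le hη.le
    nlinarith [mul_nonneg hη.le hz]
  by_cases hz1 : 1 / η < z
  · have := mul_le_mul_of_nonneg_left hz1.le hη.le
    nlinarith [mul_nonneg hη.le hy]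
  push Not at hy1 hz1
  by_cases hd : η ≤ |y / (1 + y) - z / (1 + z)|
  · have h2 := hmS (y, z) ⟨⟨⟨hy, hy1⟩, hz, hz1⟩, hd⟩
    have h3 : 1 ≤ 1 / m * utilityGap U y z := by
      rw [div_mul_eq_mul_div, one_mul, le_div_iff₀ hm]
      simpa using h2
    have : 0 ≤ η * (1 + y + z) := by positivity
    linarith
  · push Not at hd
    nlinarith [mul_nonneg hη.le hy, mul_nonneg hη.le hz]

section Existence

variable {U G : ℝ → ℝ} {γ K₁ δ l x : ℝ} {c : ℕ → ℝ → ℝ}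

theorem integral_abs_squash_sub_le (hδ : 0 < δ) (hU : IsUtility U γ K₁) {y z : ℝ → ℝ}
    (hy : AuxAdmissible l x y) (hz : AuxAdmissible l x z) {η K : ℝ} (hη : 0 < η)
    (hK : ∀ y z, 0 ≤ y → 0 ≤ z →
      |y / (1 + y) - z / (1 + z)| ≤ η * (1 + y + z) + K * utilityGap U y z) :
    ∫ s, |y s / (1 + y s) - z s / (1 + z s)| ∂(discountMeasure δ) ≤
      η * ((discountMeasure δ).real univ + 2 * (x - l)) +
        K * ∫ s, utilityGap U (y s) (z s) ∂(discountMeasure δ) := by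
  have := isFiniteMeasure_discountMeasure hδ
  have iy := hy.integrable_discount hδ
  have iz := hz.integrable_discount hδ
  have ig := (hy.integrable_gap hδ hU hz).const_mul K
  have i1 : Integrable (fun s => 1 + y s + z s) (discountMeasure δ) :=
    ((integrable_const 1).add iy).add iz
  have h1 : ∫ s, |y s / (1 + y s) - z s / (1 + z s)| ∂(discountMeasure δ) ≤
      ∫ s, (η * (1 + y s + z s) + K * utilityGap U (y s) (z s)) ∂(discountMeasure δ) := by
    refine integral_mono_of_nonneg (Filter.Eventually.of_forall fun s => abs_nonneg _)
      ((i1.const_mul η).add ig) ?_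
    filter_upwards [ae_discountMeasure_pos δ] with s hs
    exact hK _ _ (hy.nonneg s hs.le) (hz.nonneg s hs.le)
  have i2 : Integrable (fun s => 1 + y s) (discountMeasure δ) := (integrable_const 1).add iy
  rw [integral_add (i1.const_mul η) ig, integral_const_mul, integral_const_mul,
    integral_add i2 iz, integral_add (integrable_const 1) iy, integral_const, smul_eq_mul,
    mul_one] at h1
  refine h1.trans (add_le_add (mul_le_mul_of_nonneg_left ?_ hη.le) le_rfl)
  have := hy.integral_discount_le hδ
  have := hz.integral_discount_le hδ
  linarith

/-- Controls whose mutual concavity gaps vanish converge almost everywhere along a subsequence. -/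
theorem exists_subseq_tendsto (hδ : 0 < δ) (hU : IsUtility U γ K₁)
    (hc : ∀ n, AuxAdmissible l x (c n))
    (hgap : ∀ ε > 0, ∃ N, ∀ n ≥ N, ∀ m ≥ N,
      ∫ s, utilityGap U (c n s) (c m s) ∂(discountMeasure δ) ≤ ε) :
    ∃ ns : ℕ → ℕ, StrictMono ns ∧ ∃ f : ℝ → ℝ, Measurable f ∧ (∀ s, 0 ≤ f s) ∧
      ∀ᵐ s ∂(discountMeasure δ),
        Filter.Tendsto (fun k => c (ns k) s) Filter.atTop (nhds (f s)) := by
  have := isFiniteMeasure_discountMeasure hδ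
  have hxl : l ≤ x := (hc 0).initial_le
  set μ := discountMeasure δ with hμ
  set A := μ.real univ + 2 * (x - l) with hA
  have hA0 : 0 ≤ A := by
    have : 0 ≤ μ.real univ := measureReal_nonneg
    linarith
  have hX : ∀ n, Integrable (fun s => c n s / (1 + c n s)) μ := by
    intro n
    refine Integrable.mono' (integrable_const 1)
      ((hc n).measurable.div (measurable_const.add (hc n).measurable)).aestronglyMeasurable ?_
    filter_upwards [ae_discountMeasure_pos δ] with s hs
    have h0 := (hc n).nonneg s hs.le
    rw [Real.norm_of_nonneg (by positivity)]
    exact (div_le_one (by linarith)).2 (by linarith)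
  -- The budget bounds the integral of the linear term by `η A`; this `η` and the gap tolerance each
  -- contribute at most `ε / 2` to the `L¹` distance of the squashed controls.
  obtain ⟨ns, hns, ψ, hψ⟩ := exists_subseq_ae_tendsto_of_integral_cauchy hX fun ε hε => by
    obtain ⟨K, hK0, hK⟩ := hU.exists_abs_squash_sub_le (η := ε / (2 * (A + 1))) (by positivity)
    obtain ⟨N, hN⟩ := hgap (ε / (2 * (K + 1))) (by positivity)
    refine ⟨N, fun n hn m hm => ?_⟩
    refine (integral_abs_squash_sub_le hδ hU (hc n) (hc m) (by positivity) hK).trans ?_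
    have h1 : ε / (2 * (A + 1)) * A ≤ ε / 2 := by
      rw [div_mul_eq_mul_div, div_le_div_iff₀ (by positivity) (by positivity)]
      nlinarith
    have h2 : K * (ε / (2 * (K + 1))) ≤ ε / 2 := by
      rw [mul_div_assoc', div_le_div_iff₀ (by positivity) (by positivity)]
      nlinarith
    have h3 := mul_le_mul_of_nonneg_left (hN n hn m hm) hK0
    linarith
  have hpos : ∀ᵐ s ∂μ, 0 < s := ae_discountMeasure_pos δ
  -- By Fatou and the budget the lower limit is finite almost everywhere. This excludes the limit 1
  -- of the squashed controls, so the squashing can be inverted in the limit.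
  have hfin : ∀ᵐ s ∂μ, Filter.liminf (fun k => ENNReal.ofReal (c (ns k) s)) Filter.atTop < ⊤ := by
    refine ae_lt_top (Measurable.liminf fun k => (hc (ns k)).measurable.ennreal_ofReal) ?_
    refine ne_top_of_le_ne_top (b := ENNReal.ofReal (x - l)) ENNReal.ofReal_ne_top ?_
    refine (lintegral_liminf_le fun k => (hc (ns k)).measurable.ennreal_ofReal).trans ?_
    refine Filter.liminf_le_of_frequently_le' (Filter.Frequently.of_forall fun k => ?_)
    rw [← ofReal_integral_eq_lintegral_ofReal ((hc (ns k)).integrable_discount hδ)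
      (by filter_upwards [hpos] with s hs using (hc (ns k)).nonneg s hs.le)]
    exact ENNReal.ofReal_le_ofReal ((hc (ns k)).integral_discount_le hδ)
  have hlim : ∀ᵐ s ∂μ, ∃ r, Filter.Tendsto (fun k => c (ns k) s) Filter.atTop (nhds r) := by
    filter_upwards [hψ, hfin, hpos] with s h1 h2 h3
    obtain ⟨C, hC1, hC2⟩ := exists_between h2
    have hfr : ∃ᶠ k in Filter.atTop, c (ns k) s ≤ C.toReal := by
      refine (Filter.frequently_lt_of_liminf_lt (by isBoundedDefault) hC1).mono fun k hk => ?_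
      exact (ENNReal.ofReal_le_iff_le_toReal hC2.ne).1 hk.le
    have hψ1 : ψ s ≤ C.toReal / (1 + C.toReal) := by
      refine le_of_tendsto_of_frequently h1 (hfr.mono fun k hk => ?_)
      have h0 := (hc (ns k)).nonneg s h3.le
      rw [div_le_div_iff₀ (by linarith) (by positivity)]
      linarith
    have hψ2 : ψ s < 1 := hψ1.trans_lt ((div_lt_one (by positivity)).2 (by linarith))
    refine ⟨ψ s / (1 - ψ s), ?_⟩
    refine (h1.div (tendsto_const_nhds.sub h1) (by linarith)).congr fun k => ?_
    have h0 := (hc (ns k)).nonneg s h3.le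
    have h4 : 1 + c (ns k) s ≠ 0 := by positivity
    have h5 : 1 - c (ns k) s / (1 + c (ns k) s) = 1 / (1 + c (ns k) s) := by
      field_simp
      ring
    simp only [Pi.div_apply]
    rw [h5]
    field_simp
  obtain ⟨f, hfm, hf⟩ := measurable_limit_of_tendsto_metrizable_ae
    (fun k => (hc (ns k)).measurable.aemeasurable) hlim
  refine ⟨ns, hns, fun s => max (f s) 0, hfm.max measurable_const, fun s => le_max_right _ _, ?_⟩
  filter_upwards [hf, hpos] with s h1 h2
  refine (h1.max tendsto_const_nhds).congr fun k => max_eq_left ((hc (ns k)).nonneg s h2.le)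

section Limit

variable {f : ℝ → ℝ}

theorem AuxAdmissible.lintegral_Ioc {y : ℝ → ℝ} (hy : AuxAdmissible l x y) {t : ℝ} (ht : 0 ≤ t) :
    ∫⁻ s in Ioc 0 t, ENNReal.ofReal (y s) = ENNReal.ofReal (∫ s in (0 : ℝ)..t, y s) := by
  rw [intervalIntegral.integral_of_le ht, ofReal_integral_eq_lintegral_ofReal
    ((intervalIntegrable_iff_integrableOn_Ioc_of_le ht).1 (hy.integrable t ht))]
  filter_upwards [ae_restrict_mem measurableSet_Ioc] with s hs using hy.nonneg s hs.1.le

/-- Fatou's lemma for the cumulated consumption. -/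
theorem intervalIntegral_limit_le (hc : ∀ n, AuxAdmissible l x (c n)) (hfm : Measurable f)
    (hf0 : ∀ s, 0 ≤ f s)
    (hf : ∀ᵐ s ∂(discountMeasure δ),
      Filter.Tendsto (fun k => c k s) Filter.atTop (nhds (f s)))
    {t b : ℝ} (ht : 0 ≤ t) (hb : ∃ᶠ k in Filter.atTop, ∫ s in (0 : ℝ)..t, c k s ≤ b) :
    IntervalIntegrable f volume 0 t ∧ ∫ s in (0 : ℝ)..t, f s ≤ b := by
  have hf' : ∀ᵐ s ∂(volume.restrict (Ioc 0 t)),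
      Filter.Tendsto (fun k => c k s) Filter.atTop (nhds (f s)) :=
    ae_mono (Measure.restrict_mono Ioc_subset_Ioi_self le_rfl) (ae_discountMeasure_iff.1 hf)
  have hb0 : 0 ≤ b := by
    obtain ⟨k, hk⟩ := hb.exists
    exact (intervalIntegral.integral_nonneg ht fun s hs => (hc k).nonneg s hs.1).trans hk
  have h1 : ∫⁻ s in Ioc 0 t, ENNReal.ofReal (f s) ≤ ENNReal.ofReal b := by
    calc ∫⁻ s in Ioc 0 t, ENNReal.ofReal (f s)
        = ∫⁻ s in Ioc 0 t, Filter.liminf (fun k => ENNReal.ofReal (c k s)) Filter.atTop := by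
          refine lintegral_congr_ae ?_
          filter_upwards [hf'] with s hs
          exact (ENNReal.tendsto_ofReal hs).liminf_eq.symm
      _ ≤ Filter.liminf (fun k => ∫⁻ s in Ioc 0 t, ENNReal.ofReal (c k s)) Filter.atTop :=
          lintegral_liminf_le fun k => (hc k).measurable.ennreal_ofReal
      _ ≤ ENNReal.ofReal b := by
          refine Filter.liminf_le_of_frequently_le' (hb.mono fun k hk => ?_)
          rw [(hc k).lintegral_Ioc ht]
          exact ENNReal.ofReal_le_ofReal hk
  have h2 : IntegrableOn f (Ioc 0 t) := by
    refine ⟨hfm.aestronglyMeasurable, ?_⟩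
    rw [hasFiniteIntegral_iff_ofReal (Filter.Eventually.of_forall hf0)]
    exact h1.trans_lt ENNReal.ofReal_lt_top
  refine ⟨(intervalIntegrable_iff_integrableOn_Ioc_of_le ht).2 h2, ?_⟩
  rw [← ofReal_integral_eq_lintegral_ofReal h2 (Filter.Eventually.of_forall hf0),
    ENNReal.ofReal_le_ofReal_iff hb0] at h1
  rwa [intervalIntegral.integral_of_le ht]

theorem auxAdmissible_limit (hc : ∀ n, AuxAdmissible l x (c n)) (hfm : Measurable f)
    (hf0 : ∀ s, 0 ≤ f s)
    (hf : ∀ᵐ s ∂(discountMeasure δ),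
      Filter.Tendsto (fun k => c k s) Filter.atTop (nhds (f s))) : AuxAdmissible l x f where
  measurable := hfm
  nonneg s _ := hf0 s
  integrable t ht := (intervalIntegral_limit_le hc hfm hf0 hf ht
    (Filter.Frequently.of_forall fun k => (hc k).budget t ht)).1
  budget t ht := (intervalIntegral_limit_le hc hfm hf0 hf ht
    (Filter.Frequently.of_forall fun k => (hc k).budget t ht)).2

/-- Fatou is one-sided: consumption can be lost in the limit but not created, so the limit wealth is
asymptotically at least that of the approximations. Monotonicity and continuity of `G` turn this
into upper semicontinuity. -/
theorem eventually_reward_le (hG : IsRunningReward G l) (hc : ∀ n, AuxAdmissible l x (c n))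
    (hfm : Measurable f) (hf0 : ∀ s, 0 ≤ f s)
    (hf : ∀ᵐ s ∂(discountMeasure δ),
      Filter.Tendsto (fun k => c k s) Filter.atTop (nhds (f s)))
    {t ε : ℝ} (ht : 0 ≤ t) (hε : 0 < ε) :
    ∀ᶠ k in Filter.atTop, G (wealthBetween x (c k) t) ≤ G (wealthBetween x f t) + ε := by
  have hfa := auxAdmissible_limit hc hfm hf0 hf
  have hl := hfa.le_wealthBetween ht
  obtain ⟨d, hd, hd2⟩ := Metric.continuousWithinAt_iff.1 (hG.continuousOn _ hl) ε hε
  have hev : ∀ᶠ k in Filter.atTop,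
      ¬ (∫ s in (0 : ℝ)..t, c k s ≤ (∫ s in (0 : ℝ)..t, f s) - d / 2) := by
    rw [← Filter.not_frequently]
    intro hfr
    linarith [(intervalIntegral_limit_le hc hfm hf0 hf ht hfr).2]
  filter_upwards [hev] with k hk
  have h1 : wealthBetween x (c k) t ≤ wealthBetween x f t + d / 2 := by
    simp only [wealthBetween]
    linarith
  have h2 : l ≤ wealthBetween x f t + d / 2 := by linarith
  have h3 := hG.monotoneOn ((hc k).le_wealthBetween ht) h2 h1
  have h4 := hd2 (mem_Ici.2 h2) (by
    rw [Real.dist_eq, add_sub_cancel_left, abs_of_pos (by positivity)]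
    linarith)
  rw [Real.dist_eq] at h4
  linarith [le_abs_self (G (wealthBetween x f t + d / 2) - G (wealthBetween x f t))]

/-- Upper semicontinuity of the reward, up to the consumption that may escape to infinity. -/
theorem le_realReward_limit_add (hδ : 0 < δ) (hU : IsUtility U γ K₁) (hG : IsRunningReward G l)
    (hc : ∀ n, AuxAdmissible l x (c n)) (hfm : Measurable f) (hf0 : ∀ s, 0 ≤ f s)
    (hf : ∀ᵐ s ∂(discountMeasure δ),
      Filter.Tendsto (fun k => c k s) Filter.atTop (nhds (f s)))
    {S : ℝ} (hS : Filter.Tendsto (fun k => realReward U G δ x (c k)) Filter.atTop (nhds S))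
    {m : ℝ} (hm : 0 < m) : S ≤ realReward U G δ x f + deriv U m * (x - l) := by
  have := isFiniteMeasure_discountMeasure hδ
  have hfa := auxAdmissible_limit hc hfm hf0 hf
  have hd := hU.deriv_pos hm
  set μ := discountMeasure δ with hμ
  -- The tangent of `U` at `m` and monotonicity of `G` make `B` nonnegative, so Fatou applies to it.
  -- The price is the linear term, at most `deriv U m * (x - l)`.
  set B : (ℝ → ℝ) → ℝ → ℝ := fun y s =>
    U m + G x + deriv U m * y s - (U (y s) + G (wealthBetween x y s)) with hB
  have hint : ∀ y, AuxAdmissible l x y → Integrable (B y) μ := fun y hy =>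
    ((integrable_const _).add ((hy.integrable_discount hδ).const_mul _)).sub
      (hy.integrable_total hδ hU hG)
  have heq : ∀ y, AuxAdmissible l x y → ∫ s, B y s ∂μ =
      (U m + G x) * μ.real univ + deriv U m * ∫ s, y s ∂μ - realReward U G δ x y := by
    intro y hy
    have i1 : Integrable (fun s => U m + G x + deriv U m * y s) μ :=
      (integrable_const _).add ((hy.integrable_discount hδ).const_mul _)
    rw [hB]
    simp only
    rw [integral_sub i1 (hy.integrable_total hδ hU hG), integral_add (integrable_const _)
      ((hy.integrable_discount hδ).const_mul _), integral_const, integral_const_mul, smul_eq_mul,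
      mul_comm (μ.real univ), realReward]
  have hnn : ∀ y, AuxAdmissible l x y → ∀ᵐ s ∂μ, 0 ≤ B y s := by
    intro y hy
    filter_upwards [ae_discountMeasure_pos δ] with s hs
    have h1 := hU.le_tangent hm (hy.nonneg s hs.le)
    have h2 := hy.le_wealthBetween hs.le
    have h3 := hy.wealthBetween_le hs.le
    have h4 := hG.monotoneOn h2 (h2.trans h3) h3
    have h5 : 0 ≤ deriv U m * m := by positivity
    simp only [hB]
    nlinarith
  set R := (U m + G x) * μ.real univ + deriv U m * (x - l) with hR
  have h1 : ∫⁻ s, ENNReal.ofReal (B f s) ∂μ ≤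
      Filter.liminf (fun k => ∫⁻ s, ENNReal.ofReal (B (c k) s) ∂μ) Filter.atTop := by
    refine le_trans (lintegral_mono_ae ?_) (lintegral_liminf_le' fun k =>
      (hint _ (hc k)).aestronglyMeasurable.aemeasurable.ennreal_ofReal)
    filter_upwards [hf, ae_discountMeasure_pos δ] with s h1 h2
    refine le_of_forall_lt_imp_le_of_dense fun r hr => ?_
    have hr1 : r ≠ ⊤ := (hr.trans ENNReal.ofReal_lt_top).ne
    have hr2 : r.toReal < B f s := (ENNReal.lt_ofReal_iff_toReal_lt hr1).1 hr
    refine Filter.le_liminf_of_le (by isBoundedDefault) ?_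
    have hG1 := eventually_reward_le hG hc hfm hf0 hf h2.le
      (show 0 < (B f s - r.toReal) / 2 by linarith)
    have hcont : ContinuousWithinAt U (Ici 0) (f s) := hU.continuousOn _ (hf0 s)
    have hU1 : Filter.Tendsto (fun k => U (c k s)) Filter.atTop (nhds (U (f s))) :=
      hcont.tendsto.comp (tendsto_nhdsWithin_iff.2
        ⟨h1, Filter.Eventually.of_forall fun k => (hc k).nonneg s h2.le⟩)
    have hU2 := ((h1.const_mul (deriv U m)).sub hU1).eventually
      (lt_mem_nhds (show deriv U m * f s - U (f s) - (B f s - r.toReal) / 2 <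
        deriv U m * f s - U (f s) by linarith))
    filter_upwards [hG1, hU2] with k h3 h4
    rw [← ENNReal.ofReal_toReal hr1]
    refine ENNReal.ofReal_le_ofReal ?_
    simp only [hB] at h3 h4 ⊢
    linarith
  have h2 : Filter.liminf (fun k => ∫⁻ s, ENNReal.ofReal (B (c k) s) ∂μ) Filter.atTop ≤
      ENNReal.ofReal (R - S) := by
    rw [← (ENNReal.tendsto_ofReal (hS.const_sub R)).liminf_eq]
    refine Filter.liminf_le_liminf (Filter.Eventually.of_forall fun k => ?_)
    rw [← ofReal_integral_eq_lintegral_ofReal (hint _ (hc k)) (hnn _ (hc k)), heq _ (hc k)]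
    refine ENNReal.ofReal_le_ofReal ?_
    have := mul_le_mul_of_nonneg_left ((hc k).integral_discount_le hδ) hd.le
    linarith
  have hRS : 0 ≤ R - S := by
    refine ge_of_tendsto' (hS.const_sub R) fun k => ?_
    have h3 := integral_nonneg_of_ae (hnn _ (hc k))
    rw [heq _ (hc k)] at h3
    have := mul_le_mul_of_nonneg_left ((hc k).integral_discount_le hδ) hd.le
    linarith
  have h3 := h1.trans h2
  rw [← ofReal_integral_eq_lintegral_ofReal (hint _ hfa) (hnn _ hfa), heq _ hfa,
    ENNReal.ofReal_le_ofReal_iff hRS] at h3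
  have h4 : 0 ≤ deriv U m * ∫ s, f s ∂μ :=
    mul_nonneg hd.le (integral_nonneg fun s => hf0 s)
  linarith

end Limit

/-- The auxiliary problem has an optimal control. -/
theorem exists_isAuxOptimal (hδ : 0 < δ) (hU : IsUtility U γ K₁) (hG : IsRunningReward G l)
    (hx : l ≤ x) : ∃ c, IsAuxOptimal U G δ l x c := by
  set J : Set ℝ := {r | ∃ y, AuxAdmissible l x y ∧ realReward U G δ x y = r} with hJ
  have hne : J.Nonempty := ⟨_, _, auxAdmissible_zero hx, rfl⟩
  have hbdd : BddAbove J := by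
    refine ⟨(U 1 + G x) * (discountMeasure δ).real univ + deriv U 1 * (x - l), ?_⟩
    rintro r ⟨y, hy, rfl⟩
    exact hy.realReward_le hδ hU hG
  have hle : ∀ y, AuxAdmissible l x y → realReward U G δ x y ≤ sSup J := fun y hy =>
    le_csSup hbdd ⟨y, hy, rfl⟩
  have hex : ∀ n : ℕ, ∃ y, AuxAdmissible l x y ∧
      sSup J - 1 / ((n : ℝ) + 1) < realReward U G δ x y := by
    intro n
    obtain ⟨r, ⟨y, hy, rfl⟩, hr⟩ := exists_lt_of_lt_csSup hne
      (show sSup J - 1 / ((n : ℝ) + 1) < sSup J by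
        have : 0 < 1 / ((n : ℝ) + 1) := by positivity
        linarith)
    exact ⟨y, hy, hr⟩
  choose c hc hcS using hex
  have hS : Filter.Tendsto (fun n => realReward U G δ x (c n)) Filter.atTop (nhds (sSup J)) := by
    refine tendsto_of_tendsto_of_tendsto_of_le_of_le ?_ tendsto_const_nhds
      (fun n => (hcS n).le) fun n => hle _ (hc n)
    simpa using tendsto_one_div_add_atTop_nhds_zero_nat.const_sub (sSup J)
  obtain ⟨ns, hns, f, hfm, hf0, hf⟩ := exists_subseq_tendsto hδ hU hc fun ε hε => by
    obtain ⟨N, hN⟩ := exists_nat_one_div_lt hε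
    refine ⟨N, fun n hn m hm => ?_⟩
    have h1 := (hc n).integral_gap_le hδ hU hG (hc m)
    have h2 := hle _ ((hc n).midpoint (hc m))
    have h3 : 1 / ((n : ℝ) + 1) ≤ 1 / ((N : ℝ) + 1) := by gcongr
    have h4 : 1 / ((m : ℝ) + 1) ≤ 1 / ((N : ℝ) + 1) := by gcongr
    linarith [hcS n, hcS m]
  refine ⟨f, (isAuxOptimal_iff hδ hU hG).2
    ⟨auxAdmissible_limit (fun k => hc (ns k)) hfm hf0 hf, fun y hy => (hle y hy).trans ?_⟩⟩
  -- As `m → ∞`, the Inada condition at infinity removes the loss term.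
  refine ge_of_tendsto (f := fun m => realReward U G δ x f + deriv U m * (x - l))
    (x := Filter.atTop) ?_ ?_
  · simpa using (hU.inada_top.mul_const (x - l)).const_add (realReward U G δ x f)
  · filter_upwards [Filter.eventually_gt_atTop 0] with m hm
    exact le_realReward_limit_add hδ hU hG (fun k => hc (ns k)) hfm hf0 hf
      (hS.comp hns.tendsto_atTop) hm

end Existence

/-! ### Marginal running reward and strict positivity of optimal consumption -/

namespace IsRunningReward

variable {G : ℝ → ℝ} {l : ℝ}

theorem le_tangent (hG : IsRunningReward G l) {y z : ℝ} (hy : l < y) (hz : l ≤ z) :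
    G z ≤ G y + deriv G y * (z - y) :=
  hG.concaveOn.le_tangent hy.le hz (hG.differentiableAt y hy).hasDerivAt

theorem antitoneOn_deriv (hG : IsRunningReward G l) : AntitoneOn (deriv G) (Ioi l) :=
  (hG.concaveOn.subset Ioi_subset_Ici_self (convex_Ioi l)).antitoneOn_deriv
    fun y hy => hG.differentiableAt y hy

theorem deriv_nonneg (hG : IsRunningReward G l) {y : ℝ} (hy : l < y) : 0 ≤ deriv G y := by
  have h1 := hG.le_tangent hy (show l ≤ y + 1 by linarith)
  have h2 := hG.monotoneOn (mem_Ici.2 hy.le) (mem_Ici.2 (show l ≤ y + 1 by linarith))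
    (by linarith)
  linarith

/-- A secant slope from `y` to a fixed nearby `u` approximates the derivative at `y` and varies
continuously when `y` is moved to `z`. The tangent inequality compares it with the derivative at
`z`, on either side. -/
theorem continuousOn_deriv (hG : IsRunningReward G l) : ContinuousOn (deriv G) (Ioi l) := by
  intro y hy
  have hy' : l < y := hy
  refine ContinuousAt.continuousWithinAt ?_
  have hs := hasDerivAt_iff_tendsto_slope.1 (hG.differentiableAt y hy').hasDerivAt
  have hcont : ∀ u, u ≠ y → ContinuousAt (fun z => (G u - G z) / (u - z)) y := fun u hu =>
    (continuousAt_const.sub (hG.differentiableAt y hy').continuousAt).div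
      (continuousAt_const.sub continuousAt_id) (sub_ne_zero.2 hu)
  have hz : ∀ᶠ z in nhds y, l < z := lt_mem_nhds hy'
  refine tendsto_order.2 ⟨fun r hr => ?_, fun r hr => ?_⟩
  · have h1 := (hs.mono_left (nhdsWithin_mono y fun z (hz : z ∈ Ioi y) => ne_of_gt hz)).eventually
      (lt_mem_nhds hr)
    obtain ⟨u, hu, hyu⟩ := (h1.and self_mem_nhdsWithin).exists
    have hyu' : y < u := hyu
    rw [slope_def_field] at hu
    filter_upwards [hz, gt_mem_nhds hyu', (hcont u hyu'.ne').eventually (lt_mem_nhds hu)]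
      with z h2 h3 h4
    have h5 := hG.le_tangent h2 (show l ≤ u by linarith)
    refine h4.trans_le ?_
    rw [div_le_iff₀ (by linarith)]
    linarith
  · have h1 := (hs.mono_left (nhdsWithin_mono y fun z (hz : z ∈ Iio y) => ne_of_lt hz)).eventually
      (gt_mem_nhds hr)
    obtain ⟨u, ⟨hu, huy⟩, hlu⟩ := ((h1.and self_mem_nhdsWithin).and
      (nhdsWithin_le_nhds hz)).exists
    have huy' : u < y := huy
    rw [slope_comm, slope_def_field, ← neg_div_neg_eq, neg_sub, neg_sub] at hu
    filter_upwards [hz, lt_mem_nhds huy', (hcont u huy'.ne).eventually (gt_mem_nhds hu)]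
      with z h2 h3 h4
    have h5 := hG.le_tangent h2 hlu.le
    refine lt_of_le_of_lt ?_ h4
    rw [← neg_div_neg_eq, neg_sub, neg_sub, le_div_iff₀ (by linarith)]
    linarith

end IsRunningReward

section Positivity

variable {U G : ℝ → ℝ} {γ K₁ δ l x : ℝ} {c : ℝ → ℝ}

/-- The competitor in the positivity argument: when `l < x` it consumes at every time, at a rate of
at most `x - l` for nonnegative times. -/
theorem auxAdmissible_exp (hx : l ≤ x) : AuxAdmissible l x fun s => (x - l) * Real.exp (-s) where
  measurable := by fun_prop
  nonneg s _ := mul_nonneg (by linarith) (Real.exp_pos _).le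
  integrable t _ := Continuous.intervalIntegrable (by fun_prop) _ _
  budget t ht := by
    have h1 : ∫ u in (0 : ℝ)..t, (x - l) * Real.exp (-u) = (x - l) * (1 - Real.exp (-t)) := by
      rw [intervalIntegral.integral_const_mul, intervalIntegral.integral_comp_neg, integral_exp]
      simp
    rw [h1]
    have := Real.exp_pos (-t)
    nlinarith

/-- An optimal control consumes at almost every time, by the Inada condition at zero. -/
theorem ae_pos_of_isMax (hδ : 0 < δ) (hU : IsUtility U γ K₁) (hG : IsRunningReward G l)
    (hx : l < x) (hc : AuxAdmissible l x c)
    (hmax : ∀ c', AuxAdmissible l x c' → realReward U G δ x c' ≤ realReward U G δ x c) :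
    ∀ᵐ s ∂(discountMeasure δ), 0 < c s := by
  set μ := discountMeasure δ with hμ
  set e : ℝ → ℝ := fun s => (x - l) * Real.exp (-s) with he
  have hea : AuxAdmissible l x e := auxAdmissible_exp hx.le
  set N : Set ℝ := {s | c s ≤ 0} with hN
  have hNm : MeasurableSet N := measurableSet_le hc.measurable measurable_const
  have hie := (hea.integrable_discount hδ).indicator hNm
  have hxl : 0 < x - l := by linarith
  have he_pos : ∀ s, 0 < e s := fun s => mul_pos hxl (Real.exp_pos _)
  have hind : ∀ s, 0 ≤ N.indicator e s := fun s => indicator_nonneg (fun s _ => (he_pos s).le) s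
  -- Mixing in a fraction `ε` of the competitor costs at most `ε` times the current reward. Where
  -- `c` vanishes it gains at least `ε e(s) U'(ε (x - l))`; the common factor `ε` then cancels.
  have key : ∀ ε, 0 < ε → ε < 1 →
      deriv U (ε * (x - l)) * ∫ s, N.indicator e s ∂μ ≤ realReward U G δ x c := by
    intro ε h0 h1
    have hadm := hc.combine hea (show 0 ≤ 1 - ε by linarith) h0.le (by ring)
    have hpt : ∀ᵐ s ∂μ, (1 - ε) * (U (c s) + G (wealthBetween x c s)) +
        ε * deriv U (ε * (x - l)) * N.indicator e s ≤
        U ((1 - ε) * c s + ε * e s) +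
          G (wealthBetween x (fun u => (1 - ε) * c u + ε * e u) s) := by
      filter_upwards [ae_discountMeasure_pos δ] with s hs
      have hl := hc.le_wealthBetween hs.le
      have hle := hea.le_wealthBetween hs.le
      have hcs := hc.nonneg s hs.le
      rw [hc.wealthBetween_combine hea (by ring) hs.le]
      have g1 := hG.concaveOn.2 hl hle (show 0 ≤ 1 - ε by linarith) h0.le (by ring)
      simp only [smul_eq_mul] at g1
      have g2 := mul_nonneg h0.le (hG.nonneg _ hle)
      by_cases hsN : s ∈ N
      · have hc0 : c s = 0 := le_antisymm hsN hcs
        have hεe : 0 < ε * e s := mul_pos h0 (he_pos s)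
        have g3 := hU.le_tangent hεe le_rfl
        rw [hU.zero] at g3
        have hes : e s ≤ x - l := by
          have : Real.exp (-s) ≤ 1 := Real.exp_le_one_iff.2 (by linarith)
          simp only [he]
          nlinarith
        have g4 : deriv U (ε * (x - l)) ≤ deriv U (ε * e s) :=
          hU.strictAntiOn_deriv.antitoneOn hεe (mul_pos h0 hxl)
            (mul_le_mul_of_nonneg_left hes h0.le)
        have g5 := mul_le_mul_of_nonneg_right g4 hεe.le
        rw [indicator_of_mem hsN]
        simp only [hc0, hU.zero, mul_zero, zero_add]
        nlinarith
      · have g3 := hU.strictConcave.concaveOn.2 hcs (he_pos s).le (show 0 ≤ 1 - ε by linarith)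
          h0.le (by ring)
        simp only [smul_eq_mul] at g3
        have g4 := mul_nonneg h0.le (hU.nonneg (he_pos s).le)
        rw [indicator_of_notMem hsN]
        nlinarith
    have i1 := (hc.integrable_total hδ hU hG).const_mul (1 - ε)
    have i2 := hie.const_mul (ε * deriv U (ε * (x - l)))
    have h2 := integral_mono_ae (i1.add i2) (hadm.integrable_total hδ hU hG) hpt
    have h3 := h2.trans (hmax _ hadm)
    simp only [Pi.add_apply] at h3
    rw [integral_add i1 i2, integral_const_mul, integral_const_mul] at h3
    change (1 - ε) * realReward U G δ x c + _ ≤ _ at h3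
    refine le_of_mul_le_mul_left ?_ h0
    linarith
  have hzero : ∫ s, N.indicator e s ∂μ = 0 := by
    by_contra hne
    have hpos : 0 < ∫ s, N.indicator e s ∂μ := lt_of_le_of_ne (integral_nonneg hind) (Ne.symm hne)
    have ht : Filter.Tendsto (fun ε : ℝ => ε * (x - l)) (nhdsWithin 0 (Ioi 0))
        (nhdsWithin 0 (Ioi 0)) := by
      refine tendsto_nhdsWithin_iff.2 ⟨?_, ?_⟩
      · have : Filter.Tendsto (fun ε : ℝ => ε * (x - l)) (nhds 0) (nhds (0 * (x - l))) :=
          Filter.Tendsto.mul_const _ Filter.tendsto_id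
        rw [zero_mul] at this
        exact this.mono_left nhdsWithin_le_nhds
      · filter_upwards [self_mem_nhdsWithin] with ε hε using mul_pos hε hxl
    have h1 := ((hU.inada_zero.comp ht).atTop_mul_const hpos).eventually
      (Filter.eventually_gt_atTop (realReward U G δ x c))
    have h2 : ∀ᶠ ε : ℝ in nhdsWithin 0 (Ioi 0), ε < 1 :=
      nhdsWithin_le_nhds (gt_mem_nhds one_pos)
    obtain ⟨ε, ⟨h3, h4⟩, h5⟩ := ((h1.and h2).and self_mem_nhdsWithin).exists
    exact absurd (key ε h5 h4) (not_le.2 h3)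
  have hae := (integral_eq_zero_iff_of_nonneg hind hie).1 hzero
  filter_upwards [hae] with s hs
  by_contra hcs
  rw [indicator_of_mem (show s ∈ N from not_lt.1 hcs)] at hs
  exact (he_pos s).ne' hs

/-- Wealth equal to `l` at time `t` would leave nothing for the positive consumption on `(t, t +
1]`. -/
theorem AuxAdmissible.lt_wealthBetween (hc : AuxAdmissible l x c)
    (hpos : ∀ᵐ s ∂(discountMeasure δ), 0 < c s) {t : ℝ} (ht : 0 ≤ t) :
    l < wealthBetween x c t := by
  have h1 := hc.wealthBetween_sub ht (show 0 ≤ t + 1 by linarith)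
  have h2 := hc.le_wealthBetween (show 0 ≤ t + 1 by linarith)
  have hpos' : ∀ᵐ s ∂(volume.restrict (Ioc t (t + 1))), 0 < c s :=
    ae_mono (Measure.restrict_mono (fun s hs => ht.trans_lt hs.1) le_rfl)
      (ae_discountMeasure_iff.1 hpos)
  have h3 : 0 < ∫ u in t..(t + 1), c u := by
    rw [intervalIntegral.integral_pos_iff_support_of_nonneg_ae'
      (by rw [uIoc_of_le (by linarith)]; exact hpos'.mono fun s hs => hs.le)
      (hc.intervalIntegrable ht (by linarith))]
    refine ⟨by linarith, ?_⟩
    have h4 : volume (Ioc t (t + 1)) = 1 := by simp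
    have h5 : (Function.support c ∩ Ioc t (t + 1) : Set ℝ) =ᵐ[volume] Ioc t (t + 1) := by
      filter_upwards [(ae_restrict_iff' measurableSet_Ioc).1 hpos'] with s hs
      refine propext ⟨fun h => h.2, fun h => ⟨(hs h).ne', h⟩⟩
    rw [measure_congr h5, h4]
    exact one_pos
  linarith

end Positivity

/-! ### First-order conditions and the integrated Euler equation -/

theorem integral_mul_primitive {q η : ℝ → ℝ} {T : ℝ} (hq : IntervalIntegrable q volume 0 T)
    (hη : IntervalIntegrable η volume 0 T) :
    ∫ s in (0 : ℝ)..T, q s * ∫ u in (0 : ℝ)..s, η u =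
      (∫ s in (0 : ℝ)..T, q s) * (∫ s in (0 : ℝ)..T, η s) -
        ∫ s in (0 : ℝ)..T, (∫ u in (0 : ℝ)..s, q u) * η s := by
  have h1 := (hη.absolutelyContinuousOnInterval_intervalIntegral
    left_mem_uIcc).integral_mul_deriv_eq_deriv_mul
    (hq.absolutelyContinuousOnInterval_intervalIntegral left_mem_uIcc)
  have h2 : ∫ s in (0 : ℝ)..T, (∫ u in (0 : ℝ)..s, η u) * deriv (fun s => ∫ u in (0 : ℝ)..s, q u) s =
      ∫ s in (0 : ℝ)..T, q s * ∫ u in (0 : ℝ)..s, η u := by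
    refine intervalIntegral.integral_congr_ae ?_
    filter_upwards [hq.ae_hasDerivAt_integral] with s hs hsT
    rw [(hs (uIoc_subset_uIcc hsT) 0 left_mem_uIcc).deriv, mul_comm]
  have h3 : ∫ s in (0 : ℝ)..T, deriv (fun s => ∫ u in (0 : ℝ)..s, η u) s * ∫ u in (0 : ℝ)..s, q u =
      ∫ s in (0 : ℝ)..T, (∫ u in (0 : ℝ)..s, q u) * η s := by
    refine intervalIntegral.integral_congr_ae ?_
    filter_upwards [hη.ae_hasDerivAt_integral] with s hs hsT
    rw [(hs (uIoc_subset_uIcc hsT) 0 left_mem_uIcc).deriv, mul_comm]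
  rw [← h2, h1, h3]
  simp [mul_comm]

/-- A bounded perturbation of a consumption plan `c`, of zero mean, supported by times `s ≤ T`
with `r ≤ c s`. -/
structure IsVariation (c : ℝ → ℝ) (r T C : ℝ) (η : ℝ → ℝ) : Prop where
  measurable : Measurable η
  bound : ∀ s, |η s| ≤ C
  eq_zero : ∀ s, ¬ (s ≤ T ∧ r ≤ c s) → η s = 0
  integral_eq_zero : ∫ s in (0 : ℝ)..T, η s = 0

namespace IsVariation

variable {U G c η : ℝ → ℝ} {γ K₁ δ l x r T C : ℝ}

theorem intervalIntegrable (h : IsVariation c r T C η) (s t : ℝ) :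
    IntervalIntegrable η volume s t :=
  (intervalIntegrable_const (c := C)).mono_fun h.measurable.aestronglyMeasurable
    (Filter.Eventually.of_forall fun s => (h.bound s).trans (le_abs_self C))

theorem abs_primitive_le (h : IsVariation c r T C η) (hC : 0 ≤ C) {t : ℝ} (ht : 0 ≤ t)
    (htT : t ≤ T) : |∫ s in (0 : ℝ)..t, η s| ≤ C * T := by
  have h1 := intervalIntegral.norm_integral_le_of_norm_le_const (a := 0) (b := t) (f := η) (C := C)
    fun s _ => h.bound s
  rw [Real.norm_eq_abs, sub_zero, abs_of_nonneg ht] at h1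
  exact h1.trans (mul_le_mul_of_nonneg_left htT hC)

theorem primitive_eq_zero (h : IsVariation c r T C η) {t : ℝ} (htT : T ≤ t) :
    ∫ s in (0 : ℝ)..t, η s = 0 := by
  rw [← intervalIntegral.integral_add_adjacent_intervals (h.intervalIntegrable 0 T)
    (h.intervalIntegrable T t), h.integral_eq_zero, zero_add]
  refine intervalIntegral.integral_zero_ae (Filter.Eventually.of_forall fun s hs => ?_)
  rw [uIoc_of_le htT] at hs
  exact h.eq_zero s fun h' => absurd hs.1 (not_lt.2 h'.1)

theorem le_perturbed (h : IsVariation c r T C η) {ε s : ℝ} (hε : |ε| * C ≤ r / 2)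
    (hrc : r ≤ c s) : r / 2 ≤ c s + ε * η s := by
  have h1 : |ε * η s| ≤ r / 2 := by
    rw [abs_mul]
    exact (mul_le_mul_of_nonneg_left (h.bound s) (abs_nonneg ε)).trans hε
  linarith [(abs_le.1 h1).1]

theorem wealthBetween_add (h : IsVariation c r T C η) (hc : AuxAdmissible l x c) {ε t : ℝ}
    (ht : 0 ≤ t) : wealthBetween x (fun s => c s + ε * η s) t =
      wealthBetween x c t - ε * ∫ s in (0 : ℝ)..t, η s := by
  simp only [wealthBetween]
  rw [intervalIntegral.integral_add (hc.integrable t ht) ((h.intervalIntegrable 0 t).const_mul ε),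
    intervalIntegral.integral_const_mul]
  ring

theorem mid_le (h : IsVariation c r T C η) (hc : AuxAdmissible l x c) (hC : 0 ≤ C) {ε t : ℝ}
    (hε : |ε| * (C * T) ≤ (wealthBetween x c T - l) / 2) (ht : 0 ≤ t) (htT : t ≤ T) :
    (wealthBetween x c T + l) / 2 ≤ wealthBetween x c t - ε * ∫ s in (0 : ℝ)..t, η s := by
  have h1 : |ε * ∫ s in (0 : ℝ)..t, η s| ≤ (wealthBetween x c T - l) / 2 := by
    rw [abs_mul]
    exact (mul_le_mul_of_nonneg_left (h.abs_primitive_le hC ht htT) (abs_nonneg ε)).trans hε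
  linarith [(abs_le.1 h1).2, hc.wealthBetween_anti ht htT]

theorem auxAdmissible (h : IsVariation c r T C η) (hc : AuxAdmissible l x c) (hr : 0 ≤ r)
    (hC : 0 ≤ C) (hT : 0 ≤ T) {ε : ℝ} (hε : |ε| * C ≤ r / 2)
    (hε' : |ε| * (C * T) ≤ (wealthBetween x c T - l) / 2) :
    AuxAdmissible l x fun s => c s + ε * η s where
  measurable := hc.measurable.add (h.measurable.const_mul ε)
  nonneg s hs := by
    by_cases hA : s ≤ T ∧ r ≤ c s
    · exact le_trans (by positivity) (h.le_perturbed hε hA.2)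
    · rw [h.eq_zero s hA, mul_zero, add_zero]
      exact hc.nonneg s hs
  integrable t ht := (hc.integrable t ht).add ((h.intervalIntegrable 0 t).const_mul ε)
  budget t ht := by
    have h1 : l ≤ wealthBetween x (fun s => c s + ε * η s) t := by
      rw [h.wealthBetween_add hc ht]
      rcases le_total t T with htT | htT
      · have h1 := h.mid_le hc hC hε' ht htT
        have h2 := hc.le_wealthBetween hT
        linarith
      · rw [h.primitive_eq_zero htT, mul_zero, sub_zero]
        exact hc.le_wealthBetween ht
    rw [wealthBetween] at h1
    linarith

/-- First-order condition for optimal controls. -/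
theorem integral_eq_zero_of_isMax (h : IsVariation c r T C η) (hδ : 0 < δ) (hU : IsUtility U γ K₁)
    (hG : IsRunningReward G l) (hc : AuxAdmissible l x c)
    (hmax : ∀ c', AuxAdmissible l x c' → realReward U G δ x c' ≤ realReward U G δ x c)
    (hpos : ∀ᵐ s ∂(discountMeasure δ), 0 < c s) (hr : 0 < r) (hT : 0 < T) (hC : 0 < C) :
    ∫ s, (deriv U (c s) * η s - deriv G (wealthBetween x c s) * ∫ u in (0 : ℝ)..s, η u)
      ∂(discountMeasure δ) = 0 := by
  have := isFiniteMeasure_discountMeasure hδ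
  have hl : ∀ t, 0 ≤ t → l < wealthBetween x c t := fun t ht => hc.lt_wealthBetween hpos ht
  have hlT := hl T hT.le
  set m := (wealthBetween x c T + l) / 2 with hm
  have hlm : l < m := by
    rw [hm]
    linarith
  -- The first bound keeps the perturbed rate above `r / 2` where `η` acts; the second keeps the
  -- wealth above the midpoint `m` up to time `T`. Both signs of `ε` are allowed, so the derivative
  -- at 0 must vanish.
  set ε₀ := min (r / (2 * C)) ((wealthBetween x c T - l) / (2 * (C * T))) with hε₀
  have hε₀pos : 0 < ε₀ := lt_min (by positivity) (div_pos (by linarith) (by positivity))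
  have hsmall : ∀ ε ∈ Metric.ball (0 : ℝ) ε₀, |ε| * C ≤ r / 2 ∧
      |ε| * (C * T) ≤ (wealthBetween x c T - l) / 2 := by
    intro ε hε
    rw [mem_ball_zero_iff, Real.norm_eq_abs] at hε
    have h1 := hε.le.trans (min_le_left _ _)
    have h2 := hε.le.trans (min_le_right _ _)
    rw [le_div_iff₀ (by positivity)] at h1 h2
    constructor <;> linarith
  have hadm : ∀ ε ∈ Metric.ball (0 : ℝ) ε₀, AuxAdmissible l x fun s => c s + ε * η s :=
    fun ε hε => h.auxAdmissible hc hr.le hC.le hT.le (hsmall ε hε).1 (hsmall ε hε).2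
  set D : ℝ → ℝ := fun s => ∫ u in (0 : ℝ)..s, η u with hD
  have hDcont : Continuous D := intervalIntegral.continuous_primitive h.intervalIntegrable 0
  set F : ℝ → ℝ → ℝ := fun ε s => U (c s + ε * η s) + G (wealthBetween x c s - ε * D s) with hF
  set F' : ℝ → ℝ → ℝ := fun ε s => deriv U (c s + ε * η s) * η s -
    deriv G (wealthBetween x c s - ε * D s) * D s with hF'
  have hFeq : ∀ ε, (fun s => U (c s + ε * η s) +
      G (wealthBetween x (fun s => c s + ε * η s) s)) =ᵐ[discountMeasure δ] F ε := by
    intro ε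
    filter_upwards [ae_discountMeasure_pos δ] with s hs
    rw [h.wealthBetween_add hc hs.le]
  have hFint : ∀ ε ∈ Metric.ball (0 : ℝ) ε₀, Integrable (F ε) (discountMeasure δ) := fun ε hε =>
    ((hadm ε hε).integrable_total hδ hU hG).congr (hFeq ε)
  have hball : Metric.ball (0 : ℝ) ε₀ ∈ nhds (0 : ℝ) := Metric.ball_mem_nhds 0 hε₀pos
  have h0 : (0 : ℝ) ∈ Metric.ball (0 : ℝ) ε₀ := Metric.mem_ball_self hε₀pos
  -- Both marginals are decreasing, so on the ball they are dominated by their values at `r / 2` and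
  -- `m`.
  have key := hasDerivAt_integral_of_dominated_loc_of_deriv_le (μ := discountMeasure δ) (F := F)
    (F' := F') (x₀ := 0) (s := Metric.ball 0 ε₀)
    (bound := fun _ => deriv U (r / 2) * C + deriv G m * (C * T)) hball
    (by filter_upwards [hball] with ε hε using (hFint ε hε).aestronglyMeasurable)
    (hFint 0 h0) ?_ ?_ (integrable_const _) ?_
  · have hloc : IsLocalMax (fun ε => ∫ s, F ε s ∂(discountMeasure δ)) 0 := by
      filter_upwards [hball] with ε hε
      have h1 := hmax _ (hadm ε hε)
      have h2 : F 0 = fun s => U (c s) + G (wealthBetween x c s) := by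
        simp [hF]
      rw [realReward, integral_congr_ae (hFeq ε)] at h1
      change ∫ s, F ε s ∂_ ≤ ∫ s, F 0 s ∂_
      rw [h2]
      exact h1
    have h1 := hloc.hasDerivAt_eq_zero key.2
    simpa [hF'] using h1
  · refine AEStronglyMeasurable.sub ?_ ?_
    · exact (((measurable_deriv U).comp (hc.measurable.add (h.measurable.const_mul 0))).mul
        h.measurable).aestronglyMeasurable
    · refine (AEMeasurable.mul ?_ hDcont.measurable.aemeasurable).aestronglyMeasurable
      exact (measurable_deriv G).comp_aemeasurable
        (hc.aemeasurable_wealthBetween.sub (hDcont.measurable.const_mul 0).aemeasurable)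
  · filter_upwards [ae_discountMeasure_pos δ, hpos] with s hs hcs ε hε
    obtain ⟨e1, e2⟩ := hsmall ε hε
    have hd2 := hU.deriv_pos (show 0 < r / 2 by positivity)
    have hdm := hG.deriv_nonneg hlm
    have b1 : |deriv U (c s + ε * η s) * η s| ≤ deriv U (r / 2) * C := by
      by_cases hA : s ≤ T ∧ r ≤ c s
      · have h1 := h.le_perturbed e1 hA.2
        have h2 : 0 < r / 2 := by positivity
        rw [abs_mul, abs_of_pos (hU.deriv_pos (h2.trans_le h1))]
        exact mul_le_mul (hU.strictAntiOn_deriv.antitoneOn h2 (h2.trans_le h1) h1) (h.bound s)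
          (abs_nonneg _) hd2.le
      · rw [h.eq_zero s hA, mul_zero, abs_zero]
        positivity
    have b2 : |deriv G (wealthBetween x c s - ε * D s) * D s| ≤ deriv G m * (C * T) := by
      rcases le_total s T with hsT | hsT
      · have h1 := h.mid_le hc hC.le e2 hs.le hsT
        rw [abs_mul, abs_of_nonneg (hG.deriv_nonneg (hlm.trans_le h1))]
        exact mul_le_mul (hG.antitoneOn_deriv hlm (hlm.trans_le h1) h1)
          (h.abs_primitive_le hC.le hs.le hsT) (abs_nonneg _) hdm
      · simp only [hD, h.primitive_eq_zero hsT, mul_zero, abs_zero]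
        positivity
    exact (abs_sub _ _).trans (add_le_add b1 b2)
  · filter_upwards [ae_discountMeasure_pos δ, hpos] with s hs hcs ε hε
    obtain ⟨e1, e2⟩ := hsmall ε hε
    have p1 : 0 < c s + ε * η s := by
      by_cases hA : s ≤ T ∧ r ≤ c s
      · exact lt_of_lt_of_le (by positivity) (h.le_perturbed e1 hA.2)
      · rwa [h.eq_zero s hA, mul_zero, add_zero]
    have p2 : l < wealthBetween x c s - ε * D s := by
      rcases le_total s T with hsT | hsT
      · exact hlm.trans_le (h.mid_le hc hC.le e2 hs.le hsT)
      · simp only [hD, h.primitive_eq_zero hsT, mul_zero, sub_zero]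
        exact hl s hs.le
    have q1 : HasDerivAt (fun ε => c s + ε * η s) (η s) ε := by
      simpa using ((hasDerivAt_id ε).mul_const (η s)).const_add (c s)
    have q2 : HasDerivAt (fun ε => wealthBetween x c s - ε * D s) (-D s) ε := by
      simpa using ((hasDerivAt_id ε).mul_const (D s)).const_sub (wealthBetween x c s)
    have r1 := (hU.hasDerivAt p1).comp ε q1
    have r2 := (hG.differentiableAt _ p2).hasDerivAt.comp ε q2
    have r3 := r1.add r2
    rw [mul_neg, ← sub_eq_add_neg] at r3
    exact r3

end IsVariation

/-- The fundamental lemma of the calculus of variations for zero-mean test functions supported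
in a set. -/
theorem exists_ae_eq_const_of_forall_integral_eq_zero {α : Type*} [MeasurableSpace α]
    {μ : Measure α} {A : Set α} (hA : MeasurableSet A) (hμA : μ A ≠ ⊤) {f : α → ℝ}
    (hf : Measurable f) {B : ℝ} (hB : ∀ s ∈ A, |f s| ≤ B)
    (h : ∀ (η : α → ℝ) (C : ℝ), 0 < C → Measurable η → (∀ s, |η s| ≤ C) → (∀ s ∉ A, η s = 0) →
      ∫ s, η s ∂μ = 0 → ∫ s, f s * η s ∂μ = 0) :
    ∃ m, ∀ᵐ s ∂μ, s ∈ A → f s = m := by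
  by_cases hA0 : μ A = 0
  · exact ⟨0, (measure_eq_zero_iff_ae_notMem.1 hA0).mono fun s hs hsA => absurd hsA hs⟩
  have hV : 0 < μ.real A := ENNReal.toReal_pos hA0 hμA
  have hfin : IsFiniteMeasure (μ.restrict A) := ⟨by simpa using hμA.lt_top⟩
  have hfA : IntegrableOn f A μ := Integrable.mono' (integrable_const B) hf.aestronglyMeasurable
    ((ae_restrict_iff' hA).2 (Filter.Eventually.of_forall hB))
  -- The test function is `f` minus its mean over `A`, cut off to `A`. It has zero mean, and testing
  -- against it gives the integral of its square.
  set m := (∫ s in A, f s ∂μ) / μ.real A with hm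
  have hfm : IntegrableOn (fun s => f s - m) A μ := hfA.sub (integrable_const m)
  set η : α → ℝ := A.indicator fun s => f s - m with hη
  have hηm : Measurable η := (hf.sub measurable_const).indicator hA
  have hηi : Integrable η μ := hfm.integrable_indicator hA
  have hη0 : ∫ s, η s ∂μ = 0 := by
    rw [hη, integral_indicator hA, integral_sub hfA (integrable_const m), setIntegral_const,
      smul_eq_mul, hm]
    field_simp
    ring
  have hηb : ∀ s, |η s| ≤ |B| + |m| + 1 := by
    intro s
    by_cases hs : s ∈ A
    · rw [hη, indicator_of_mem hs]
      have h1 := abs_sub (f s) m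
      have h2 := (hB s hs).trans (le_abs_self B)
      linarith
    · rw [hη, indicator_of_notMem hs, abs_zero]
      positivity
  have hz := h η (|B| + |m| + 1) (by positivity) hηm hηb
    (fun s hs => indicator_of_notMem hs _) hη0
  have hsq : ∀ s, η s * η s = f s * η s - m * η s := by
    intro s
    by_cases hs : s ∈ A
    · simp only [hη, indicator_of_mem hs]
      ring
    · simp only [hη, indicator_of_notMem hs]
      ring
  have hi2 : Integrable (fun s => η s * η s) μ :=
    hηi.bdd_mul (c := |B| + |m| + 1) hηm.aestronglyMeasurable (Filter.Eventually.of_forall hηb)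
  have hi1 : Integrable (fun s => f s * η s) μ := by
    refine (hi2.add (hηi.const_mul m)).congr (Filter.Eventually.of_forall fun s => ?_)
    simp only [Pi.add_apply, hsq]
    ring
  have h2 : ∫ s, η s * η s ∂μ = 0 := by
    simp_rw [hsq]
    rw [integral_sub hi1 (hηi.const_mul m), integral_const_mul, hη0, hz]
    ring
  refine ⟨m, ?_⟩
  filter_upwards [(integral_eq_zero_iff_of_nonneg (fun s => mul_self_nonneg (η s)) hi2).1 h2]
    with s hs hsA
  have h3 : η s = 0 := mul_self_eq_zero.1 hs
  rw [hη, indicator_of_mem hsA] at h3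
  linarith

/-- Once some `A N` has positive measure, it lies in all later sets, and overlap forces their
constants to agree with the one on `A N`. -/
theorem exists_ae_eq_const_of_iUnion {α : Type*} [MeasurableSpace α] {μ : Measure α}
    {A : ℕ → Set α} (hA : Monotone A) {f : α → ℝ}
    (h : ∀ n, ∃ m, ∀ᵐ s ∂μ, s ∈ A n → f s = m) :
    ∃ m, ∀ᵐ s ∂μ, s ∈ ⋃ n, A n → f s = m := by
  by_cases h0 : ∀ n, μ (A n) = 0
  · exact ⟨0, (measure_eq_zero_iff_ae_notMem.1 (measure_iUnion_null h0)).mono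
      fun s hs hsA => absurd hsA hs⟩
  push Not at h0
  obtain ⟨N, hN⟩ := h0
  choose m hm using h
  refine ⟨m N, ?_⟩
  filter_upwards [ae_all_iff.2 hm] with s hs hsA
  obtain ⟨n, hn⟩ := mem_iUnion.1 hsA
  have hk : s ∈ A (max n N) := hA (le_max_left n N) hn
  rw [hs _ hk]
  by_contra hne
  refine hN (measure_mono_null (fun u hu => ?_) (ae_iff.1 ((hm N).and (hm (max n N)))))
  rintro ⟨h1, h2⟩
  exact hne ((h2 (hA (le_max_right n N) hu)).symm.trans (h1 hu))

/-- Discounted marginal running reward along the wealth path, extended by `Y_0` to negative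
times. -/
noncomputable def marginalReward (G : ℝ → ℝ) (δ x : ℝ) (c : ℝ → ℝ) (s : ℝ) : ℝ :=
  Real.exp (-δ * s) * deriv G (wealthBetween x c (max s 0))

section Euler

variable {U G c η : ℝ → ℝ} {γ K₁ δ l x r T C : ℝ}

theorem AuxAdmissible.continuous_wealthBetween_max (hc : AuxAdmissible l x c) :
    Continuous fun s => wealthBetween x c (max s 0) :=
  hc.continuousOn_wealthBetween.comp_continuous (by fun_prop) fun s => le_max_right s 0

theorem continuous_marginalReward (hG : IsRunningReward G l) (hc : AuxAdmissible l x c)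
    (hl : ∀ t, 0 ≤ t → l < wealthBetween x c t) : Continuous (marginalReward G δ x c) :=
  (by fun_prop : Continuous fun s => Real.exp (-δ * s)).mul
    (hG.continuousOn_deriv.comp_continuous hc.continuous_wealthBetween_max
      fun s => hl _ (le_max_right s 0))

theorem marginalReward_nonneg (hG : IsRunningReward G l)
    (hl : ∀ t, 0 ≤ t → l < wealthBetween x c t) (s : ℝ) : 0 ≤ marginalReward G δ x c s :=
  mul_nonneg (Real.exp_pos _).le (hG.deriv_nonneg (hl _ (le_max_right s 0)))

/-- Integrating by parts moves the primitive from `η` to the marginal reward; the boundary term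
vanishes because `η` has zero mean. The first-order condition becomes orthogonality to `η` itself.
-/
theorem IsVariation.integral_mul_eq_zero (h : IsVariation c r T C η) (hδ : 0 < δ)
    (hU : IsUtility U γ K₁) (hG : IsRunningReward G l) (hc : AuxAdmissible l x c)
    (hmax : ∀ c', AuxAdmissible l x c' → realReward U G δ x c' ≤ realReward U G δ x c)
    (hpos : ∀ᵐ s ∂(discountMeasure δ), 0 < c s) (hr : 0 < r) (hT : 0 < T) (hC : 0 < C) :
    ∫ s in (0 : ℝ)..T, (Real.exp (-δ * s) * deriv U (c s) +
      ∫ u in (0 : ℝ)..s, marginalReward G δ x c u) * η s = 0 := by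
  have hl : ∀ t, 0 ≤ t → l < wealthBetween x c t := fun t ht => hc.lt_wealthBetween hpos ht
  have hq := continuous_marginalReward (δ := δ) hG hc hl
  have hη := h.intervalIntegrable 0 T
  have hDcont : Continuous fun s => ∫ u in (0 : ℝ)..s, η u :=
    intervalIntegral.continuous_primitive h.intervalIntegrable 0
  have hQcont : Continuous fun s => ∫ u in (0 : ℝ)..s, marginalReward G δ x c u :=
    intervalIntegral.continuous_primitive (fun a b => hq.intervalIntegrable a b) 0
  have i1 : IntervalIntegrable (fun s => Real.exp (-δ * s) * (deriv U (c s) * η s)) volume 0 T := by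
    refine IntervalIntegrable.continuousOn_mul ?_ (by fun_prop)
    refine (intervalIntegrable_const (c := deriv U r * C)).mono_fun
      (((measurable_deriv U).comp hc.measurable).mul h.measurable).aestronglyMeasurable
      (Filter.Eventually.of_forall fun s => ?_)
    have hd := hU.deriv_pos hr
    change |deriv U (c s) * η s| ≤ |deriv U r * C|
    rw [abs_of_nonneg (show 0 ≤ deriv U r * C by positivity), abs_mul]
    by_cases hA : s ≤ T ∧ r ≤ c s
    · rw [abs_of_pos (hU.deriv_pos (hr.trans_le hA.2))]
      exact mul_le_mul (hU.strictAntiOn_deriv.antitoneOn hr (hr.trans_le hA.2) hA.2) (h.bound s)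
        (abs_nonneg _) hd.le
    · rw [h.eq_zero s hA, abs_zero, mul_zero]
      positivity
  have i2 : IntervalIntegrable (fun s => marginalReward G δ x c s * ∫ u in (0 : ℝ)..s, η u)
      volume 0 T := (hq.mul hDcont).intervalIntegrable _ _
  have i3 : IntervalIntegrable (fun s => (∫ u in (0 : ℝ)..s, marginalReward G δ x c u) * η s)
      volume 0 T := hη.continuousOn_mul hQcont.continuousOn
  have h1 := h.integral_eq_zero_of_isMax hδ hU hG hc hmax hpos hr hT hC
  rw [integral_discountMeasure, setIntegral_eq_of_subset_of_forall_sdiff_eq_zero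
    (s := Ioc 0 T) measurableSet_Ioi Ioc_subset_Ioi_self, ← intervalIntegral.integral_of_le hT.le]
    at h1
  · have h2 : ∫ s in (0 : ℝ)..T, Real.exp (-δ * s) * (deriv U (c s) * η s -
        deriv G (wealthBetween x c s) * ∫ u in (0 : ℝ)..s, η u) =
        ∫ s in (0 : ℝ)..T, (Real.exp (-δ * s) * (deriv U (c s) * η s) -
          marginalReward G δ x c s * ∫ u in (0 : ℝ)..s, η u) := by
      refine intervalIntegral.integral_congr fun s hs => ?_
      rw [uIcc_of_le hT.le] at hs
      simp only [marginalReward, max_eq_left hs.1]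
      ring
    rw [h2, intervalIntegral.integral_sub i1 i2,
      integral_mul_primitive (hq.intervalIntegrable _ _) hη, h.integral_eq_zero] at h1
    rw [mul_zero, zero_sub, sub_neg_eq_add, ← intervalIntegral.integral_add i1 i3] at h1
    refine Eq.trans ?_ h1
    congr 1
    funext s
    ring
  · intro s hs
    have hs1 : (0 : ℝ) < s := hs.1
    have hs2 : T < s := by
      by_contra hh
      exact hs.2 ⟨hs1, not_lt.1 hh⟩
    rw [h.primitive_eq_zero hs2.le, h.eq_zero s fun h' => absurd h'.1 (not_le.2 hs2)]
    ring

/-- Integrated Euler equation. -/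
theorem exists_ae_euler (hδ : 0 < δ)
    (hU : IsUtility U γ K₁) (hG : IsRunningReward G l) (hc : AuxAdmissible l x c)
    (hmax : ∀ c', AuxAdmissible l x c' → realReward U G δ x c' ≤ realReward U G δ x c)
    (hpos : ∀ᵐ s ∂(discountMeasure δ), 0 < c s) :
    ∃ m, ∀ᵐ s ∂(volume.restrict (Ioi (0 : ℝ))), Real.exp (-δ * s) * deriv U (c s) +
      ∫ u in (0 : ℝ)..s, marginalReward G δ x c u = m := by
  have hl : ∀ t, 0 ≤ t → l < wealthBetween x c t := fun t ht => hc.lt_wealthBetween hpos ht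
  have hq := continuous_marginalReward (δ := δ) hG hc hl
  have hQcont : Continuous fun s => ∫ u in (0 : ℝ)..s, marginalReward G δ x c u :=
    intervalIntegral.continuous_primitive (fun a b => hq.intervalIntegrable a b) 0
  set f : ℝ → ℝ := fun s => Real.exp (-δ * s) * deriv U (c s) +
    ∫ u in (0 : ℝ)..s, marginalReward G δ x c u with hf
  have hfm : Measurable f := Measurable.add
    ((by fun_prop : Measurable fun s => Real.exp (-δ * s)).mul
      ((measurable_deriv U).comp hc.measurable)) hQcont.measurable
  -- These sets increase and exhaust almost all positive times, since `c > 0` almost everywhere; on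
  -- each of them `U'(c)` is bounded.
  set A : ℕ → Set ℝ := fun n => Ioc 0 ((n : ℝ) + 1) ∩ {s | 1 / ((n : ℝ) + 1) ≤ c s} with hA
  have hAmono : Monotone A := by
    intro n k hnk s hs
    have h1 : (n : ℝ) ≤ k := by exact_mod_cast hnk
    have h2 : 1 / ((k : ℝ) + 1) ≤ 1 / ((n : ℝ) + 1) := by gcongr
    exact ⟨⟨hs.1.1, hs.1.2.trans (by linarith)⟩, h2.trans hs.2⟩
  have hAm : ∀ n, MeasurableSet (A n) := fun n =>
    measurableSet_Ioc.inter (measurableSet_le measurable_const hc.measurable)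
  have hAeq : ∀ n, ∃ m, ∀ᵐ s ∂(volume : Measure ℝ), s ∈ A n → f s = m := by
    intro n
    have hr : 0 < 1 / ((n : ℝ) + 1) := by positivity
    have hT : 0 < (n : ℝ) + 1 := by positivity
    refine exists_ae_eq_const_of_forall_integral_eq_zero (hAm n)
      (measure_ne_top_of_subset inter_subset_left (by simp)) hfm
      (B := deriv U (1 / ((n : ℝ) + 1)) + ∫ u in (0 : ℝ)..((n : ℝ) + 1), marginalReward G δ x c u)
      (fun s hs => ?_) ?_
    · have hcs : 0 < c s := hr.trans_le hs.2
      have h1 : Real.exp (-δ * s) ≤ 1 := Real.exp_le_one_iff.2 (by nlinarith [hs.1.1])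
      have h2 : deriv U (c s) ≤ deriv U (1 / ((n : ℝ) + 1)) :=
        hU.strictAntiOn_deriv.antitoneOn hr hcs hs.2
      have h3 := hU.deriv_pos hcs
      have h4 : 0 ≤ ∫ u in (0 : ℝ)..s, marginalReward G δ x c u :=
        intervalIntegral.integral_nonneg hs.1.1.le fun u _ => marginalReward_nonneg hG hl u
      have h5 : ∫ u in (0 : ℝ)..s, marginalReward G δ x c u ≤
          ∫ u in (0 : ℝ)..((n : ℝ) + 1), marginalReward G δ x c u :=
        intervalIntegral.integral_mono_interval le_rfl hs.1.1.le hs.1.2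
          (Filter.Eventually.of_forall (marginalReward_nonneg hG hl)) (hq.intervalIntegrable _ _)
      have h6 := Real.exp_pos (-δ * s)
      rw [abs_of_nonneg (add_nonneg (mul_nonneg h6.le h3.le) h4)]
      nlinarith
    · intro η C hC hηm hηb hη0 hηi
      have hsupp : ∀ F : ℝ → ℝ, ∫ s, F s * η s = ∫ s in (0 : ℝ)..((n : ℝ) + 1), F s * η s := by
        intro F
        rw [intervalIntegral.integral_of_le hT.le]
        refine (setIntegral_eq_integral_of_forall_compl_eq_zero fun s hs => ?_).symm
        rw [hη0 s fun h => hs h.1, mul_zero]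
      have hvar : IsVariation c (1 / ((n : ℝ) + 1)) ((n : ℝ) + 1) C
          (fun s => η s) := by
        refine ⟨hηm, hηb, fun s hs => hη0 s fun h => hs ⟨h.1.2, h.2⟩, ?_⟩
        have := hsupp fun _ => 1
        simp only [one_mul] at this
        rw [← this, hηi]
      rw [hsupp f]
      exact hvar.integral_mul_eq_zero hδ hU hG hc hmax hpos hr hT hC
  obtain ⟨m, hm⟩ := exists_ae_eq_const_of_iUnion hAmono hAeq
  refine ⟨m, ?_⟩
  filter_upwards [ae_restrict_of_ae hm, ae_restrict_mem measurableSet_Ioi,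
    ae_discountMeasure_iff.1 hpos] with s h1 h2 h3
  refine h1 (mem_iUnion.2 ?_)
  obtain ⟨n, hn⟩ := exists_nat_gt s
  obtain ⟨k, hk⟩ := exists_nat_one_div_lt h3
  have h4 : (n : ℝ) ≤ (max n k : ℕ) := by exact_mod_cast le_max_left n k
  have h5 : (k : ℝ) ≤ (max n k : ℕ) := by exact_mod_cast le_max_right n k
  have h6 : 1 / (((max n k : ℕ) : ℝ) + 1) ≤ 1 / ((k : ℝ) + 1) := by gcongr
  exact ⟨max n k, ⟨h2, by linarith⟩, h6.trans hk.le⟩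

end Euler

/-! ### Inverting the marginal utility and regularity of the wealth path -/

namespace IsUtility

variable {U : ℝ → ℝ} {γ K₁ : ℝ}

/-- The two Inada conditions bracket `w`, and continuity of `U'` supplies the intermediate value. -/
theorem exists_deriv_eq (hU : IsUtility U γ K₁) {w : ℝ} (hw : 0 < w) :
    ∃ y, 0 < y ∧ deriv U y = w := by
  obtain ⟨y₁, h1, h1'⟩ := ((hU.inada_zero.eventually (Filter.eventually_gt_atTop w)).and
    self_mem_nhdsWithin).exists
  obtain ⟨y₂, h2, h2'⟩ := ((hU.inada_top.eventually (gt_mem_nhds hw)).and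
    (Filter.eventually_ge_atTop y₁)).exists
  have h1'' : (0 : ℝ) < y₁ := h1'
  obtain ⟨y, hy, hyw⟩ := intermediate_value_Icc' h2'
    (hU.continuousOn_deriv.mono fun z hz => h1''.trans_le hz.1) ⟨h2.le, h1.le⟩
  exact ⟨y, h1''.trans_le hy.1, hyw⟩

/-- The marginal utility has a differentiable inverse. -/
theorem exists_inverse_deriv (hU : IsUtility U γ K₁) (hU2 : ContDiffOn ℝ 2 U (Ioi 0))
    (hU2neg : ∀ c : ℝ, 0 < c → deriv (deriv U) c < 0) :
    ∃ I : ℝ → ℝ, (∀ w, 0 < w → 0 < I w ∧ deriv U (I w) = w) ∧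
      (∀ y, 0 < y → I (deriv U y) = y) ∧
      ∀ w, 0 < w → HasDerivAt I (deriv (deriv U) (I w))⁻¹ w := by
  classical
  choose! I hI using fun w (hw : 0 < w) => hU.exists_deriv_eq hw
  have hleft : ∀ y, 0 < y → I (deriv U y) = y := fun y hy =>
    hU.strictAntiOn_deriv.injOn (hI _ (hU.deriv_pos hy)).1 hy (hI _ (hU.deriv_pos hy)).2
  refine ⟨I, hI, hleft, fun w hw => ?_⟩
  obtain ⟨h1, h2⟩ := hI w hw
  have hd1 : ContDiffOn ℝ 1 (deriv U) (Ioi 0) :=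
    ((contDiffOn_succ_iff_deriv_of_isOpen (n := 1) isOpen_Ioi).1
      (by rw [one_add_one_eq_two]; exact hU2)).2.2
  have hs : HasStrictDerivAt (deriv U) (deriv (deriv U) (I w)) (I w) :=
    (hd1.contDiffAt (Ioi_mem_nhds h1)).hasStrictDerivAt one_ne_zero
  have h3 := (hs.to_local_left_inverse (g := I) (hU2neg _ h1).ne
    (by filter_upwards [lt_mem_nhds h1] with y hy using hleft y hy)).hasDerivAt
  rwa [h2] at h3

end IsUtility

section Regularity

variable {U G c : ℝ → ℝ} {γ K₁ δ l x : ℝ}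

/-- Regularity of optimal wealth paths and the Euler equation. -/
theorem exists_consumption_of_isAuxOptimal (hδ : 0 < δ) (hU : IsUtility U γ K₁)
    (hU2 : ContDiffOn ℝ 2 U (Ioi 0)) (hU2neg : ∀ c : ℝ, 0 < c → deriv (deriv U) c < 0)
    (hG : IsRunningReward G l) (hx : l < x) (hc : IsAuxOptimal U G δ l x c) :
    ∃ κ : ℝ → ℝ, ∀ t : ℝ, 0 ≤ t →
      HasDerivWithinAt (wealthBetween x c) (-κ t) (Ici 0) t ∧ 0 < κ t ∧
      l < wealthBetween x c t ∧ DifferentiableAt ℝ G (wealthBetween x c t) ∧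
      HasDerivWithinAt (fun s => -κ s)
        ((deriv G (wealthBetween x c t) - δ * deriv U (κ t)) / deriv (deriv U) (κ t))
        (Ici 0) t := by
  obtain ⟨hca, hmax⟩ := (isAuxOptimal_iff hδ hU hG).1 hc
  have hpos := ae_pos_of_isMax hδ hU hG hx hca hmax
  have hl : ∀ t, 0 ≤ t → l < wealthBetween x c t := fun t ht => hca.lt_wealthBetween hpos ht
  have hq := continuous_marginalReward (δ := δ) hG hca hl
  have hqi : ∀ a b, IntervalIntegrable (marginalReward G δ x c) volume a b :=
    fun a b => hq.intervalIntegrable a b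
  have hpos' := ae_discountMeasure_iff.1 hpos
  obtain ⟨m, hm⟩ := exists_ae_euler hδ hU hG hca hmax hpos
  obtain ⟨I, hI1, hI2, hI3⟩ := hU.exists_inverse_deriv hU2 hU2neg
  set Q : ℝ → ℝ := fun s => ∫ u in (0 : ℝ)..s, marginalReward G δ x c u with hQ
  have hQmono : Monotone Q := by
    intro s t hst
    have h1 := intervalIntegral.integral_add_adjacent_intervals (hqi 0 s) (hqi s t)
    have h2 := intervalIntegral.integral_nonneg (μ := volume) hst
      fun u _ => marginalReward_nonneg (δ := δ) hG hl u
    simp only [hQ]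
    linarith
  -- At some later time `u` the Euler equation holds with a strictly positive marginal utility term,
  -- and `Q` is nondecreasing.
  have hmQ : ∀ s, 0 < m - Q s := by
    intro s
    have h1 : ∀ᵐ u ∂(volume.restrict (Ioi (max s 0))),
        Real.exp (-δ * u) * deriv U (c u) + Q u = m ∧ 0 < c u :=
      ae_mono (Measure.restrict_mono (Ioi_subset_Ioi (le_max_right s 0)) le_rfl) (hm.and hpos')
    have : (ae (volume.restrict (Ioi (max s 0)))).NeBot := by
      rw [ae_neBot, Ne, Measure.restrict_eq_zero]
      simp
    obtain ⟨u, ⟨h2, h3⟩, h4⟩ := (h1.and (ae_restrict_mem measurableSet_Ioi)).exists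
    have h5 : Q s ≤ Q u := hQmono ((le_max_left s 0).trans (le_of_lt h4))
    have h6 := mul_pos (Real.exp_pos (-δ * u)) (hU.deriv_pos h3)
    linarith
  -- This is the marginal utility prescribed by the Euler equation. It is defined and differentiable
  -- on all of `ℝ`, also where the equation fails for `c` on a null set.
  set w : ℝ → ℝ := fun s => Real.exp (δ * s) * (m - Q s) with hw
  have hwpos : ∀ s, 0 < w s := fun s => mul_pos (Real.exp_pos _) (hmQ s)
  have hwd : ∀ s, HasDerivAt w (δ * w s - Real.exp (δ * s) * marginalReward G δ x c s) s := by
    intro s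
    have h1 : HasDerivAt (fun s => Real.exp (δ * s)) (Real.exp (δ * s) * δ) s := by
      simpa using ((hasDerivAt_id s).const_mul δ).exp
    have h2 : HasDerivAt Q (marginalReward G δ x c s) s :=
      intervalIntegral.integral_hasDerivAt_right (hqi 0 s)
        (hq.stronglyMeasurableAtFilter _ _) hq.continuousAt
    refine (h1.mul (h2.const_sub m)).congr_deriv ?_
    simp only [hw]
    ring
  set κ : ℝ → ℝ := fun s => I (w s) with hκ
  have hκpos : ∀ s, 0 < κ s := fun s => (hI1 _ (hwpos s)).1
  have hκU : ∀ s, deriv U (κ s) = w s := fun s => (hI1 _ (hwpos s)).2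
  have hκd : ∀ s, HasDerivAt κ ((deriv (deriv U) (κ s))⁻¹ *
      (δ * w s - Real.exp (δ * s) * marginalReward G δ x c s)) s := fun s =>
    (hI3 _ (hwpos s)).comp s (hwd s)
  have hκc : Continuous κ := continuous_iff_continuousAt.2 fun s => (hκd s).continuousAt
  have hcκ : ∀ᵐ s ∂(volume.restrict (Ioi (0 : ℝ))), c s = κ s := by
    filter_upwards [hm, hpos'] with s h1 h2
    have h3 : deriv U (c s) = w s := by
      have h4 : Real.exp (δ * s) * Real.exp (-δ * s) = 1 := by
        rw [← Real.exp_add]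
        simp
      have h5 : m - Q s = Real.exp (-δ * s) * deriv U (c s) := by linarith
      simp only [hw]
      rw [h5, ← mul_assoc, h4, one_mul]
    simp only [hκ]
    rw [← h3, hI2 _ h2]
  have hY : ∀ t ∈ Ici (0 : ℝ), wealthBetween x c t = x - ∫ s in (0 : ℝ)..t, κ s := by
    intro t ht
    rw [wealthBetween, intervalIntegral.integral_of_le ht, intervalIntegral.integral_of_le ht,
      integral_congr_ae (ae_mono (Measure.restrict_mono Ioc_subset_Ioi_self le_rfl) hcκ)]
  refine ⟨κ, fun t ht => ⟨?_, hκpos t, hl t ht, hG.differentiableAt _ (hl t ht), ?_⟩⟩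
  · have h1 : HasDerivAt (fun t => ∫ s in (0 : ℝ)..t, κ s) (κ t) t :=
      intervalIntegral.integral_hasDerivAt_right (hκc.intervalIntegrable _ _)
        (hκc.stronglyMeasurableAtFilter _ _) hκc.continuousAt
    exact (h1.const_sub x).hasDerivWithinAt.congr hY (hY t ht)
  · refine ((hκd t).neg.congr_deriv ?_).hasDerivWithinAt
    -- Only for `t ≥ 0` does the extended marginal reward involve `Y_t` itself, hence the one-sided
    -- statement at 0.
    have h1 : Real.exp (δ * t) * marginalReward G δ x c t = deriv G (wealthBetween x c t) := by
      rw [marginalReward, max_eq_left ht, ← mul_assoc, ← Real.exp_add]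
      simp
    rw [h1, hκU, div_eq_inv_mul]
    ring

end Regularity

theorem mainTheorem8 {Ω : Type*} [MeasurableSpace Ω] (P : Measure Ω) [IsProbabilityMeasure P]
    (lam ρ : ℝ) (hlam : 0 < lam) (hρ : 0 < ρ)
    (p : Measure ℝ) (zlo : ℝ) (zhi : EReal) (kap b : ℝ) (hp : IsReturnLaw p zlo zhi kap b)
    (M : IlliquidMarket P lam p)
    (U : ℝ → ℝ) (γ K₁ : ℝ) (hU : IsUtility U γ K₁)
    (hρb : b * γ + lam * (kap ^ γ / zlo ^ γ - 1) < ρ)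
    (hU2 : ContDiffOn ℝ 2 U (Ioi 0))
    (hU2neg : ∀ c : ℝ, 0 < c → deriv (deriv U) c < 0)
    (a : ℝ) (ha : a ∈ investmentSet zhi) (x : ℝ) (hx : lowerWealth zlo zhi a < x) :
    (∃ c : ℝ → ℝ, IsAuxOptimal U (M.g U ρ a) (ρ + lam) (lowerWealth zlo zhi a) x c) ∧
    ∀ c : ℝ → ℝ, IsAuxOptimal U (M.g U ρ a) (ρ + lam) (lowerWealth zlo zhi a) x c →
      ∃ κ : ℝ → ℝ, ∀ t : ℝ, 0 ≤ t →
        HasDerivWithinAt (wealthBetween x c) (-κ t) (Ici 0) t ∧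
        0 < κ t ∧
        lowerWealth zlo zhi a < wealthBetween x c t ∧
        DifferentiableAt ℝ (M.g U ρ a) (wealthBetween x c t) ∧
        HasDerivWithinAt (fun s => -κ s)
          ((deriv (M.g U ρ a) (wealthBetween x c t) - (ρ + lam) * deriv U (κ t)) /
            deriv (deriv U) (κ t)) (Ici 0) t := by
  have hδ : 0 < ρ + lam := by positivity
  have hG := M.isRunningReward_g hlam hρ hp hU hρb ha
  exact ⟨exists_isAuxOptimal hδ hU hG hx.le,
    fun c hc => exists_consumption_of_isAuxOptimal hδ hU hU2 hU2neg hG hx hc⟩
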